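/- **Theorem 7.1.** Let $k$ be a commutative ring and let $S$ be a simplicial set with exactly one vertex, $S_0=\{x\}$. Then there is an isomorphism of differential graded algebras over $k$ (an isomorphism of $k$-algebras that preserves the grading and commutes with the differentials) $$\Lambda(S)(x,x)\;\cong\;\Omega Q_\Delta(S),$$ where the two sides are defined as follows. *Necklaces.* A necklace is a simplicial set $T=\Delta^{n_1}\vee\dots\vee\Delta^{n_m}$ with all $n_i\ge 1$, or $T=\Delta^0$ (the case $m=0$), where the last vertex of each $\Delta^{n_i}$ is glued to the first vertex of $\Delta^{n_{i+1}}$. Its set of vertices $V_T$ is totally ordered, with first vertex $\alpha_T$ and last vertex $\omega_T$; $J_T\subseteq V_T$ is the set of first and last vertices of beads (for $T=\Delta^0$, its single vertex); put $N_T=|V_T\setminus J_T|$. A morphism of necklaces is a map of simplicial sets preserving first and last vertices. For such $f:T\to T'$, the map $X\mapsto f(X)$ sends sets $X$ with $J_T\subseteq X\subseteq V_T$ to sets $X'$ with $J_{T'}\subseteq X'\subseteq V_{T'}$. Recording membership of the elements of $V_T\setminus J_T$, in increasing order, identifies this with a map $P_{\mathbf 1}(f):\{0,1\}^{N_T}\to\{0,1\}^{N_{T'}}$.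 *Cubical sets with connections.* Let $\square_c$ be the category with objects $\mathbf 1^n=\{0,1\}^n$, $n\ge0$, and with morphisms generated by the maps $$\delta^\epsilon_j(s_1,\dots,s_n)=(s_1,\dots,s_{j-1},\epsilon,s_j,\dots,s_n)\quad(1\le j\le n+1,\ \epsilon\in\{0,1\}),$$ $$\varepsilon_j(s_1,\dots,s_n)=(s_1,\dots,s_{j-1},s_{j+1},\dots,s_n)\quad(1\le j\le n),$$ $$\gamma_j(s_1,\dots,s_n)=(s_1,\dots,s_{j-1},\max(s_j,s_{j+1}),s_{j+2},\dots,s_n)\quad(1\le j\le n-1).$$ A cubical set with connections is a presheaf of sets $K$ on $\square_c$; write $K_n=K(\mathbf 1^n)$, and write $\partial^\epsilon_j=K(\delta^\epsilon_j)$ for its faces. An $n$-cell is degenerate if it lies in the image of some $K(\varepsilon_j)$ or $K(\gamma_j)$ from $K_{n-1}$. Let $\square_c^n$ be the presheaf represented by $\mathbf 1^n$. Each $P_{\mathbf 1}(f)$ is a morphism of $\square_c$. *The left-hand side.* Put $$\mathfrak C_{\square_c}(S)(x,x)=\operatorname*{colim}_{(T\to S)}\ \square_c^{N_T},$$ the colimit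 over the category of necklaces $T$ with a simplicial map $t:T\to S$ such that $t(\alpha_T)=t(\omega_T)=x$, whose morphisms are the morphisms of necklaces over $S$, which act through $P_{\mathbf 1}$. It is a monoid for concatenation. The product of an $n$-cell represented by $(t:T\to S,\sigma:\mathbf 1^n\to\mathbf 1^{N_T})$ and an $m$-cell represented by $(u:U\to S,\tau:\mathbf 1^m\to\mathbf 1^{N_U})$ is the $(n+m)$-cell represented by $(t\vee u:T\vee U\to S,\ \sigma\times\tau)$, and the unit is the $0$-cell given by $\Delta^0$ at $x$. Let $\Lambda(S)(x,x)=Q_{\square_c}(\mathfrak C_{\square_c}(S)(x,x))$ be its algebra of normalized cubical chains. In degree $n$ it is the free $k$-module on the $n$-cells modulo the submodule spanned by the degenerate $n$-cells. The product is induced by that of cells, and the differential is $$\partial\sigma=\sum_{j=1}^n(-1)^j\bigl(\partial^1_j\sigma-\partial^0_j\sigma\bigr).$$ *The right-hand side.* Let $Q_\Delta(S)$ be the differential graded coalgebra of normalized simplicial chains: in degree $n$ the free $k$-module on $S_n$ modulo the span of the degenerate simplices, with $\partial\sigma=\sum_{i=0}^n(-1)^i\partial_i\sigma$ and the Alexander–Whitney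 coproduct $\Delta\sigma=\sum_{p+q=n}f^p(\sigma)\otimes l^q(\sigma)$, where $f^p(\sigma)$ is the front $p$-face and $l^q(\sigma)$ is the last $q$-face of $\sigma\in S_n$. As $S_0=\{x\}$, we have $Q_\Delta(S)_0\cong k$. For a differential graded coalgebra $C$ with $C_0\cong k$, free over $k$ in each degree, let $\overline C_n=C_n$ for $n>0$ and $\overline C_0=0$; let $(s\overline C)_n=\overline C_{n+1}$, and let $\Delta'(c)=\sum c'\otimes c''$ be the part of $\Delta(c)$ in $\overline C\otimes\overline C$. The cobar construction $\Omega C$ is the tensor algebra $T(s\overline C)$ over $k$, with the induced grading and with the differential $D$ that extends $$D(sc)=-s\,\partial c+\sum(-1)^{\deg c'}\,sc'\otimes sc''$$ as a graded derivation, $D(ab)=D(a)\,b+(-1)^{\deg a}a\,D(b)$; here $s\,\partial c=0$ when $\deg c=1$. -/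

import Mathlib

open CategoryTheory Opposite

universe u v w

namespace CubicalCobar

open scoped TensorProduct

/-! ## The category of cubes with connections -/

/-- The objects of the poset `𝟏ⁿ`, that is, strings of `0`'s (`false`) and `1`'s (`true`) of
length `n`. -/
abbrev Str (n : ℕ) : Type := Fin n → Bool

/-- The cubical co-face functor `𝟏ⁿ ⟶ 𝟏ⁿ⁺¹`, which inserts `ε` in position `j`. -/
def coface {n : ℕ} (j : Fin (n + 1)) (ε : Bool) (s : Str n) : Str (n + 1) :=
  j.insertNth ε s

/-- The cubical co-degeneracy functor `𝟏ⁿ⁺¹ ⟶ 𝟏ⁿ`, which forgets the entry in position `j`. -/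
def codegen {n : ℕ} (j : Fin (n + 1)) (s : Str (n + 1)) : Str n :=
  j.removeNth s

/-- The cubical co-connection functor `𝟏ⁿ⁺¹ ⟶ 𝟏ⁿ`, which replaces the entries in the consecutive
positions `j` and `j + 1` by their maximum. -/
def coconn {n : ℕ} (j : Fin n) (s : Str (n + 1)) : Str n := fun i =>
  if i < j then s i.castSucc else if i = j then s i.castSucc || s i.succ else s i.succ

/-- The functors `𝟏ⁿ ⟶ 𝟏ᵐ` generated under composition by the co-faces, the co-degeneracies and
the co-connections.  As `𝟏ⁿ` and `𝟏ᵐ` are posets, a functor is given by its values on objects. -/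
inductive IsCubeMap : ∀ {n m : ℕ}, (Str n → Str m) → Prop
  | refl (n : ℕ) : IsCubeMap (fun s : Str n => s)
  | comp {n m l : ℕ} {f : Str n → Str m} {g : Str m → Str l} :
      IsCubeMap f → IsCubeMap g → IsCubeMap (fun s => g (f s))
  | coface {n : ℕ} (j : Fin (n + 1)) (ε : Bool) : IsCubeMap (coface j ε)
  | codegen {n : ℕ} (j : Fin (n + 1)) : IsCubeMap (codegen j)
  | coconn {n : ℕ} (j : Fin n) : IsCubeMap (coconn j)

/-- The category `□_c`.  Its objects are the posets `𝟏ⁿ`. -/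
structure Cube : Type where
  /-- the exponent `n` of the object `𝟏ⁿ` -/
  dim : ℕ

instance : SmallCategory Cube where
  Hom a b := {f : Str a.dim → Str b.dim // IsCubeMap f}
  id a := ⟨fun s => s, IsCubeMap.refl _⟩
  comp f g := ⟨fun s => g.1 (f.1 s), IsCubeMap.comp f.2 g.2⟩

/-- A generated functor, as a morphism of `□_c`. -/
def Cube.ofMap {n m : ℕ} (f : Str n → Str m) (hf : IsCubeMap f) : (⟨n⟩ : Cube) ⟶ ⟨m⟩ := ⟨f, hf⟩

theorem Cube.hom_ext {a b : Cube} {f g : a ⟶ b} (h : ∀ s, f.1 s = g.1 s) : f = g :=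
  Subtype.ext (funext h)

/-- Reindexing along an equality of dimensions. -/
theorem isCubeMap_cast {n m : ℕ} (h : m = n) :
    IsCubeMap (fun (s : Str n) (i : Fin m) => s (Fin.cast h i)) := by
  subst h; exact IsCubeMap.refl _

theorem IsCubeMap.congr {n m : ℕ} {f g : Str n → Str m} (hf : IsCubeMap f)
    (h : ∀ s, g s = f s) : IsCubeMap g := by
  have : g = f := funext h
  rwa [this]

/-- A sufficient criterion for a functor to be generated by co-faces, co-degeneracies and
co-connections. -/
theorem isCubeMap_of_monotone {L : Type*} [LinearOrder L] (N : ℕ) :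
    ∀ {n m : ℕ}, n + m = N → ∀ (F : Str n → Str m) (g : Fin n → L) (h : Fin m → L)
      (C : Fin m → Prop), Monotone g → StrictMono h →
      (∀ s i, F s i = true ↔ C i ∨ ∃ j, s j = true ∧ g j = h i) → IsCubeMap F := by
  induction N with
  | zero =>
    intro n m hnm F g h C hg hh hF
    obtain ⟨rfl, rfl⟩ : n = 0 ∧ m = 0 := by omega
    exact (IsCubeMap.refl 0).congr fun s => Subsingleton.elim _ _
  | succ N ih =>
    intro n m hnm F g h C hg hh hF
    -- constant outputs are split off as co-faces
    have key : ∀ (ε : Bool) (i : Fin m), (∀ s, F s i = ε) → IsCubeMap F := by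
      intro ε i hi
      obtain ⟨m, rfl⟩ : ∃ m', m = m' + 1 := ⟨m - 1, by have := i.2; omega⟩
      have hF' : IsCubeMap (fun s => i.removeNth (F s)) :=
        ih (by omega) _ g (h ∘ i.succAbove) (C ∘ i.succAbove) hg
          (hh.comp (Fin.strictMono_succAbove i)) (fun s l => by simp [Fin.removeNth, hF])
      refine (hF'.comp (IsCubeMap.coface i ε)).congr fun s => ?_
      rw [coface, ← hi s, Fin.insertNth_self_removeNth]
    by_cases hC : ∃ i, C i
    · obtain ⟨i, hi⟩ := hC
      exact key true i fun s => (hF s i).2 (Or.inl hi)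
    by_cases hr : ∃ i, ∀ j, g j ≠ h i
    · obtain ⟨i, hi⟩ := hr
      refine key false i fun s => ?_
      rw [Bool.eq_false_iff, Ne, hF]
      rintro (h' | ⟨j, -, hj⟩)
      exacts [hC ⟨i, h'⟩, hi j hj]
    simp only [not_exists, not_forall, not_not] at hC hr
    by_cases hd : ∃ j, ∀ i, g j ≠ h i
    · obtain ⟨j, hj⟩ := hd
      obtain ⟨n, rfl⟩ : ∃ n', n = n' + 1 := ⟨n - 1, by have := j.2; omega⟩
      have hF' : IsCubeMap (fun s => F (j.insertNth false s)) :=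
        ih (by omega) _ (g ∘ j.succAbove) h C (hg.comp (Fin.strictMono_succAbove j).monotone) hh
          (fun s i => by
            rw [hF, Fin.exists_iff_succAbove (P := fun x => _ ∧ _) j]
            simp)
      refine ((IsCubeMap.codegen j).comp hF').congr fun s => ?_
      funext i
      rw [Bool.eq_iff_iff, hF, hF, Fin.exists_iff_succAbove (P := fun x => _ ∧ _) j,
        Fin.exists_iff_succAbove (P := fun x => _ ∧ _) j]
      simp [codegen, Fin.removeNth, hj]
    simp only [not_exists, not_forall, not_not] at hd
    by_cases hi : Function.Injective g
    · have hg' : StrictMono g := hg.strictMono_of_injective hi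
      have hrange : Set.range g = Set.range h := by
        apply Set.Subset.antisymm
        · rintro _ ⟨j, rfl⟩; obtain ⟨i, hi⟩ := hd j; exact ⟨i, hi.symm⟩
        · rintro _ ⟨i, rfl⟩; obtain ⟨j, hj⟩ := hr i; exact ⟨j, hj⟩
      have hnm : n = m := by
        have h1 := Set.ncard_range_of_injective hi
        have h2 := Set.ncard_range_of_injective hh.injective
        rw [hrange, h2] at h1
        simpa using h1.symm
      subst hnm
      have hgh : g = h := (hg'.range_inj hh).1 hrange
      subst hgh
      refine (IsCubeMap.refl n).congr fun s => funext fun i => ?_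
      rw [Bool.eq_iff_iff, hF]
      constructor
      · rintro (h' | ⟨j, hj, hji⟩)
        exacts [(hC i h').elim, hi hji ▸ hj]
      · exact fun h' => Or.inr ⟨i, h', rfl⟩
    · have : ∃ j : ℕ, ∃ hj : j + 1 < n, g ⟨j, by omega⟩ = g ⟨j + 1, hj⟩ := by
        by_contra hcon
        push Not at hcon
        refine hi (StrictMono.injective ?_)
        have hstep : ∀ (d a : ℕ) (ha : a + d + 1 < n), g ⟨a, by omega⟩ < g ⟨a + d + 1, ha⟩ := by
          intro d
          induction d with
          | zero =>
            intro a ha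
            exact lt_of_le_of_ne (hg (by simp)) (hcon a ha)
          | succ d ihd =>
            intro a ha
            exact (ihd a (by omega)).trans_le (hg (by simp))
        intro a b hab
        obtain ⟨d, hd⟩ : ∃ d, b.1 = a.1 + d + 1 := ⟨b.1 - a.1 - 1, by omega⟩
        have := hstep d a.1 (hd ▸ b.2)
        convert this
      obtain ⟨j, hj, hjj⟩ := this
      obtain ⟨n, rfl⟩ : ∃ n', n = n' + 1 := ⟨n - 1, by omega⟩
      let J : Fin n := ⟨j, by omega⟩
      have hJ : g J.castSucc = g J.succ := hjj
      have hF' : IsCubeMap (fun s => F (J.succ.insertNth false s)) :=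
        ih (by omega) _ (g ∘ J.succ.succAbove) h C
          (hg.comp (Fin.strictMono_succAbove _).monotone) hh
          (fun s i => by
            rw [hF, Fin.exists_iff_succAbove (P := fun x => _ ∧ _) J.succ]
            simp)
      refine ((IsCubeMap.coconn J).comp hF').congr fun s => ?_
      funext i
      rw [Bool.eq_iff_iff, hF, hF]
      refine or_congr Iff.rfl ⟨?_, ?_⟩
      · rintro ⟨a, ha, hai⟩
        by_cases haJ : a = J.succ
        · subst haJ
          refine ⟨J.succ.succAbove J, ?_, ?_⟩
          · rw [Fin.insertNth_apply_succAbove]; simp [coconn, ha]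
          · rw [← hai, ← hJ]; simp
        · obtain ⟨b, rfl⟩ := Fin.exists_succAbove_eq haJ
          refine ⟨_, ?_, hai⟩
          rw [Fin.insertNth_apply_succAbove, coconn]
          rcases lt_trichotomy b J with hb | hb | hb
          · rw [if_pos hb, ← ha, Fin.succAbove_of_castSucc_lt]
            exact Fin.lt_def.2 (by simp; omega)
          · subst hb
            simp at ha
            simp [ha]
          · rw [if_neg (by omega), if_neg (by omega), ← ha, Fin.succAbove_of_le_castSucc]
            exact Fin.le_def.2 (by simp; omega)
      · rintro ⟨a, ha, hai⟩
        by_cases haJ : a = J.succ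
        · subst haJ; simp at ha
        · obtain ⟨b, rfl⟩ := Fin.exists_succAbove_eq haJ
          rw [Fin.insertNth_apply_succAbove, coconn] at ha
          rcases lt_trichotomy b J with hb | hb | hb
          · rw [if_pos hb] at ha
            refine ⟨_, ?_, hai⟩
            rw [← ha, Fin.succAbove_of_castSucc_lt]
            exact Fin.lt_def.2 (by simp; omega)
          · subst hb
            simp at ha hai
            rcases ha with ha | ha
            · exact ⟨_, ha, hai⟩
            · exact ⟨_, ha, by rw [← hJ, hai]⟩
          · rw [if_neg (by omega), if_neg (by omega)] at ha
            refine ⟨_, ?_, hai⟩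
            rw [← ha, Fin.succAbove_of_le_castSucc]
            exact Fin.le_def.2 (by simp; omega)

/-- The product `f × g : 𝟏ⁿ⁺ᵐ = 𝟏ⁿ × 𝟏ᵐ ⟶ 𝟏ⁿ' × 𝟏ᵐ' = 𝟏ⁿ'⁺ᵐ'` of two functors. -/
def strProd {n n' m m' : ℕ} (f : Str n → Str n') (g : Str m → Str m') (s : Str (n + m)) :
    Str (n' + m') :=
  Fin.append (f fun i => s (Fin.castAdd m i)) (g fun i => s (Fin.natAdd n i))

/-- The hypothesis of `isCubeMap_of_monotone`. -/
def CubeCriterion {n m : ℕ} (F : Str n → Str m) : Prop :=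
  ∃ (L : Type) (_ : LinearOrder L) (g : Fin n → L) (h : Fin m → L) (C : Fin m → Prop),
    Monotone g ∧ StrictMono h ∧ ∀ s i, F s i = true ↔ C i ∨ ∃ j, s j = true ∧ g j = h i

theorem CubeCriterion.isCubeMap {n m : ℕ} {F : Str n → Str m} (hF : CubeCriterion F) :
    IsCubeMap F := by
  obtain ⟨L, _, g, h, C, hg, hh, hF⟩ := hF
  exact isCubeMap_of_monotone _ rfl F g h C hg hh hF

theorem cubeCriterion_id (n : ℕ) : CubeCriterion (fun s : Str n => s) :=
  ⟨Fin n, inferInstance, fun i => i, fun i => i, fun _ => False, monotone_id, strictMono_id,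
    fun s i => by simp⟩

theorem cubeCriterion_coface {n : ℕ} (j : Fin (n + 1)) (ε : Bool) :
    CubeCriterion (coface j ε) := by
  refine ⟨Fin (n + 1), inferInstance, j.succAbove, fun i => i, fun i => i = j ∧ ε = true,
    (Fin.strictMono_succAbove j).monotone, strictMono_id, fun s i => ?_⟩
  refine Fin.succAboveCases j ?_ (fun i => ?_) i <;> simp [coface, Fin.succAbove_ne]

theorem cubeCriterion_codegen {n : ℕ} (j : Fin (n + 1)) : CubeCriterion (codegen j) :=
  ⟨Fin (n + 1), inferInstance, fun i => i, j.succAbove, fun _ => False, monotone_id,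
    Fin.strictMono_succAbove j, fun s i => by simp [codegen, Fin.removeNth]⟩

theorem cubeCriterion_coconn {n : ℕ} (j : Fin n) : CubeCriterion (coconn j) := by
  refine ⟨Fin n, inferInstance, j.predAbove, fun i => i, fun _ => False,
    Fin.predAbove_right_monotone j, strictMono_id, fun s i => ?_⟩
  rw [Fin.exists_iff_succAbove (P := fun x => _ ∧ _) j.succ]
  have h : ∀ b : Fin n, j.predAbove (j.succ.succAbove b) = b := fun b => by
    rcases le_or_gt b j with hb | hb
    · rw [Fin.succAbove_of_castSucc_lt _ _ (Fin.castSucc_lt_succ_iff.2 hb),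
        Fin.predAbove_castSucc_of_le _ _ hb]
    · rw [Fin.succAbove_of_le_castSucc _ _ (Fin.succ_le_castSucc_iff.2 hb),
        Fin.predAbove_succ_of_le _ _ hb.le]
  simp only [h, false_or, exists_eq_right, Fin.predAbove_succ_self, coconn]
  rcases lt_trichotomy i j with hb | rfl | hb
  · rw [if_pos hb, Fin.succAbove_of_castSucc_lt _ _ (Fin.castSucc_lt_succ_iff.2 hb.le)]
    simp [hb.ne']
  · simp [or_comm]
  · rw [if_neg hb.not_gt, if_neg hb.ne', Fin.succAbove_of_le_castSucc _ _
      (Fin.succ_le_castSucc_iff.2 hb)]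
    simp [hb.ne]

theorem CubeCriterion.prod {n n' m m' : ℕ} {F : Str n → Str n'} {G : Str m → Str m'}
    (hF : CubeCriterion F) (hG : CubeCriterion G) : CubeCriterion (strProd F G) := by
  obtain ⟨L, _, g, h, C, hg, hh, hF⟩ := hF
  obtain ⟨L', _, g', h', C', hg', hh', hG⟩ := hG
  refine ⟨L ⊕ₗ L', inferInstance,
    Fin.append (fun i => Sum.inlₗ (g i)) (fun i => Sum.inrₗ (g' i)),
    Fin.append (fun i => Sum.inlₗ (h i)) (fun i => Sum.inrₗ (h' i)),
    Fin.append C C', ?_, ?_, ?_⟩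
  · intro a b
    refine Fin.addCases (fun a => ?_) (fun a => ?_) a <;>
    refine Fin.addCases (fun b => ?_) (fun b => ?_) b <;> intro hab
    · simpa using hg (Fin.le_def.2 (by simpa using Fin.le_def.1 hab))
    · simp
    · have := Fin.le_def.1 hab; simp at this; omega
    · simpa using hg' (Fin.le_def.2 (by simpa using Fin.le_def.1 hab))
  · intro a b
    refine Fin.addCases (fun a => ?_) (fun a => ?_) a <;>
    refine Fin.addCases (fun b => ?_) (fun b => ?_) b <;> intro hab
    · simpa using hh (Fin.lt_def.2 (by simpa using Fin.lt_def.1 hab))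
    · simp [(Sum.Lex.inl_lt_inr _ _)]
    · have := Fin.lt_def.1 hab; simp at this; omega
    · simpa using hh' (Fin.lt_def.2 (by simpa using Fin.lt_def.1 hab))
  · intro s i
    have key : ∀ P : Fin (n + m) → Prop, (∃ j, P j) ↔
        (∃ j, P (Fin.castAdd m j)) ∨ ∃ j, P (Fin.natAdd n j) := fun P =>
      ⟨fun ⟨j, hj⟩ => by
        revert hj
        refine Fin.addCases (fun j => ?_) (fun j => ?_) j
        exacts [fun hj => Or.inl ⟨j, hj⟩, fun hj => Or.inr ⟨j, hj⟩],
        fun hP => hP.elim (fun ⟨j, hj⟩ => ⟨_, hj⟩) fun ⟨j, hj⟩ => ⟨_, hj⟩⟩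
    rw [key]
    refine Fin.addCases (fun i => ?_) (fun i => ?_) i
    · simp [strProd, hF, Sum.inlₗ, Sum.inrₗ]
    · simp [strProd, hG, Sum.inlₗ, Sum.inrₗ]

theorem isCubeMap_prod_id {n n' : ℕ} {f : Str n → Str n'} (hf : IsCubeMap f) (m : ℕ) :
    IsCubeMap (strProd f (fun s : Str m => s)) := by
  induction hf with
  | refl n => exact ((cubeCriterion_id n).prod (cubeCriterion_id m)).isCubeMap
  | comp _ _ hf hg => exact (hf.comp hg).congr fun s => by simp [strProd]
  | coface j ε => exact ((cubeCriterion_coface j ε).prod (cubeCriterion_id m)).isCubeMap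
  | codegen j => exact ((cubeCriterion_codegen j).prod (cubeCriterion_id m)).isCubeMap
  | coconn j => exact ((cubeCriterion_coconn j).prod (cubeCriterion_id m)).isCubeMap

theorem isCubeMap_id_prod {n n' : ℕ} {f : Str n → Str n'} (hf : IsCubeMap f) (m : ℕ) :
    IsCubeMap (strProd (fun s : Str m => s) f) := by
  induction hf with
  | refl n => exact ((cubeCriterion_id m).prod (cubeCriterion_id n)).isCubeMap
  | comp _ _ hf hg => exact (hf.comp hg).congr fun s => by simp [strProd]
  | coface j ε => exact ((cubeCriterion_id m).prod (cubeCriterion_coface j ε)).isCubeMap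
  | codegen j => exact ((cubeCriterion_id m).prod (cubeCriterion_codegen j)).isCubeMap
  | coconn j => exact ((cubeCriterion_id m).prod (cubeCriterion_coconn j)).isCubeMap

theorem IsCubeMap.prod {n n' m m' : ℕ} {f : Str n → Str n'} {g : Str m → Str m'}
    (hf : IsCubeMap f) (hg : IsCubeMap g) : IsCubeMap (strProd f g) :=
  ((isCubeMap_prod_id hf m).comp (isCubeMap_id_prod hg n')).congr fun s => by
    simp [strProd]

/-! ## Necklaces -/

/-- A necklace in preferred form, recorded by its vertices `0 < 1 < ... < last` and by the set of
its joints.  The beads are the simplices spanned by the vertices between two consecutive joints.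
The underlying simplicial set is `Necklace.toSSet`. -/
structure Necklace : Type u where
  /-- the last vertex; there are `last + 1` vertices -/
  last : ℕ
  /-- the set of joints -/
  joints : Finset (Fin (last + 1))
  zero_mem : 0 ∈ joints
  last_mem : Fin.last last ∈ joints

namespace Necklace

/-- The wedge `Δ^{n₁} ∨ ... ∨ Δ^{n_k}`, as the simplicial subset of `Δ^{n₁ + ... + n_k}` which is
the union of the beads: a simplex belongs to it if no joint lies strictly between two of its
vertices. -/
def subcomplex (T : Necklace.{u}) :
    (SSet.stdSimplex.{u}.obj (SimplexCategory.mk T.last)).Subcomplex where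
  obj _ := {σ | ∀ j ∈ T.joints,
    (∀ a, (SSet.stdSimplex.objEquiv σ).toOrderHom a ≤ j) ∨
      (∀ a, j ≤ (SSet.stdSimplex.objEquiv σ).toOrderHom a)}
  map θ _ hσ j hj := (hσ j hj).imp (fun h a => h (θ.unop.toOrderHom a))
    (fun h a => h (θ.unop.toOrderHom a))

/-- The simplicial set underlying a necklace. -/
abbrev toSSet (T : Necklace.{u}) : SSet.{u} := T.subcomplex.toSSet

/-- The vertices of a simplex of a necklace. -/
def pt (T : Necklace.{u}) {m : SimplexCategoryᵒᵖ} (σ : T.toSSet.obj m) :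
    Fin (m.unop.len + 1) →o Fin (T.last + 1) :=
  (SSet.stdSimplex.objEquiv σ.1).toOrderHom

/-- The simplex of a necklace with given vertices. -/
def simplex (T : Necklace.{u}) {m : SimplexCategoryᵒᵖ}
    (f : Fin (m.unop.len + 1) →o Fin (T.last + 1))
    (hf : ∀ j ∈ T.joints, (∀ a, f a ≤ j) ∨ ∀ a, j ≤ f a) : T.toSSet.obj m :=
  ⟨SSet.stdSimplex.objEquiv.symm (SimplexCategory.Hom.mk f), hf⟩

theorem pt_simplex (T : Necklace.{u}) {m : SimplexCategoryᵒᵖ}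
    (f : Fin (m.unop.len + 1) →o Fin (T.last + 1))
    (hf : ∀ j ∈ T.joints, (∀ a, f a ≤ j) ∨ ∀ a, j ≤ f a) : T.pt (T.simplex f hf) = f := rfl

theorem pt_joint (T : Necklace.{u}) {m : SimplexCategoryᵒᵖ} (σ : T.toSSet.obj m)
    {j : Fin (T.last + 1)} (hj : j ∈ T.joints) :
    (∀ a, T.pt σ a ≤ j) ∨ ∀ a, j ≤ T.pt σ a := σ.2 j hj

theorem pt_map (T : Necklace.{u}) {m m' : SimplexCategoryᵒᵖ} (θ : m ⟶ m') (σ : T.toSSet.obj m)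
    (a : Fin (m'.unop.len + 1)) :
    T.pt (T.toSSet.map θ σ) a = T.pt σ (θ.unop.toOrderHom a) := rfl

theorem pt_ext (T : Necklace.{u}) {m : SimplexCategoryᵒᵖ} {σ τ : T.toSSet.obj m}
    (h : ∀ a, T.pt σ a = T.pt τ a) : σ = τ := by
  apply Subtype.ext
  apply SSet.stdSimplex.objEquiv.injective
  ext a : 3
  exact h a

/-- A vertex of a necklace, as a `0`-simplex. -/
def vertex (T : Necklace.{u}) (v : Fin (T.last + 1)) :
    T.toSSet.obj (op (SimplexCategory.mk 0)) :=
  T.simplex (OrderHom.const _ v) fun j _ => (le_total v j).imp (fun h _ => h) (fun h _ => h)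

/-- The morphisms of necklaces: the maps of simplicial sets preserving the first and the last
vertex. -/
def Hom (T U : Necklace.{u}) : Type u :=
  {f : T.toSSet ⟶ U.toSSet //
    f.app _ (T.vertex 0) = U.vertex 0 ∧
    f.app _ (T.vertex (Fin.last _)) = U.vertex (Fin.last _)}

instance : SmallCategory Necklace.{u} where
  Hom := Hom
  id T := ⟨𝟙 _, rfl, rfl⟩
  comp f g := ⟨f.1 ≫ g.1, by
    constructor
    · change g.1.app _ (f.1.app _ _) = _
      rw [f.2.1, g.2.1]
    · change g.1.app _ (f.1.app _ _) = _
      rw [f.2.2, g.2.2]⟩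

theorem hom_ext {T U : Necklace.{u}} {f g : T ⟶ U} (h : f.1 = g.1) : f = g := Subtype.ext h

/-- The map induced on vertices by a map of simplicial sets between necklaces. -/
def vert {T U : Necklace.{u}} (f : T.toSSet ⟶ U.toSSet) (v : Fin (T.last + 1)) :
    Fin (U.last + 1) :=
  U.pt (f.app _ (T.vertex v)) 0

theorem pt_app {T U : Necklace.{u}} (f : T.toSSet ⟶ U.toSSet) {m : SimplexCategoryᵒᵖ}
    (σ : T.toSSet.obj m) (a : Fin (m.unop.len + 1)) :
    U.pt (f.app m σ) a = vert f (T.pt σ a) := by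
  let θ : m ⟶ op (SimplexCategory.mk 0) := (SimplexCategory.const (SimplexCategory.mk 0) m.unop a).op
  have h1 : T.vertex (T.pt σ a) = T.toSSet.map θ σ := T.pt_ext fun _ => rfl
  have h2 : f.app _ (T.toSSet.map θ σ) = U.toSSet.map θ (f.app _ σ) :=
    NatTrans.naturality_apply f θ σ
  rw [vert, h1, h2]
  rfl

theorem vert_comp {T U V : Necklace.{u}} (f : T.toSSet ⟶ U.toSSet) (g : U.toSSet ⟶ V.toSSet)
    (v : Fin (T.last + 1)) : vert (f ≫ g) v = vert g (vert f v) :=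
  pt_app g (f.app _ (T.vertex v)) 0

theorem vert_id {T : Necklace.{u}} (v : Fin (T.last + 1)) : vert (𝟙 T.toSSet) v = v := rfl

theorem vert_zero {T U : Necklace.{u}} (f : T ⟶ U) : vert f.1 0 = 0 := by
  rw [vert, f.2.1]; rfl

theorem vert_last {T U : Necklace.{u}} (f : T ⟶ U) :
    vert f.1 (Fin.last _) = Fin.last _ := by
  rw [vert, f.2.2]; rfl

/-- Two vertices which are not separated by a joint span an edge. -/
theorem exists_edge (T : Necklace.{u}) {v w : Fin (T.last + 1)} (hvw : v ≤ w)
    (h : ∀ j ∈ T.joints, j ≤ v ∨ w ≤ j) :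
    ∃ e : T.toSSet.obj (op (SimplexCategory.mk 1)), T.pt e 0 = v ∧ T.pt e 1 = w := by
  refine ⟨T.simplex ⟨![v, w], ?_⟩ ?_, rfl, rfl⟩
  · exact (Fin.monotone_iff_le_succ (f := ![v, w])).2 fun i => by
      obtain rfl := Subsingleton.elim i 0; exact hvw
  · intro j hj
    rcases h j hj with h | h
    · right; intro a
      change j ≤ ![v, w] a
      match a with
      | 0 => exact h
      | 1 => exact h.trans hvw
    · left; intro a
      change ![v, w] a ≤ j
      match a with
      | 0 => exact hvw.trans h
      | 1 => exact h

theorem vert_monotone {T U : Necklace.{u}} (f : T.toSSet ⟶ U.toSSet) : Monotone (vert f) := by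
  refine Fin.monotone_iff_le_succ.2 fun i => ?_
  obtain ⟨e, h0, h1⟩ := T.exists_edge (v := i.castSucc) (w := i.succ) i.castSucc_le_succ
    (fun j _ => (le_or_gt j i.castSucc).imp id Fin.castSucc_lt_iff_succ_le.1)
  rw [← h0, ← h1, ← pt_app, ← pt_app]
  exact (U.pt _).monotone (by decide)

/-- A morphism of necklaces `f : T ⟶ U` satisfies `J_U ⊆ f(J_T)`. -/
theorem joints_subset_image {T U : Necklace.{u}} (f : T ⟶ U) :
    U.joints ⊆ T.joints.image (vert f.1) := by
  intro j hj
  rw [Finset.mem_image]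
  by_contra hcon
  push Not at hcon
  let A := T.joints.filter fun a => vert f.1 a ≤ j
  have hA : A.Nonempty := ⟨0, by simp [A, T.zero_mem, vert_zero f]⟩
  let B := T.joints.filter fun a => j ≤ vert f.1 a
  have hB : B.Nonempty := ⟨Fin.last _, by simp [B, T.last_mem, vert_last f, Fin.le_last]⟩
  obtain ⟨ha, ha'⟩ := Finset.mem_filter.1 (A.max'_mem hA)
  obtain ⟨hb, hb'⟩ := Finset.mem_filter.1 (B.min'_mem hB)
  set a := A.max' hA
  set b := B.min' hB
  have ha2 : vert f.1 a < j := lt_of_le_of_ne ha' (hcon a ha)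
  have hb2 : j < vert f.1 b := lt_of_le_of_ne hb' (hcon b hb).symm
  have hab : a ≤ b := by
    by_contra h
    exact absurd (vert_monotone f.1 (le_of_not_ge h)) (not_le.2 (ha2.trans hb2))
  obtain ⟨e, h0, h1⟩ := T.exists_edge hab (fun i hi => by
    rcases le_total (vert f.1 i) j with h | h
    · exact Or.inl (A.le_max' i (Finset.mem_filter.2 ⟨hi, h⟩))
    · exact Or.inr (B.min'_le i (Finset.mem_filter.2 ⟨hi, h⟩)))
  rcases U.pt_joint (f.1.app _ e) hj with h | h
  · have := h 1
    rw [pt_app, h1] at this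
    exact absurd this (not_le.2 hb2)
  · have := h 0
    rw [pt_app, h0] at this
    exact absurd this (not_le.2 ha2)

/-! ### The functor from necklaces to cubes -/

/-- The set `V_T - J_T` of the vertices which are not joints. -/
def free (T : Necklace.{u}) : Finset (Fin (T.last + 1)) := T.jointsᶜ

/-- The number `N = |V_T - J_T|`. -/
def dim (T : Necklace.{u}) : ℕ := T.free.card

/-- The increasing enumeration of `V_T - J_T`. -/
def freeVertex (T : Necklace.{u}) : Fin T.dim ↪o Fin (T.last + 1) := T.free.orderEmbOfFin rfl

/-- The isomorphism from the poset of the sets `X` with `J_T ⊆ X ⊆ V_T` to `𝟏ᴺ`. -/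
def toStr (T : Necklace.{u}) (X : Finset (Fin (T.last + 1))) : Str T.dim :=
  fun i => decide (T.freeVertex i ∈ X)

/-- The inverse isomorphism, from `𝟏ᴺ` to the poset of the sets `X` with `J_T ⊆ X ⊆ V_T`. -/
def ofStr (T : Necklace.{u}) (s : Str T.dim) : Finset (Fin (T.last + 1)) :=
  T.joints ∪ (Finset.univ.filter fun i => s i = true).image T.freeVertex

theorem freeVertex_notMem (T : Necklace.{u}) (i : Fin T.dim) : T.freeVertex i ∉ T.joints := by
  exact Finset.mem_compl.1 (Finset.orderEmbOfFin_mem T.free rfl i)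

theorem exists_freeVertex (T : Necklace.{u}) {v : Fin (T.last + 1)} (hv : v ∉ T.joints) :
    ∃ i, T.freeVertex i = v := by
  have : v ∈ Set.range (T.free.orderEmbOfFin rfl) := by
    rw [Finset.range_orderEmbOfFin]; simpa [free] using hv
  exact this

theorem joints_subset_ofStr (T : Necklace.{u}) (s : Str T.dim) : T.joints ⊆ T.ofStr s :=
  Finset.subset_union_left

theorem toStr_ofStr (T : Necklace.{u}) (s : Str T.dim) : T.toStr (T.ofStr s) = s := by
  funext i
  simp [toStr, ofStr, freeVertex_notMem]

theorem ofStr_toStr (T : Necklace.{u}) {X : Finset (Fin (T.last + 1))} (hX : T.joints ⊆ X) :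
    T.ofStr (T.toStr X) = X := by
  ext v
  simp only [ofStr, toStr, Finset.mem_union, Finset.mem_image, Finset.mem_filter, Finset.mem_univ,
    true_and, decide_eq_true_eq]
  constructor
  · rintro (h | ⟨i, hi, rfl⟩)
    exacts [hX h, hi]
  · intro h
    by_cases hv : v ∈ T.joints
    · exact Or.inl hv
    · obtain ⟨i, rfl⟩ := T.exists_freeVertex hv
      exact Or.inr ⟨i, h, rfl⟩

/-- The functor `P_𝟏(f) : 𝟏ᴺ ⟶ 𝟏ᴺ'` given by `X ↦ f(X)`. -/
def strMap {T U : Necklace.{u}} (f : T ⟶ U) (s : Str T.dim) : Str U.dim :=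
  U.toStr ((T.ofStr s).image (vert f.1))

theorem isCubeMap_strMap {T U : Necklace.{u}} (f : T ⟶ U) : IsCubeMap (strMap f) := by
  refine isCubeMap_of_monotone _ rfl _ (fun i => vert f.1 (T.freeVertex i)) U.freeVertex
    (fun i => U.freeVertex i ∈ T.joints.image (vert f.1))
    ((vert_monotone f.1).comp T.freeVertex.monotone) U.freeVertex.strictMono fun s i => ?_
  simp only [strMap, toStr, ofStr, Finset.image_union, Finset.mem_union, decide_eq_true_eq]
  simp

/-- The functor `P_𝟏 : Nec ⥤ □_c`. -/
def toCube : Necklace.{u} ⥤ Cube where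
  obj T := ⟨T.dim⟩
  map f := ⟨strMap f, isCubeMap_strMap f⟩
  map_id T := Cube.hom_ext fun s => by
    change T.toStr ((T.ofStr s).image (vert (𝟙 T.toSSet))) = s
    have : vert (𝟙 T.toSSet) = _root_.id := funext vert_id
    rw [this, Finset.image_id, toStr_ofStr]
  map_comp {T U V} f g := Cube.hom_ext fun s => by
    change V.toStr ((T.ofStr s).image (vert (f.1 ≫ g.1))) =
      V.toStr ((U.ofStr (U.toStr ((T.ofStr s).image (vert f.1)))).image (vert g.1))
    rw [ofStr_toStr, Finset.image_image]
    · congr 2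
      exact funext (vert_comp f.1 g.1)
    · exact (joints_subset_image f).trans (Finset.image_subset_image (T.joints_subset_ofStr s))

end Necklace

namespace Necklace

/-! ### Wedges of necklaces -/

/-- The wedge `T ∨ U`, in which the last vertex of `T` is glued to the first vertex of `U`. -/
def wedge (T U : Necklace.{u}) : Necklace.{u} where
  last := T.last + U.last
  joints := T.joints.image (fun v => ⟨v.1, by have := v.2; omega⟩) ∪
    U.joints.image (fun v => ⟨T.last + v.1, by have := v.2; omega⟩)
  zero_mem := Finset.mem_union_left _ (Finset.mem_image.2 ⟨0, T.zero_mem, rfl⟩)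
  last_mem := Finset.mem_union_right _ (Finset.mem_image.2 ⟨_, U.last_mem, rfl⟩)

/-- The vertex of `T ∨ U` corresponding to a vertex of `T`. -/
def inlV (T U : Necklace.{u}) (v : Fin (T.last + 1)) : Fin ((wedge T U).last + 1) :=
  ⟨v.1, by have := v.2; change _ < T.last + U.last + 1; omega⟩

/-- The vertex of `T ∨ U` corresponding to a vertex of `U`. -/
def inrV (T U : Necklace.{u}) (v : Fin (U.last + 1)) : Fin ((wedge T U).last + 1) :=
  ⟨T.last + v.1, by have := v.2; change _ < T.last + U.last + 1; omega⟩

theorem wedge_joints (T U : Necklace.{u}) :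
    (wedge T U).joints = T.joints.image (inlV T U) ∪ U.joints.image (inrV T U) := rfl

theorem inlV_mem {T U : Necklace.{u}} {j : Fin (T.last + 1)} (hj : j ∈ T.joints) :
    inlV T U j ∈ (wedge T U).joints :=
  Finset.mem_union_left _ (Finset.mem_image_of_mem _ hj)

theorem inrV_mem {T U : Necklace.{u}} {j : Fin (U.last + 1)} (hj : j ∈ U.joints) :
    inrV T U j ∈ (wedge T U).joints :=
  Finset.mem_union_right _ (Finset.mem_image_of_mem _ hj)

/-- The inclusion `T ⟶ T ∨ U`. -/
def inl (T U : Necklace.{u}) : T.toSSet ⟶ (wedge T U).toSSet where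
  app m := ↾fun σ => (wedge T U).simplex ⟨fun a => inlV T U (T.pt σ a),
      fun _ _ h => (T.pt σ).monotone h⟩ (by
    intro j hj
    rw [wedge_joints] at hj
    rcases Finset.mem_union.1 hj with hj | hj
    · obtain ⟨j, hj', rfl⟩ := Finset.mem_image.1 hj
      exact T.pt_joint σ hj'
    · obtain ⟨j, hj', rfl⟩ := Finset.mem_image.1 hj
      refine Or.inl fun a => Fin.le_def.2 ?_
      have := (T.pt σ a).2
      change (T.pt σ a).1 ≤ T.last + j.1
      omega)
  naturality _ _ _ := rfl

/-- The inclusion `U ⟶ T ∨ U`. -/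
def inr (T U : Necklace.{u}) : U.toSSet ⟶ (wedge T U).toSSet where
  app m := ↾fun σ => (wedge T U).simplex ⟨fun a => inrV T U (U.pt σ a),
      fun _ _ h => Nat.add_le_add_left ((U.pt σ).monotone h) _⟩ (by
    intro j hj
    rw [wedge_joints] at hj
    rcases Finset.mem_union.1 hj with hj | hj
    · obtain ⟨j, hj', rfl⟩ := Finset.mem_image.1 hj
      refine Or.inr fun a => Fin.le_def.2 ?_
      have := j.2
      change j.1 ≤ T.last + (U.pt σ a).1
      omega
    · obtain ⟨j, hj', rfl⟩ := Finset.mem_image.1 hj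
      exact (U.pt_joint σ hj').imp (fun h a => Nat.add_le_add_left (h a) _)
        (fun h a => Nat.add_le_add_left (h a) _))
  naturality _ _ _ := rfl

theorem pt_inl {T U : Necklace.{u}} {m : SimplexCategoryᵒᵖ} (σ : T.toSSet.obj m)
    (a : Fin (m.unop.len + 1)) :
    (wedge T U).pt ((inl T U).app m σ) a = inlV T U (T.pt σ a) := rfl

theorem pt_inr {T U : Necklace.{u}} {m : SimplexCategoryᵒᵖ} (σ : U.toSSet.obj m)
    (a : Fin (m.unop.len + 1)) :
    (wedge T U).pt ((inr T U).app m σ) a = inrV T U (U.pt σ a) := rfl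

theorem vert_inl {T U : Necklace.{u}} (v : Fin (T.last + 1)) :
    vert (inl T U) v = inlV T U v := rfl

theorem vert_inr {T U : Necklace.{u}} (v : Fin (U.last + 1)) :
    vert (inr T U) v = inrV T U v := rfl

/-- The retraction `T ∨ U ⟶ T`, on simplices. -/
def left {T U : Necklace.{u}} {m : SimplexCategoryᵒᵖ} (σ : (wedge T U).toSSet.obj m) :
    T.toSSet.obj m :=
  T.simplex ⟨fun a => ⟨min ((wedge T U).pt σ a).1 T.last, by omega⟩, fun a b h => by
    have : ((wedge T U).pt σ a).1 ≤ ((wedge T U).pt σ b).1 := ((wedge T U).pt σ).monotone h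
    exact Fin.le_def.2 (min_le_min_right _ this)⟩ (by
    intro j hj
    have hj' := j.2
    refine ((wedge T U).pt_joint σ (inlV_mem hj)).imp (fun h a => ?_) (fun h a => ?_)
    · have : ((wedge T U).pt σ a).1 ≤ j.1 := h a
      exact Fin.le_def.2 ((min_le_left _ _).trans this)
    · have : j.1 ≤ ((wedge T U).pt σ a).1 := h a
      exact Fin.le_def.2 (le_min this (by omega)))

/-- The retraction `T ∨ U ⟶ U`, on simplices. -/
def right {T U : Necklace.{u}} {m : SimplexCategoryᵒᵖ} (σ : (wedge T U).toSSet.obj m) :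
    U.toSSet.obj m :=
  U.simplex ⟨fun a => ⟨((wedge T U).pt σ a).1 - T.last, by
      have : ((wedge T U).pt σ a).1 < T.last + U.last + 1 := ((wedge T U).pt σ a).2
      omega⟩, fun a b h => by
    have : ((wedge T U).pt σ a).1 ≤ ((wedge T U).pt σ b).1 := ((wedge T U).pt σ).monotone h
    exact Fin.le_def.2 (Nat.sub_le_sub_right this _)⟩ (by
    intro j hj
    refine ((wedge T U).pt_joint σ (inrV_mem hj)).imp (fun h a => ?_) (fun h a => ?_)
    · have : ((wedge T U).pt σ a).1 ≤ T.last + j.1 := h a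
      refine Fin.le_def.2 ?_
      change ((wedge T U).pt σ a).1 - T.last ≤ j.1
      omega
    · have : T.last + j.1 ≤ ((wedge T U).pt σ a).1 := h a
      refine Fin.le_def.2 ?_
      change j.1 ≤ ((wedge T U).pt σ a).1 - T.last
      omega)

theorem left_map {T U : Necklace.{u}} {m m' : SimplexCategoryᵒᵖ} (θ : m ⟶ m')
    (σ : (wedge T U).toSSet.obj m) :
    left ((wedge T U).toSSet.map θ σ) = T.toSSet.map θ (left σ) := rfl

theorem right_map {T U : Necklace.{u}} {m m' : SimplexCategoryᵒᵖ} (θ : m ⟶ m')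
    (σ : (wedge T U).toSSet.obj m) :
    right ((wedge T U).toSSet.map θ σ) = U.toSSet.map θ (right σ) := rfl

theorem left_or_right {T U : Necklace.{u}} {m : SimplexCategoryᵒᵖ}
    (σ : (wedge T U).toSSet.obj m) :
    (∀ a, ((wedge T U).pt σ a).1 ≤ T.last) ∨ ∀ a, T.last ≤ ((wedge T U).pt σ a).1 :=
  (wedge T U).pt_joint σ (inlV_mem T.last_mem)

theorem inl_left {T U : Necklace.{u}} {m : SimplexCategoryᵒᵖ} (σ : (wedge T U).toSSet.obj m)
    (h : ∀ a, ((wedge T U).pt σ a).1 ≤ T.last) : (inl T U).app m (left σ) = σ :=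
  pt_ext _ fun a => Fin.ext (min_eq_left (h a))

theorem inr_right {T U : Necklace.{u}} {m : SimplexCategoryᵒᵖ} (σ : (wedge T U).toSSet.obj m)
    (h : ∀ a, T.last ≤ ((wedge T U).pt σ a).1) : (inr T U).app m (right σ) = σ :=
  pt_ext _ fun a => Fin.ext (Nat.add_sub_cancel' (h a))

theorem left_inl {T U : Necklace.{u}} {m : SimplexCategoryᵒᵖ} (σ : T.toSSet.obj m) :
    left ((inl T U).app m σ) = σ :=
  pt_ext _ fun a => Fin.ext (min_eq_left (by
    have := (T.pt σ a).2
    rw [pt_inl]; change (T.pt σ a).1 ≤ _; omega))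

theorem right_inr {T U : Necklace.{u}} {m : SimplexCategoryᵒᵖ} (σ : U.toSSet.obj m) :
    right ((inr T U).app m σ) = σ :=
  pt_ext _ fun a => Fin.ext (Nat.add_sub_cancel_left (n := T.last) (m := (U.pt σ a).1))

/-- The unique morphism to the zero-dimensional simplex. -/
def toPoint (m : SimplexCategoryᵒᵖ) : op (SimplexCategory.mk 0) ⟶ m :=
  (SimplexCategory.const m.unop (SimplexCategory.mk 0) 0).op

theorem toPoint_comp {m m' : SimplexCategoryᵒᵖ} (θ : m ⟶ m') : toPoint m ≫ θ = toPoint m' := by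
  apply Quiver.Hom.unop_inj
  ext a : 3
  exact Subsingleton.elim (α := Fin 1) _ _

theorem glue {S : SSet.{u}} {T U : Necklace.{u}} (t : T.toSSet ⟶ S) (u : U.toSSet ⟶ S)
    (h : t.app _ (T.vertex (Fin.last _)) = u.app _ (U.vertex 0)) {m : SimplexCategoryᵒᵖ}
    (σ : (wedge T U).toSSet.obj m) (hσ : ∀ a, ((wedge T U).pt σ a).1 = T.last) :
    t.app m (left σ) = u.app m (right σ) := by
  have h1 : left σ = T.toSSet.map (toPoint m) (T.vertex (Fin.last _)) :=
    pt_ext _ fun a => Fin.ext (min_eq_right (hσ a).ge)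
  have h2 : right σ = U.toSSet.map (toPoint m) (U.vertex 0) :=
    pt_ext _ fun a => Fin.ext (Nat.sub_eq_zero_of_le (hσ a).le)
  rw [h1, h2, NatTrans.naturality_apply, NatTrans.naturality_apply, h]

/-- The map `T ∨ U ⟶ S` induced by two maps `T ⟶ S` and `U ⟶ S` which agree at the vertex that
is glued. -/
noncomputable def desc {S : SSet.{u}} {T U : Necklace.{u}} (t : T.toSSet ⟶ S) (u : U.toSSet ⟶ S)
    (h : t.app _ (T.vertex (Fin.last _)) = u.app _ (U.vertex 0)) : (wedge T U).toSSet ⟶ S where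
  app m := ↾fun σ =>
    if ∀ a, ((wedge T U).pt σ a).1 ≤ T.last then t.app m (left σ) else u.app m (right σ)
  naturality m m' θ := by
    ext σ
    change (if ∀ a, ((wedge T U).pt ((wedge T U).toSSet.map θ σ) a).1 ≤ T.last then
        t.app m' (left ((wedge T U).toSSet.map θ σ))
        else u.app m' (right ((wedge T U).toSSet.map θ σ))) =
      S.map θ (if ∀ a, ((wedge T U).pt σ a).1 ≤ T.last then t.app m (left σ)
        else u.app m (right σ))
    by_cases h1 : ∀ a, ((wedge T U).pt σ a).1 ≤ T.last
    · rw [if_pos h1, if_pos (show ∀ a, ((wedge T U).pt ((wedge T U).toSSet.map θ σ) a).1 ≤ T.last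
        from fun a => h1 _), left_map, NatTrans.naturality_apply]
    · have h3 := (left_or_right σ).resolve_left h1
      rw [if_neg h1]
      split_ifs with h2
      · rw [glue t u h _ fun a => le_antisymm (h2 a) (h3 _), right_map, NatTrans.naturality_apply]
      · rw [right_map, NatTrans.naturality_apply]

theorem desc_inl_app {S : SSet.{u}} {T U : Necklace.{u}} (t : T.toSSet ⟶ S) (u : U.toSSet ⟶ S)
    (h : t.app _ (T.vertex (Fin.last _)) = u.app _ (U.vertex 0)) {m : SimplexCategoryᵒᵖ}
    (σ : T.toSSet.obj m) : (desc t u h).app m ((inl T U).app m σ) = t.app m σ := by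
  refine (if_pos (fun a => ?_)).trans (congrArg (t.app m) (left_inl (U := U) σ))
  rw [pt_inl]
  exact Nat.le_of_lt_succ (T.pt σ a).2

theorem desc_inr_app {S : SSet.{u}} {T U : Necklace.{u}} (t : T.toSSet ⟶ S) (u : U.toSSet ⟶ S)
    (h : t.app _ (T.vertex (Fin.last _)) = u.app _ (U.vertex 0)) {m : SimplexCategoryᵒᵖ}
    (σ : U.toSSet.obj m) : (desc t u h).app m ((inr T U).app m σ) = u.app m σ := by
  refine Eq.trans ?_ (congrArg (u.app m) (right_inr (T := T) σ))
  by_cases h2 : ∀ a, ((wedge T U).pt ((inr T U).app m σ) a).1 ≤ T.last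
  · refine (if_pos h2).trans (glue t u h _ fun a => le_antisymm (h2 a) ?_)
    rw [pt_inr]; exact Nat.le_add_right _ _
  · exact if_neg h2

theorem inl_desc {S : SSet.{u}} {T U : Necklace.{u}} (t : T.toSSet ⟶ S) (u : U.toSSet ⟶ S)
    (h : t.app _ (T.vertex (Fin.last _)) = u.app _ (U.vertex 0)) :
    inl T U ≫ desc t u h = t :=
  NatTrans.ext (funext fun _ => ConcreteCategory.hom_ext _ _ fun σ => desc_inl_app t u h σ)

theorem inr_desc {S : SSet.{u}} {T U : Necklace.{u}} (t : T.toSSet ⟶ S) (u : U.toSSet ⟶ S)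
    (h : t.app _ (T.vertex (Fin.last _)) = u.app _ (U.vertex 0)) :
    inr T U ≫ desc t u h = u :=
  NatTrans.ext (funext fun _ => ConcreteCategory.hom_ext _ _ fun σ => desc_inr_app t u h σ)

theorem wedge_hom_ext {S : SSet.{u}} {T U : Necklace.{u}} {f g : (wedge T U).toSSet ⟶ S}
    (h1 : inl T U ≫ f = inl T U ≫ g) (h2 : inr T U ≫ f = inr T U ≫ g) : f = g := by
  ext m σ
  rcases left_or_right σ with h | h
  · have := NatTrans.congr_app h1 m
    have := ConcreteCategory.congr_hom this (left σ)
    rw [← inl_left σ h]; exact this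
  · have := NatTrans.congr_app h2 m
    have := ConcreteCategory.congr_hom this (right σ)
    rw [← inr_right σ h]; exact this

theorem vertex_inlV {T U : Necklace.{u}} (v : Fin (T.last + 1)) :
    (wedge T U).vertex (inlV T U v) = (inl T U).app _ (T.vertex v) := rfl

theorem vertex_inrV {T U : Necklace.{u}} (v : Fin (U.last + 1)) :
    (wedge T U).vertex (inrV T U v) = (inr T U).app _ (U.vertex v) := rfl

theorem inl_last {T U : Necklace.{u}} :
    (inl T U).app _ (T.vertex (Fin.last _)) = (inr T U).app _ (U.vertex 0) := rfl

theorem desc_zero {S : SSet.{u}} {T U : Necklace.{u}} (t : T.toSSet ⟶ S) (u : U.toSSet ⟶ S)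
    (h : t.app _ (T.vertex (Fin.last _)) = u.app _ (U.vertex 0)) :
    (desc t u h).app _ ((wedge T U).vertex 0) = t.app _ (T.vertex 0) :=
  desc_inl_app t u h (T.vertex 0)

theorem desc_last {S : SSet.{u}} {T U : Necklace.{u}} (t : T.toSSet ⟶ S) (u : U.toSSet ⟶ S)
    (h : t.app _ (T.vertex (Fin.last _)) = u.app _ (U.vertex 0)) :
    (desc t u h).app _ ((wedge T U).vertex (Fin.last _)) = u.app _ (U.vertex (Fin.last _)) :=
  desc_inr_app t u h (U.vertex (Fin.last _))

theorem vert_desc_inlV {V T U : Necklace.{u}} (t : T.toSSet ⟶ V.toSSet) (u : U.toSSet ⟶ V.toSSet)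
    (h : t.app _ (T.vertex (Fin.last _)) = u.app _ (U.vertex 0)) (v : Fin (T.last + 1)) :
    vert (desc t u h) (inlV T U v) = vert t v := by
  rw [← vert_inl, ← vert_comp, inl_desc]

theorem vert_desc_inrV {V T U : Necklace.{u}} (t : T.toSSet ⟶ V.toSSet) (u : U.toSSet ⟶ V.toSSet)
    (h : t.app _ (T.vertex (Fin.last _)) = u.app _ (U.vertex 0)) (v : Fin (U.last + 1)) :
    vert (desc t u h) (inrV T U v) = vert u v := by
  rw [← vert_inr, ← vert_comp, inr_desc]

theorem wedgeMap_glue {T T' U U' : Necklace.{u}} (f : T ⟶ T') (g : U ⟶ U') :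
    (f.1 ≫ inl T' U').app _ (T.vertex (Fin.last _)) =
      (g.1 ≫ inr T' U').app _ (U.vertex 0) := by
  change (inl T' U').app _ (f.1.app _ _) = (inr T' U').app _ (g.1.app _ _)
  rw [f.2.2, g.2.1, inl_last]

/-- The wedge `f ∨ g : T ∨ U ⟶ T' ∨ U'` of two morphisms of necklaces. -/
noncomputable def wedgeMap {T T' U U' : Necklace.{u}} (f : T ⟶ T') (g : U ⟶ U') :
    wedge T U ⟶ wedge T' U' :=
  ⟨desc (f.1 ≫ inl T' U') (g.1 ≫ inr T' U') (wedgeMap_glue f g), by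
    constructor
    · rw [desc_zero]
      change (inl T' U').app _ (f.1.app _ _) = _
      rw [f.2.1]; rfl
    · rw [desc_last]
      change (inr T' U').app _ (g.1.app _ _) = _
      rw [g.2.2]; rfl⟩

/-- The union `X ∪ Y ⊆ V_{T ∨ U}` of two sets `X ⊆ V_T` and `Y ⊆ V_U`. -/
def unionSet (T U : Necklace.{u}) (X : Finset (Fin (T.last + 1)))
    (Y : Finset (Fin (U.last + 1))) : Finset (Fin ((wedge T U).last + 1)) :=
  X.image (inlV T U) ∪ Y.image (inrV T U)

theorem joints_subset_unionSet {T U : Necklace.{u}} {X : Finset (Fin (T.last + 1))}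
    {Y : Finset (Fin (U.last + 1))} (hX : T.joints ⊆ X) (hY : U.joints ⊆ Y) :
    (wedge T U).joints ⊆ unionSet T U X Y :=
  Finset.union_subset_union (Finset.image_subset_image hX) (Finset.image_subset_image hY)

/-- The isomorphism `𝟏ᴺ × 𝟏ᴹ ⟶ 𝟏ᴺ⁺ᴹ` for the dimensions `N` of `T`, `M` of `U` and `N + M` of
`T ∨ U`, in terms of sets of vertices the map `(X, Y) ↦ X ∪ Y`. -/
def unionStr (T U : Necklace.{u}) (s : Str (T.dim + U.dim)) : Str (wedge T U).dim :=
  (wedge T U).toStr (unionSet T U (T.ofStr fun i => s (Fin.castAdd _ i))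
    (U.ofStr fun i => s (Fin.natAdd _ i)))

theorem isCubeMap_unionStr (T U : Necklace.{u}) : IsCubeMap (unionStr T U) := by
  refine isCubeMap_of_monotone _ rfl _
    (Fin.append (fun i => inlV T U (T.freeVertex i)) (fun i => inrV T U (U.freeVertex i)))
    (wedge T U).freeVertex
    (fun i => (wedge T U).freeVertex i ∈ (wedge T U).joints) ?_
    (wedge T U).freeVertex.strictMono fun s i => ?_
  · intro a b
    refine Fin.addCases (fun a => ?_) (fun a => ?_) a <;>
    refine Fin.addCases (fun b => ?_) (fun b => ?_) b <;> intro hab <;>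
    simp only [Fin.append_left, Fin.append_right]
    · exact T.freeVertex.monotone (Fin.le_def.2 (by simpa using Fin.le_def.1 hab))
    · have := (T.freeVertex a).2
      refine Fin.le_def.2 ?_
      change (T.freeVertex a).1 ≤ T.last + (U.freeVertex b).1
      omega
    · have := Fin.le_def.1 hab; simp at this; omega
    · exact Nat.add_le_add_left (U.freeVertex.monotone
        (Fin.le_def.2 (by simpa using Fin.le_def.1 hab))) _
  · have key : ∀ P : Fin (T.dim + U.dim) → Prop, (∃ j, P j) ↔
        (∃ j, P (Fin.castAdd _ j)) ∨ ∃ j, P (Fin.natAdd _ j) := fun P =>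
      ⟨fun ⟨j, hj⟩ => by
        revert hj
        refine Fin.addCases (fun j => ?_) (fun j => ?_) j
        exacts [fun hj => Or.inl ⟨j, hj⟩, fun hj => Or.inr ⟨j, hj⟩],
        fun hP => hP.elim (fun ⟨j, hj⟩ => ⟨_, hj⟩) fun ⟨j, hj⟩ => ⟨_, hj⟩⟩
    rw [key]
    have hJ : ∀ v, v ∈ (wedge T U).joints ↔
        v ∈ T.joints.image (inlV T U) ∨ v ∈ U.joints.image (inrV T U) :=
      fun v => Finset.mem_union
    simp only [unionStr, toStr, unionSet, ofStr, Finset.image_union, Finset.mem_union,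
      decide_eq_true_eq, hJ, Fin.append_left, Fin.append_right]
    simp only [Finset.mem_image, Finset.mem_filter, Finset.mem_univ, true_and,
      exists_exists_and_eq_and]
    exact or_or_or_comm

theorem unionStr_natural {T T' U U' : Necklace.{u}} (f : T ⟶ T') (g : U ⟶ U')
    (s : Str (T.dim + U.dim)) :
    strMap (wedgeMap f g) (unionStr T U s) = unionStr T' U' (strProd (strMap f) (strMap g) s) := by
  have hX := T.joints_subset_ofStr fun i => s (Fin.castAdd _ i)
  have hY := U.joints_subset_ofStr fun i => s (Fin.natAdd _ i)
  simp only [strMap, unionStr, strProd, Fin.append_left, Fin.append_right]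
  rw [ofStr_toStr _ (joints_subset_unionSet hX hY),
    ofStr_toStr _ ((joints_subset_image f).trans (Finset.image_subset_image hX)),
    ofStr_toStr _ ((joints_subset_image g).trans (Finset.image_subset_image hY))]
  simp only [unionSet, Finset.image_union, Finset.image_image]
  refine congrArg₂ (fun A B => (wedge T' U').toStr (A ∪ B)) ?_ ?_
  · refine Finset.image_congr fun v _ => ?_
    exact (vert_desc_inlV _ _ (wedgeMap_glue f g) v).trans (vert_comp _ _ _)
  · refine Finset.image_congr fun v _ => ?_
    exact (vert_desc_inrV _ _ (wedgeMap_glue f g) v).trans (vert_comp _ _ _)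

end Necklace

/-! ## The mapping spaces of the cubical rigidification -/

/-- A cubical set with connections: a presheaf on `□_c`. -/
abbrev CubicalSet : Type (u + 1) := Cubeᵒᵖ ⥤ Type u

/-- The set of `n`-cells of a cubical set with connections. -/
abbrev CubicalSet.cells (K : CubicalSet.{u}) (n : ℕ) : Type u := K.obj (op ⟨n⟩)

/-- The set `S₀` of vertices of a simplicial set. -/
abbrev Vertices (S : SSet.{u}) : Type u := S.obj (op (SimplexCategory.mk 0))

/-- The objects of `(Nec ↓ S)_{x,y}`: the maps `T ⟶ S` from a necklace which send the first vertex
to `x` and the last vertex to `y`. -/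
structure NecklaceIn (S : SSet.{u}) (x y : Vertices S) : Type u where
  /-- the necklace `T` -/
  nec : Necklace.{u}
  /-- the map `T ⟶ S` -/
  map : nec.toSSet ⟶ S
  map_first : map.app _ (nec.vertex 0) = x
  map_last : map.app _ (nec.vertex (Fin.last _)) = y

/-- The morphisms of `(Nec ↓ S)_{x,y}`. -/
structure NecklaceIn.Hom {S : SSet.{u}} {x y : Vertices S} (t t' : NecklaceIn S x y) :
    Type u where
  /-- the morphism of necklaces -/
  hom : t.nec ⟶ t'.nec
  w : hom.1 ≫ t'.map = t.map

/-- The cells of dimension `c` of all standard cubes `C_{□_c}(T) = Hom(-, P_𝟏(T))`, for `T ⟶ S` in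
`(Nec ↓ S)_{x,y}`. -/
structure PreCell (S : SSet.{u}) (x y : Vertices S) (c : Cube) : Type u where
  /-- the map `T ⟶ S` -/
  obj : NecklaceIn S x y
  /-- the cell of `C_{□_c}(T)` -/
  cell : c ⟶ Necklace.toCube.obj obj.nec

/-- The identification `(t, a) ∼ (t', C_{□_c}(f)(a))` for a morphism `f : t ⟶ t'` of
`(Nec ↓ S)_{x,y}`. -/
def PreCell.Rel {S : SSet.{u}} {x y : Vertices S} {c : Cube} (a a' : PreCell S x y c) : Prop :=
  ∃ f : a.obj.Hom a'.obj, a.cell ≫ Necklace.toCube.map f.hom = a'.cell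

/-- The mapping space `ℭ_{□_c}(S)(x, y)`, the colimit of the standard cubes `C_{□_c}(T)` over all
`T ⟶ S` in `(Nec ↓ S)_{x,y}`.  Colimits of presheaves are computed cellwise, so its set of cells of
dimension `c` is the quotient of the disjoint union of the sets of cells of dimension `c` of all
`C_{□_c}(T)` by the equivalence relation generated by `PreCell.Rel`. -/
def mapSpace (S : SSet.{u}) (x y : Vertices S) : CubicalSet.{u} where
  obj c := Quot (PreCell.Rel (S := S) (x := x) (y := y) (c := c.unop))
  map θ := ↾(Quot.map (fun a => ⟨a.obj, θ.unop ≫ a.cell⟩) (by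
    rintro a a' ⟨f, hf⟩
    exact ⟨f, by rw [Category.assoc, hf]⟩))
  map_id c := by
    ext a
    induction a using Quot.ind with | mk a => ?_
    exact congrArg (fun f => Quot.mk _ (PreCell.mk a.obj f)) (Category.id_comp _)
  map_comp θ θ' := by
    ext a
    induction a using Quot.ind with | mk a => ?_
    exact congrArg (fun f => Quot.mk _ (PreCell.mk a.obj f)) (Category.assoc _ _ _)

section MappingSpaces

variable {S : SSet.{u}} {x y z w : Vertices S}

/-- The object `T ∨ U ⟶ S` of `(Nec ↓ S)_{x,z}` obtained from objects `T ⟶ S` of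
`(Nec ↓ S)_{x,y}` and `U ⟶ S` of `(Nec ↓ S)_{y,z}`. -/
noncomputable def NecklaceIn.wedge (t : NecklaceIn S x y) (r : NecklaceIn S y z) :
    NecklaceIn S x z where
  nec := Necklace.wedge t.nec r.nec
  map := Necklace.desc t.map r.map (t.map_last.trans r.map_first.symm)
  map_first := (Necklace.desc_zero _ _ _).trans t.map_first
  map_last := (Necklace.desc_last _ _ _).trans r.map_last

theorem NecklaceIn.inl_wedge (t : NecklaceIn S x y) (r : NecklaceIn S y z) :
    Necklace.inl t.nec r.nec ≫ (t.wedge r).map = t.map :=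
  Necklace.inl_desc _ _ (t.map_last.trans r.map_first.symm)

theorem NecklaceIn.inr_wedge (t : NecklaceIn S x y) (r : NecklaceIn S y z) :
    Necklace.inr t.nec r.nec ≫ (t.wedge r).map = r.map :=
  Necklace.inr_desc _ _ (t.map_last.trans r.map_first.symm)

/-- The wedge of two morphisms. -/
noncomputable def NecklaceIn.wedgeHom {t t' : NecklaceIn S x y} {r r' : NecklaceIn S y z}
    (f : t.Hom t') (g : r.Hom r') : (t.wedge r).Hom (t'.wedge r') :=
  ⟨Necklace.wedgeMap f.hom g.hom, Necklace.wedge_hom_ext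
    ((congrArg (· ≫ (t'.wedge r').map)
        (Necklace.inl_desc _ _ (Necklace.wedgeMap_glue f.hom g.hom))).trans
      ((congrArg (f.hom.1 ≫ ·) (inl_wedge t' r')).trans (f.w.trans (inl_wedge t r).symm)))
    ((congrArg (· ≫ (t'.wedge r').map)
        (Necklace.inr_desc _ _ (Necklace.wedgeMap_glue f.hom g.hom))).trans
      ((congrArg (g.hom.1 ≫ ·) (inr_wedge t' r')).trans (g.w.trans (inr_wedge t r).symm)))⟩

/-- The identity of an object of `(Nec ↓ S)_{x,y}`. -/
def NecklaceIn.idHom (t : NecklaceIn S x y) : t.Hom t := ⟨𝟙 _, Category.id_comp _⟩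

/-- The product of two morphisms of `□_c`, with `𝟏ⁿ × 𝟏ᵐ = 𝟏ⁿ⁺ᵐ`. -/
def Cube.prod {n n' m m' : ℕ} (f : (⟨n⟩ : Cube) ⟶ ⟨n'⟩) (g : (⟨m⟩ : Cube) ⟶ ⟨m'⟩) :
    (⟨n + m⟩ : Cube) ⟶ ⟨n' + m'⟩ :=
  Cube.ofMap (strProd f.1 g.1) (f.2.prod g.2)

/-- The isomorphism `P_𝟏(T) × P_𝟏(U) ⟶ P_𝟏(T ∨ U)`. -/
def Necklace.unionCube (T U : Necklace.{u}) :
    (⟨T.dim + U.dim⟩ : Cube) ⟶ toCube.obj (wedge T U) :=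
  Cube.ofMap (unionStr T U) (isCubeMap_unionStr T U)

theorem Cube.prod_comp {n n' n'' m m' m'' : ℕ} (f : (⟨n⟩ : Cube) ⟶ ⟨n'⟩)
    (f' : (⟨n'⟩ : Cube) ⟶ ⟨n''⟩) (g : (⟨m⟩ : Cube) ⟶ ⟨m'⟩) (g' : (⟨m'⟩ : Cube) ⟶ ⟨m''⟩) :
    Cube.prod (f ≫ f') (g ≫ g') = Cube.prod f g ≫ Cube.prod f' g' :=
  Cube.hom_ext fun s => by
    change strProd (fun s => f'.1 (f.1 s)) (fun s => g'.1 (g.1 s)) s =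
      strProd f'.1 g'.1 (strProd f.1 g.1 s)
    simp [strProd]

theorem Necklace.unionCube_natural {T T' U U' : Necklace.{u}} (f : T ⟶ T') (g : U ⟶ U') :
    unionCube T U ≫ toCube.map (wedgeMap f g) =
      Cube.prod (toCube.map f) (toCube.map g) ≫ unionCube T' U' :=
  Cube.hom_ext fun s => unionStr_natural f g s

/-- The product of two cells of standard cubes. -/
noncomputable def PreCell.mul {n m : ℕ} (a : PreCell S x y ⟨n⟩) (b : PreCell S y z ⟨m⟩) :
    PreCell S x z ⟨n + m⟩ :=
  ⟨a.obj.wedge b.obj, Cube.prod a.cell b.cell ≫ Necklace.unionCube a.obj.nec b.obj.nec⟩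

theorem PreCell.Rel.mul {n m : ℕ} {a a' : PreCell S x y ⟨n⟩} {b b' : PreCell S y z ⟨m⟩}
    (ha : a.Rel a') (hb : b.Rel b') : (a.mul b).Rel (a'.mul b') := by
  obtain ⟨f, hf⟩ := ha
  obtain ⟨g, hg⟩ := hb
  refine ⟨NecklaceIn.wedgeHom f g, ?_⟩
  change (Cube.prod a.cell b.cell ≫ Necklace.unionCube a.obj.nec b.obj.nec) ≫
    Necklace.toCube.map (Necklace.wedgeMap f.hom g.hom) = Cube.prod a'.cell b'.cell ≫ _
  rw [Category.assoc, Necklace.unionCube_natural, ← Category.assoc, ← hf, ← hg]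
  exact congrArg (· ≫ _) (Cube.prod_comp _ _ _ _).symm

theorem PreCell.Rel.refl {c : Cube} (a : PreCell S x y c) : a.Rel a :=
  ⟨a.obj.idHom, by
    change a.cell ≫ Necklace.toCube.map (𝟙 _) = _
    rw [CategoryTheory.Functor.map_id, Category.comp_id]⟩

/-- The composition law of `ℭ_{□_c}(S)`, induced by the wedge of necklaces.  A map of cubical sets
with connections `K ⊗ K' ⟶ L`, where `K ⊗ K'` is the colimit of the standard cubes `□ⁿ⁺ᵐ` over
all cells `□ⁿ ⟶ K` and `□ᵐ ⟶ K'`, is the same as a family of maps `K_n × K'_m → L_{n+m}` which is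
natural in both variables (see `comp_natural`); here `K = ℭ_{□_c}(S)(x, y)`,
`K' = ℭ_{□_c}(S)(y, z)` and `L = ℭ_{□_c}(S)(x, z)`. -/
noncomputable def comp {n m : ℕ} : (mapSpace S x y).cells n → (mapSpace S y z).cells m →
    (mapSpace S x z).cells (n + m) :=
  Quot.map₂ PreCell.mul (fun a _ _ h => (PreCell.Rel.refl a).mul h)
    (fun _ _ b h => h.mul (PreCell.Rel.refl b))

theorem comp_natural {n n' m m' : ℕ} (f : (⟨n⟩ : Cube) ⟶ ⟨n'⟩) (g : (⟨m⟩ : Cube) ⟶ ⟨m'⟩)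
    (a : (mapSpace S x y).cells n') (b : (mapSpace S y z).cells m') :
    comp ((mapSpace S x y).map f.op a) ((mapSpace S y z).map g.op b) =
      (mapSpace S x z).map (Cube.prod f g).op (comp a b) := by
  induction a using Quot.ind with | mk a => ?_
  induction b using Quot.ind with | mk b => ?_
  refine congrArg (fun h => Quot.mk _ (PreCell.mk (a.obj.wedge b.obj) h)) ?_
  exact (congrArg (· ≫ _) (Cube.prod_comp f a.cell g b.cell)).trans (Category.assoc _ _ _)

/-- The necklace `Δ⁰` (without beads). -/
def Necklace.point : Necklace.{u} where
  last := 0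
  joints := Finset.univ
  zero_mem := Finset.mem_univ _
  last_mem := Finset.mem_univ _

/-- The map `Δ⁰ ⟶ S` with value `x`. -/
def Necklace.const (x : Vertices S) : Necklace.point.toSSet ⟶ S where
  app m := ↾fun _ => S.map (toPoint m) x
  naturality m m' θ := by
    ext σ
    change S.map (toPoint m') x = S.map θ (S.map (toPoint m) x)
    rw [← toPoint_comp θ, Functor.map_comp]
    rfl

theorem Necklace.const_app (x : Vertices S) (v : Fin 1) :
    (Necklace.const x).app _ (Necklace.point.vertex v) = x := by
  change S.map (toPoint _) x = x
  have : toPoint (op (SimplexCategory.mk 0)) = 𝟙 _ := by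
    apply Quiver.Hom.unop_inj
    ext a : 3
    exact Subsingleton.elim (α := Fin 1) _ _
  rw [this, CategoryTheory.Functor.map_id]
  rfl

theorem isCubeMap_of_zero {n : ℕ} (f : Str 0 → Str n) : IsCubeMap f :=
  isCubeMap_of_monotone _ rfl f (fun i => i.elim0) (fun i : Fin n => i)
    (fun i => f (fun j => j.elim0) i = true) (fun i => i.elim0) strictMono_id fun s i => by
      rw [Subsingleton.elim s fun j => j.elim0]
      exact ⟨Or.inl, fun h => h.elim _root_.id fun ⟨j, _⟩ => j.elim0⟩

/-- The object `Δ⁰ ⟶ S` of `(Nec ↓ S)_{x,x}`. -/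
def NecklaceIn.point (x : Vertices S) : NecklaceIn S x x :=
  ⟨Necklace.point, Necklace.const x, Necklace.const_app x _, Necklace.const_app x _⟩

/-- Reindexing along an equality of dimensions. -/
def Cube.cast {n m : ℕ} (h : m = n) : (⟨n⟩ : Cube) ⟶ ⟨m⟩ :=
  Cube.ofMap (fun s i => s (Fin.cast h i)) (isCubeMap_cast h)

theorem sigma_cells_eq {K : CubicalSet.{u}} {n m : ℕ} (h : m = n) {a : K.cells n} {b : K.cells m}
    (hab : a = K.map (Cube.cast h).op b) : (⟨n, a⟩ : Σ n, K.cells n) = ⟨m, b⟩ := by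
  subst h
  have h1 : Cube.cast (rfl : m = m) = 𝟙 _ := rfl
  rw [h1, op_id, CategoryTheory.Functor.map_id] at hab
  subst hab
  rfl

theorem Necklace.assoc_glue (T U V : Necklace.{u}) :
    (inl T (wedge U V)).app _ (T.vertex (Fin.last _)) =
      (inl U V ≫ inr T (wedge U V)).app _ (U.vertex 0) := rfl

/-- The isomorphism `(T ∨ U) ∨ V ⟶ T ∨ (U ∨ V)`. -/
noncomputable def Necklace.assocMap (T U V : Necklace.{u}) :
    wedge (wedge T U) V ⟶ wedge T (wedge U V) :=
  ⟨desc (desc (inl T (wedge U V)) (inl U V ≫ inr T (wedge U V)) (assoc_glue T U V))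
    (inr U V ≫ inr T (wedge U V)) (desc_last _ _ (assoc_glue T U V)),
    (desc_zero _ _ _).trans (desc_zero _ _ (assoc_glue T U V)), desc_last _ _ _⟩

theorem Necklace.inl_assocMap (T U V : Necklace.{u}) :
    inl (wedge T U) V ≫ (assocMap T U V).1 =
      desc (inl T (wedge U V)) (inl U V ≫ inr T (wedge U V)) (assoc_glue T U V) :=
  inl_desc _ _ (desc_last _ _ (assoc_glue T U V))

theorem Necklace.inr_assocMap (T U V : Necklace.{u}) :
    inr (wedge T U) V ≫ (assocMap T U V).1 = inr U V ≫ inr T (wedge U V) :=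
  inr_desc _ _ (desc_last _ _ (assoc_glue T U V))

theorem NecklaceIn.assocMap_w (t : NecklaceIn S x y) (r : NecklaceIn S y z)
    (q : NecklaceIn S z w) :
    (Necklace.assocMap t.nec r.nec q.nec).1 ≫ (t.wedge (r.wedge q)).map =
      ((t.wedge r).wedge q).map := by
  refine Necklace.wedge_hom_ext ?_ ?_
  · refine Eq.trans ?_ (inl_wedge (t.wedge r) q).symm
    refine (congrArg (· ≫ (t.wedge (r.wedge q)).map) (Necklace.inl_assocMap t.nec r.nec q.nec)).trans ?_
    refine Necklace.wedge_hom_ext ?_ ?_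
    · exact (congrArg (· ≫ (t.wedge (r.wedge q)).map)
        (Necklace.inl_desc _ _ (Necklace.assoc_glue _ _ _))).trans
        ((inl_wedge t (r.wedge q)).trans (inl_wedge t r).symm)
    · exact (congrArg (· ≫ (t.wedge (r.wedge q)).map)
        (Necklace.inr_desc _ _ (Necklace.assoc_glue _ _ _))).trans
        ((congrArg (Necklace.inl r.nec q.nec ≫ ·) (inr_wedge t (r.wedge q))).trans
          ((inl_wedge r q).trans (inr_wedge t r).symm))
  · refine Eq.trans ?_ (inr_wedge (t.wedge r) q).symm
    exact (congrArg (· ≫ (t.wedge (r.wedge q)).map) (Necklace.inr_assocMap t.nec r.nec q.nec)).trans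
      ((congrArg (Necklace.inr r.nec q.nec ≫ ·) (inr_wedge t (r.wedge q))).trans
        (inr_wedge r q))

theorem Necklace.vert_assocMap_inl (T U V : Necklace.{u}) (v : Fin ((wedge T U).last + 1)) :
    vert (assocMap T U V).1 (inlV _ _ v) =
      vert (desc (inl T (wedge U V)) (inl U V ≫ inr T (wedge U V)) (assoc_glue T U V)) v :=
  vert_desc_inlV _ _ (desc_last _ _ (assoc_glue T U V)) v

theorem Necklace.vert_assocMap_inr (T U V : Necklace.{u}) (v : Fin (V.last + 1)) :
    vert (assocMap T U V).1 (inrV (wedge T U) V v) = inrV T (wedge U V) (inrV U V v) :=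
  (vert_desc_inrV _ _ (desc_last _ _ (assoc_glue T U V)) v).trans (vert_comp _ _ _)

theorem Necklace.unionSet_assoc (T U V : Necklace.{u}) (X : Finset (Fin (T.last + 1)))
    (Y : Finset (Fin (U.last + 1))) (Z : Finset (Fin (V.last + 1))) :
    (unionSet (wedge T U) V (unionSet T U X Y) Z).image (vert (assocMap T U V).1) =
      unionSet T (wedge U V) X (unionSet U V Y Z) := by
  simp only [unionSet, Finset.image_union, Finset.image_image, Finset.union_assoc]
  refine congrArg₂ (· ∪ ·) ?_ (congrArg₂ (· ∪ ·) ?_ ?_)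
  · refine Finset.image_congr fun v _ => ?_
    exact (vert_assocMap_inl T U V _).trans (vert_desc_inlV _ _ (assoc_glue T U V) v)
  · refine Finset.image_congr fun v _ => ?_
    exact (vert_assocMap_inl T U V _).trans
      ((vert_desc_inrV _ _ (assoc_glue T U V) v).trans (vert_comp _ _ _))
  · refine Finset.image_congr fun v _ => ?_
    exact vert_assocMap_inr T U V v

theorem Necklace.unionStr_append (T U : Necklace.{u}) (p : Str T.dim) (q : Str U.dim) :
    unionStr T U (Fin.append p q) =
      (wedge T U).toStr (unionSet T U (T.ofStr p) (U.ofStr q)) := by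
  simp only [unionStr, Fin.append_left, Fin.append_right]

theorem Necklace.ofStr_unionStr (T U : Necklace.{u}) (p : Str T.dim) (q : Str U.dim) :
    (wedge T U).ofStr (unionStr T U (Fin.append p q)) =
      unionSet T U (T.ofStr p) (U.ofStr q) := by
  rw [unionStr_append, ofStr_toStr]
  exact joints_subset_unionSet (joints_subset_ofStr _ _) (joints_subset_ofStr _ _)

theorem Necklace.strMap_assocMap (T U V : Necklace.{u}) (p : Str T.dim) (q : Str U.dim)
    (r : Str V.dim) :
    strMap (assocMap T U V) (unionStr (wedge T U) V (Fin.append (unionStr T U (Fin.append p q)) r)) =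
      unionStr T (wedge U V) (Fin.append p (unionStr U V (Fin.append q r))) := by
  rw [strMap, ofStr_unionStr, ofStr_unionStr, unionStr_append, ofStr_unionStr, unionSet_assoc]

theorem PreCell.assoc_rel {n m l : ℕ} (a : PreCell S x y ⟨n⟩) (b : PreCell S y z ⟨m⟩)
    (c : PreCell S z w ⟨l⟩) :
    ((a.mul b).mul c).Rel
      ⟨a.obj.wedge (b.obj.wedge c.obj),
        Cube.cast (Nat.add_assoc n m l).symm ≫ (a.mul (b.mul c)).cell⟩ := by
  refine ⟨⟨Necklace.assocMap a.obj.nec b.obj.nec c.obj.nec,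
    NecklaceIn.assocMap_w a.obj b.obj c.obj⟩, Cube.hom_ext fun s => ?_⟩
  have h : (fun i : Fin l => s (Fin.natAdd (n + m) i)) =
      fun i => s (Fin.cast (Nat.add_assoc n m l).symm (Fin.natAdd n (Fin.natAdd m i))) :=
    funext fun i => congrArg s (Fin.ext (Nat.add_assoc n m i.1))
  refine (Necklace.strMap_assocMap a.obj.nec b.obj.nec c.obj.nec
    (a.cell.1 fun i => s (Fin.castAdd l (Fin.castAdd m i)))
    (b.cell.1 fun i => s (Fin.castAdd l (Fin.natAdd n i)))
    (c.cell.1 fun i => s (Fin.natAdd (n + m) i))).trans ?_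
  rw [h]
  rfl

theorem comp_assoc {n m l : ℕ} (a : (mapSpace S x y).cells n) (b : (mapSpace S y z).cells m)
    (c : (mapSpace S z w).cells l) :
    (⟨n + m + l, comp (comp a b) c⟩ : Σ n, (mapSpace S x w).cells n) =
      ⟨n + (m + l), comp a (comp b c)⟩ := by
  refine sigma_cells_eq (Nat.add_assoc n m l).symm ?_
  induction a using Quot.ind with | mk a => ?_
  induction b using Quot.ind with | mk b => ?_
  induction c using Quot.ind with | mk c => ?_
  exact Quot.sound (PreCell.assoc_rel a b c)

/-- The isomorphism `Δ⁰ ∨ T ⟶ T`. -/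
noncomputable def Necklace.pointWedge (T : Necklace.{u}) : wedge point T ⟶ T :=
  ⟨desc (const (T.vertex 0)) (𝟙 _) (const_app _ _),
    (desc_zero _ _ (const_app _ _)).trans (const_app _ _), desc_last _ _ (const_app _ _)⟩

/-- The isomorphism `T ∨ Δ⁰ ⟶ T`. -/
noncomputable def Necklace.wedgePoint (T : Necklace.{u}) : wedge T point ⟶ T :=
  ⟨desc (𝟙 _) (const (T.vertex (Fin.last _))) (const_app _ _).symm,
    desc_zero _ _ (const_app _ _).symm,
    (desc_last _ _ (const_app _ _).symm).trans (const_app _ _)⟩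

theorem Necklace.const_comp {S S' : SSet.{u}} (x : Vertices S) (f : S ⟶ S') :
    const x ≫ f = const (f.app _ x) :=
  NatTrans.ext (funext fun m => ConcreteCategory.hom_ext _ _ fun _ =>
    NatTrans.naturality_apply f (toPoint m) x)

theorem Necklace.strMap_pointWedge (T : Necklace.{u}) (p : Str T.dim) :
    strMap (pointWedge T)
      (unionStr point T (Fin.append (Necklace.point.toStr Necklace.point.joints) p)) = p := by
  rw [strMap, ofStr_unionStr, ofStr_toStr _ (Finset.Subset.refl _)]
  refine Eq.trans (congrArg T.toStr ?_) (T.toStr_ofStr p)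
  rw [unionSet, Finset.image_union, Finset.image_image, Finset.image_image]
  have h1 : point.joints.image (vert (pointWedge T).1 ∘ inlV point T) ⊆ T.ofStr p := by
    intro v hv
    obtain ⟨w, -, rfl⟩ := Finset.mem_image.1 hv
    obtain rfl : w = 0 := Subsingleton.elim (α := Fin 1) _ _
    have := vert_zero (pointWedge T)
    exact T.joints_subset_ofStr p ((congrArg (· ∈ T.joints) this).mpr T.zero_mem)
  have h2 : (T.ofStr p).image (vert (pointWedge T).1 ∘ inrV point T) = T.ofStr p := by
    refine Eq.trans (Finset.image_congr (g := _root_.id) fun v _ => ?_) Finset.image_id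
    exact vert_desc_inrV _ _ (const_app _ _) v
  rw [h2]
  exact Finset.union_eq_right.2 h1

theorem Necklace.strMap_wedgePoint (T : Necklace.{u}) (p : Str T.dim) :
    strMap (wedgePoint T)
      (unionStr T point (Fin.append p (Necklace.point.toStr Necklace.point.joints))) = p := by
  rw [strMap, ofStr_unionStr, ofStr_toStr _ (Finset.Subset.refl _)]
  refine Eq.trans (congrArg T.toStr ?_) (T.toStr_ofStr p)
  rw [unionSet, Finset.image_union, Finset.image_image, Finset.image_image]
  have h1 : point.joints.image (vert (wedgePoint T).1 ∘ inrV T point) ⊆ T.ofStr p := by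
    intro v hv
    obtain ⟨w, -, rfl⟩ := Finset.mem_image.1 hv
    obtain rfl : w = 0 := Subsingleton.elim (α := Fin 1) _ _
    have := vert_last (wedgePoint T)
    exact T.joints_subset_ofStr p ((congrArg (· ∈ T.joints) this).mpr T.last_mem)
  have h2 : (T.ofStr p).image (vert (wedgePoint T).1 ∘ inlV T point) = T.ofStr p := by
    refine Eq.trans (Finset.image_congr (g := _root_.id) fun v _ => ?_) Finset.image_id
    exact vert_desc_inlV _ _ (const_app _ _).symm v
  rw [h2]
  exact Finset.union_eq_left.2 h1

theorem NecklaceIn.pointWedge_w (t : NecklaceIn S x y) :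
    (Necklace.pointWedge t.nec).1 ≫ t.map = ((point x).wedge t).map := by
  refine Necklace.wedge_hom_ext ?_ ?_
  · refine Eq.trans ?_ (inl_wedge (point x) t).symm
    refine (congrArg (· ≫ t.map) (Necklace.inl_desc (Necklace.const (t.nec.vertex 0)) (𝟙 _)
      (Necklace.const_app _ _))).trans ?_
    exact (Necklace.const_comp _ _).trans (congrArg Necklace.const t.map_first)
  · refine Eq.trans ?_ (inr_wedge (point x) t).symm
    exact (congrArg (· ≫ t.map) (Necklace.inr_desc (Necklace.const (t.nec.vertex 0)) (𝟙 _)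
      (Necklace.const_app _ _))).trans (Category.id_comp _)

theorem NecklaceIn.wedgePoint_w (t : NecklaceIn S x y) :
    (Necklace.wedgePoint t.nec).1 ≫ t.map = (t.wedge (point y)).map := by
  refine Necklace.wedge_hom_ext ?_ ?_
  · refine Eq.trans ?_ (inl_wedge t (point y)).symm
    exact (congrArg (· ≫ t.map) (Necklace.inl_desc (𝟙 _)
      (Necklace.const (t.nec.vertex (Fin.last _))) (Necklace.const_app _ _).symm)).trans
      (Category.id_comp _)
  · refine Eq.trans ?_ (inr_wedge t (point y)).symm
    refine (congrArg (· ≫ t.map) (Necklace.inr_desc (𝟙 _)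
      (Necklace.const (t.nec.vertex (Fin.last _))) (Necklace.const_app _ _).symm)).trans ?_
    exact (Necklace.const_comp _ _).trans (congrArg Necklace.const t.map_last)

/-- The identity cell before taking the colimit. -/
def PreCell.one (x : Vertices S) : PreCell S x x ⟨0⟩ :=
  ⟨NecklaceIn.point x,
    Cube.ofMap (fun _ => Necklace.point.toStr Necklace.point.joints) (isCubeMap_of_zero _)⟩

theorem PreCell.one_rel {n : ℕ} (a : PreCell S x y ⟨n⟩) :
    ((one x).mul a).Rel ⟨a.obj, Cube.cast (Nat.zero_add n).symm ≫ a.cell⟩ := by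
  refine ⟨⟨Necklace.pointWedge a.obj.nec, NecklaceIn.pointWedge_w a.obj⟩,
    Cube.hom_ext fun s => ?_⟩
  refine (Necklace.strMap_pointWedge a.obj.nec (a.cell.1 fun i => s (Fin.natAdd 0 i))).trans ?_
  refine congrArg a.cell.1 (funext fun i => congrArg s (Fin.ext ?_))
  simp

theorem PreCell.rel_one {n : ℕ} (a : PreCell S x y ⟨n⟩) :
    (a.mul (one y)).Rel ⟨a.obj, Cube.cast (Nat.add_zero n).symm ≫ a.cell⟩ :=
  ⟨⟨Necklace.wedgePoint a.obj.nec, NecklaceIn.wedgePoint_w a.obj⟩,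
    Cube.hom_ext fun s => Necklace.strMap_wedgePoint a.obj.nec
      (a.cell.1 fun i => s (Fin.castAdd 0 i))⟩

/-- The identity `0`-cell of `x`, given by the constant necklace `Δ⁰ ⟶ S` at `x`. -/
def idCell (x : Vertices S) : (mapSpace S x x).cells 0 := Quot.mk _ (PreCell.one x)

theorem one_comp {n : ℕ} (a : (mapSpace S x y).cells n) :
    (⟨0 + n, comp (idCell x) a⟩ : Σ n, (mapSpace S x y).cells n) = ⟨n, a⟩ := by
  refine sigma_cells_eq (Nat.zero_add n).symm ?_
  induction a using Quot.ind with | mk a => ?_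
  exact Quot.sound (PreCell.one_rel a)

theorem comp_one {n : ℕ} (a : (mapSpace S x y).cells n) :
    (⟨n + 0, comp a (idCell y)⟩ : Σ n, (mapSpace S x y).cells n) = ⟨n, a⟩ := by
  refine sigma_cells_eq (Nat.add_zero n).symm ?_
  induction a using Quot.ind with | mk a => ?_
  exact Quot.sound (PreCell.rel_one a)

end MappingSpaces

/-! ### Identities between the generating functors -/

theorem coface_coface {n : ℕ} (j : Fin (n + 2)) (i : Fin (n + 1)) (η ε : Bool) (s : Str n) :
    coface j η (coface i ε s) = coface (j.succAbove i) ε (coface (i.predAbove j) η s) := by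
  refine (Fin.insertNth_eq_iff.2 ⟨?_, Fin.insertNth_eq_iff.2 ⟨?_, ?_⟩⟩).symm
  · simp [coface]
  · simp only [Fin.removeNth]
    rw [Fin.succAbove_succAbove_predAbove]
    simp [coface]
  · rw [← Fin.removeNth_removeNth_eq_swap]
    simp [coface]

theorem codegen_coface_self {n : ℕ} (j : Fin (n + 1)) (ε : Bool) (s : Str n) :
    codegen j (coface j ε s) = s :=
  Fin.removeNth_insertNth (α := fun _ => Bool) j ε s

theorem codegen_coface {n : ℕ} (i : Fin (n + 2)) (l : Fin (n + 1)) (ε : Bool) (s : Str (n + 1)) :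
    codegen i (coface (i.succAbove l) ε s) = coface l ε (codegen (l.predAbove i) s) := by
  refine (Fin.insertNth_eq_iff.2 ⟨?_, ?_⟩).symm
  · simp [coface, codegen, Fin.removeNth]
  · rw [codegen, codegen, Fin.removeNth_removeNth_eq_swap]
    simp [coface]

theorem coface_apply {n : ℕ} (j : Fin (n + 1)) (ε : Bool) (s : Str n) (i : Fin (n + 1)) :
    coface j ε s i = if h : i.1 < j.1 then s ⟨i.1, by omega⟩ else
      if h' : i.1 = j.1 then ε else s ⟨i.1 - 1, by omega⟩ := by
  refine Fin.succAboveCases j ?_ (fun i => ?_) i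
  · simp [coface]
  · rw [coface, Fin.insertNth_apply_succAbove]
    rcases lt_or_ge i.castSucc j with h | h
    · rw [Fin.succAbove_of_castSucc_lt _ _ h]
      have : i.1 < j.1 := h
      simp [this]
    · rw [Fin.succAbove_of_le_castSucc _ _ h]
      have h' : j.1 ≤ i.1 := h
      rw [dif_neg (by simp; omega), dif_neg (by simp; omega)]
      simp

theorem codegen_apply {n : ℕ} (j : Fin (n + 1)) (s : Str (n + 1)) (i : Fin n) :
    codegen j s i = s ⟨if i.1 < j.1 then i.1 else i.1 + 1, by split_ifs <;> omega⟩ := by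
  rw [codegen, Fin.removeNth, Fin.succAbove]
  refine congrArg s (Fin.ext ?_)
  simp only [Fin.lt_def, Fin.val_castSucc]
  split_ifs <;> rfl

theorem coconn_apply {n : ℕ} (j : Fin n) (s : Str (n + 1)) (i : Fin n) :
    coconn j s i = if i.1 < j.1 then s ⟨i.1, by omega⟩ else
      if i.1 = j.1 then s ⟨i.1, by omega⟩ || s ⟨i.1 + 1, by omega⟩ else s ⟨i.1 + 1, by omega⟩ := by
  simp only [coconn, Fin.lt_def, Fin.ext_iff]
  rfl

theorem strProd_apply {n n' m m' : ℕ} (f : Str n → Str n') (g : Str m → Str m') (s : Str (n + m))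
    (i : Fin (n' + m')) :
    strProd f g s i = if h : i.1 < n' then f (fun a => s ⟨a.1, by omega⟩) ⟨i.1, h⟩ else
      g (fun b => s ⟨n + b.1, by omega⟩) ⟨i.1 - n', by omega⟩ := by
  refine Fin.addCases (fun i => ?_) (fun i => ?_) i
  · rw [dif_pos (by simp), strProd, Fin.append_left]
    rfl
  · rw [dif_neg (by simp), strProd, Fin.append_right]
    congr 1
    exact Fin.ext (by simp)

theorem coconn_coface_succ {n : ℕ} (i : Fin n) (ε : Bool) (s : Str n) :
    coconn i (coface i.succ ε s) = coconn i (coface i.castSucc ε s) := by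
  funext a
  simp only [coconn_apply, coface_apply, Fin.val_succ, Fin.val_castSucc]
  split_ifs <;> first | rfl | (exfalso; omega) | (simp [Bool.or_comm])

theorem coconn_coface {n : ℕ} (i : Fin (n + 1)) (j : Fin (n + 2)) (h1 : j ≠ i.castSucc)
    (h2 : j ≠ i.succ) : ∃ (i' : Fin n) (j' : Fin (n + 1)), ∀ (ε : Bool) (s : Str (n + 1)),
      coconn i (coface j ε s) = coface j' ε (coconn i' s) := by
  have h1' : j.1 ≠ i.1 := fun h => h1 (Fin.ext h)
  have h2' : j.1 ≠ i.1 + 1 := fun h => h2 (Fin.ext h)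
  rcases lt_or_gt_of_ne h1' with h | h
  · refine ⟨⟨i.1 - 1, by omega⟩, ⟨j.1, by omega⟩, fun ε s => funext fun a => ?_⟩
    simp only [coconn_apply, coface_apply]
    split_ifs <;> first | rfl | (exfalso; omega) | (congr 2; omega) | (congr 3; omega)
  · refine ⟨⟨i.1, by omega⟩, ⟨j.1 - 1, by omega⟩, fun ε s => funext fun a => ?_⟩
    simp only [coconn_apply, coface_apply]
    split_ifs <;> first | rfl | (exfalso; omega) | (congr 2; omega) | (congr 3; omega)

theorem prod_coface_left {n m : ℕ} (j : Fin (n + 1)) (ε : Bool) (s : Str (n + m)) :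
    strProd (coface j ε) (fun t : Str m => t) s =
      fun i => coface (⟨j.1, by omega⟩ : Fin (n + m + 1)) ε s
        (Fin.cast (Nat.add_right_comm n 1 m) i) := by
  funext i
  simp only [strProd_apply, coface_apply, Fin.val_cast]
  split_ifs <;> first | rfl | (exfalso; omega) | (congr 2; omega)

theorem prod_coface_right {n m : ℕ} (j : Fin (m + 1)) (ε : Bool) (s : Str (n + m)) :
    strProd (fun t : Str n => t) (coface j ε) s = coface (⟨n + j.1, by omega⟩ : Fin (n + m + 1)) ε s := by
  funext i
  simp only [strProd_apply, coface_apply]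
  split_ifs <;> first | rfl | (exfalso; omega) | (congr 2; omega)

theorem prod_codegen_left {n m : ℕ} (j : Fin (n + 1)) (s : Str (n + 1 + m)) :
    strProd (codegen j) (fun t : Str m => t) s =
      codegen (⟨j.1, by omega⟩ : Fin (n + m + 1))
        (fun i => s (Fin.cast (Nat.add_right_comm n m 1) i)) := by
  funext i
  simp only [strProd_apply, codegen_apply, Fin.cast]
  split_ifs <;> first | rfl | (exfalso; omega) | (congr 2; omega)

theorem prod_codegen_right {n m : ℕ} (j : Fin (m + 1)) (s : Str (n + (m + 1))) :
    strProd (fun t : Str n => t) (codegen j) s = codegen (⟨n + j.1, by omega⟩ : Fin (n + m + 1)) s := by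
  funext i
  simp only [strProd_apply, codegen_apply]
  split_ifs <;> first | rfl | (exfalso; omega) | (refine congrArg s (Fin.ext ?_); dsimp only; split_ifs <;> omega)

theorem prod_coconn_left {n m : ℕ} (j : Fin n) (s : Str (n + 1 + m)) :
    strProd (coconn j) (fun t : Str m => t) s =
      coconn (⟨j.1, by omega⟩ : Fin (n + m))
        (fun i => s (Fin.cast (Nat.add_right_comm n m 1) i)) := by
  funext i
  simp only [strProd_apply, coconn_apply, Fin.cast]
  split_ifs <;> first | rfl | (exfalso; omega) | (congr 2; omega)

theorem prod_coconn_right {n m : ℕ} (j : Fin m) (s : Str (n + (m + 1))) :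
    strProd (fun t : Str n => t) (coconn j) s = coconn (⟨n + j.1, by omega⟩ : Fin (n + m)) s := by
  funext i
  simp only [strProd_apply, coconn_apply]
  split_ifs <;> first | rfl | (exfalso; omega) | (congr 2; omega) | (congr 3 <;> omega)

/-! ## Differential graded algebras -/

/-- Differential graded algebras over `k`, concentrated in degrees `≥ 0`, with a differential of
degree `-1`. -/
structure DGAlgebra (k : Type v) [CommRing k] where
  /-- the underlying set of the direct sum of all homogeneous components -/
  carrier : Type w
  [ring : Ring carrier]
  [algebra : Algebra k carrier]
  /-- the homogeneous components -/
  gr : ℕ → Submodule k carrier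
  [graded : GradedAlgebra gr]
  /-- the differential -/
  d : carrier →ₗ[k] carrier
  d_zero : ∀ a ∈ gr 0, d a = 0
  d_succ : ∀ n, ∀ a ∈ gr (n + 1), d a ∈ gr n
  d_d : ∀ a, d (d a) = 0
  d_mul : ∀ n, ∀ a ∈ gr n, ∀ b, d (a * b) = d a * b + (-1) ^ n * (a * d b)

attribute [instance] DGAlgebra.ring DGAlgebra.algebra DGAlgebra.graded

/-- The isomorphisms of differential graded algebras: the isomorphisms of `k`-algebras which
preserve degrees and commute with the differentials. -/
structure DGAlgebra.Iso {k : Type v} [CommRing k] (A : DGAlgebra.{v, u} k)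
    (B : DGAlgebra.{v, w} k) where
  /-- the underlying isomorphism of algebras -/
  equiv : A.carrier ≃ₐ[k] B.carrier
  mem_gr_iff : ∀ n a, equiv a ∈ B.gr n ↔ a ∈ A.gr n
  map_d : ∀ a, equiv (A.d a) = B.d (equiv a)

/-! ## Monoids in cubical sets with connections and their normalized chains -/

/-- The monoids in the monoidal category of cubical sets with connections.  The multiplication
`K ⊗ K ⟶ K` is given by the natural maps `K_n × K_m → K_{n+m}`. -/
structure CubicalMonoid : Type (u + 1) where
  /-- the underlying cubical set with connections -/
  K : CubicalSet.{u}
  /-- the multiplication -/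
  mul : ∀ {n m : ℕ}, K.cells n → K.cells m → K.cells (n + m)
  /-- the unit -/
  one : K.cells 0
  mul_natural : ∀ {n n' m m' : ℕ} (f : (⟨n⟩ : Cube) ⟶ ⟨n'⟩) (g : (⟨m⟩ : Cube) ⟶ ⟨m'⟩)
    (a : K.cells n') (b : K.cells m'),
    mul (K.map f.op a) (K.map g.op b) = K.map (Cube.prod f g).op (mul a b)
  mul_assoc : ∀ {n m l : ℕ} (a : K.cells n) (b : K.cells m) (c : K.cells l),
    (⟨n + m + l, mul (mul a b) c⟩ : Σ n, K.cells n) = ⟨n + (m + l), mul a (mul b c)⟩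
  one_mul : ∀ {n : ℕ} (a : K.cells n), (⟨0 + n, mul one a⟩ : Σ n, K.cells n) = ⟨n, a⟩
  mul_one : ∀ {n : ℕ} (a : K.cells n), (⟨n + 0, mul a one⟩ : Σ n, K.cells n) = ⟨n, a⟩

/-- The monoid of endomorphisms of the vertex `x` in `ℭ_{□_c}(S)`.  Composition is written in the
order in which necklaces are concatenated. -/
noncomputable def endMonoid (S : SSet.{u}) (x : Vertices S) : CubicalMonoid.{u} where
  K := mapSpace S x x
  mul := comp
  one := idCell x
  mul_natural := comp_natural
  mul_assoc := comp_assoc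
  one_mul := one_comp
  mul_one := comp_one

/-- The face `∂^ε_j` of a cell, where `0 ≤ j < n + 1`. -/
def CubicalSet.face {K : CubicalSet.{u}} {n : ℕ} (j : Fin (n + 1)) (ε : Bool)
    (a : K.cells (n + 1)) : K.cells n :=
  K.map (Cube.ofMap (coface j ε) (IsCubeMap.coface j ε)).op a

/-- The degenerate cell given by a co-degeneracy. -/
def CubicalSet.degen {K : CubicalSet.{u}} {n : ℕ} (j : Fin (n + 1)) (a : K.cells n) :
    K.cells (n + 1) :=
  K.map (Cube.ofMap (codegen j) (IsCubeMap.codegen j)).op a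

/-- The degenerate cell given by a co-connection. -/
def CubicalSet.conn {K : CubicalSet.{u}} {n : ℕ} (j : Fin n) (a : K.cells n) :
    K.cells (n + 1) :=
  K.map (Cube.ofMap (coconn j) (IsCubeMap.coconn j)).op a

namespace CubicalMonoid

variable (k : Type v) [CommRing k] (M : CubicalMonoid.{u})

/-- The cells of all dimensions. -/
structure Cell : Type u where
  /-- the dimension -/
  dim : ℕ
  /-- the cell -/
  val : M.K.cells dim

variable {M} in
/-- A cell of dimension `n`. -/
def cell {n : ℕ} (a : M.K.cells n) : M.Cell := ⟨n, a⟩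

variable {M} in
theorem cell_congr {a b : Σ n, M.K.cells n} (h : a = b) : cell a.2 = cell b.2 := by rw [h]

instance : Monoid M.Cell where
  mul a b := cell (M.mul a.val b.val)
  one := cell M.one
  mul_assoc a b c := cell_congr (M.mul_assoc a.val b.val c.val)
  one_mul a := cell_congr (M.one_mul a.val)
  mul_one a := cell_congr (M.mul_one a.val)

variable {M} in
theorem cell_mul {n m : ℕ} (a : M.K.cells n) (b : M.K.cells m) :
    cell a * cell b = cell (M.mul a b) := rfl

variable {M} in
theorem cell_eq {n m : ℕ} (h : m = n) {a : M.K.cells n} {b : M.K.cells m}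
    (hab : a = M.K.map (Cube.cast h).op b) : cell a = cell b :=
  cell_congr (sigma_cells_eq h hab)

/-- The face `∂^ε_j` of a cell of dimension `n`, where `0 ≤ j < n`. -/
def cellFace (ε : Bool) : ∀ a : M.Cell, Fin a.dim → M.Cell
  | ⟨_ + 1, a⟩, j => cell (CubicalSet.face j ε a)

/-- The cells which are images of degeneracies or connections. -/
def degenerate : Set M.Cell :=
  {a | (∃ (n : ℕ) (j : Fin (n + 1)) (b : M.K.cells n), a = cell (CubicalSet.degen j b)) ∨
    ∃ (n : ℕ) (j : Fin n) (b : M.K.cells n), a = cell (CubicalSet.conn j b)}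

theorem map_id {n : ℕ} (a : M.K.cells n) : M.K.map (Cube.ofMap (fun s => s)
    (IsCubeMap.refl n)).op a = a :=
  congrArg (fun f => f.hom a) (M.K.map_id _)

theorem map_map {n m l : ℕ} (f : (⟨n⟩ : Cube) ⟶ ⟨m⟩) (g : (⟨m⟩ : Cube) ⟶ ⟨l⟩)
    (a : M.K.cells l) : M.K.map f.op (M.K.map g.op a) = M.K.map (f ≫ g).op a := by
  rw [op_comp, Functor.map_comp]; rfl

variable {M} in
theorem mul_map_left {n n' m : ℕ} (f : (⟨n⟩ : Cube) ⟶ ⟨n'⟩) (a : M.K.cells n')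
    (b : M.K.cells m) : M.mul (M.K.map f.op a) b =
      M.K.map (Cube.prod f (Cube.ofMap (fun s => s) (IsCubeMap.refl m))).op (M.mul a b) := by
  rw [← mul_natural, map_id]

variable {M} in
theorem mul_map_right {n m m' : ℕ} (f : (⟨m⟩ : Cube) ⟶ ⟨m'⟩) (a : M.K.cells n)
    (b : M.K.cells m') : M.mul a (M.K.map f.op b) =
      M.K.map (Cube.prod (Cube.ofMap (fun s => s) (IsCubeMap.refl n)) f).op (M.mul a b) := by
  rw [← mul_natural, map_id]

theorem cellFace_of_eq {n m : ℕ} (h : n = m + 1) (ε : Bool) (a : M.K.cells n) (j : Fin n) :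
    M.cellFace ε (cell a) j = cell (M.K.map (Cube.ofMap (coface (Fin.cast h j) ε)
      (IsCubeMap.coface _ ε) ≫ Cube.cast h).op a) := by
  subst h
  rfl

theorem cellFace_mul_left (ε : Bool) (a b : M.Cell) (j : Fin a.dim) :
    M.cellFace ε (a * b) (Fin.castAdd b.dim j) = M.cellFace ε a j * b := by
  obtain ⟨n, a⟩ := a
  obtain ⟨m, b⟩ := b
  cases n with
  | zero => exact j.elim0
  | succ n =>
    refine (cellFace_of_eq M (Nat.add_right_comm n 1 m) ε (M.mul a b) _).trans ?_
    refine congrArg cell (Eq.symm ((mul_map_left _ a b).trans ?_))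
    exact congrArg (fun f => M.K.map (Quiver.Hom.op f) (M.mul a b))
      (Cube.hom_ext fun s => prod_coface_left j ε s)

theorem cellFace_mul_right (ε : Bool) (a b : M.Cell) (j : Fin b.dim) :
    M.cellFace ε (a * b) (Fin.natAdd a.dim j) = a * M.cellFace ε b j := by
  obtain ⟨n, a⟩ := a
  obtain ⟨m, b⟩ := b
  cases m with
  | zero => exact j.elim0
  | succ m =>
    refine congrArg cell (Eq.symm ((mul_map_right _ a b).trans ?_))
    exact congrArg (fun f => M.K.map (Quiver.Hom.op f) (M.mul a b))
      (Cube.hom_ext fun s => prod_coface_right j ε s)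

theorem mul_mem_degenerate_left {a : M.Cell} (ha : a ∈ M.degenerate) (b : M.Cell) :
    a * b ∈ M.degenerate := by
  obtain ⟨m, b⟩ := b
  rcases ha with ⟨n, j, a, rfl⟩ | ⟨n, j, a, rfl⟩
  · left
    refine ⟨n + m, ⟨j.1, by omega⟩, M.mul a b, ?_⟩
    refine cell_eq (Nat.add_right_comm n m 1) ?_
    refine (mul_map_left _ a b).trans ((map_map M _ _ _).trans ?_).symm
    exact congrArg (fun f => M.K.map (Quiver.Hom.op f) (M.mul a b))
      (Cube.hom_ext fun s => (prod_codegen_left j s).symm)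
  · right
    refine ⟨n + m, ⟨j.1, by omega⟩, M.mul a b, ?_⟩
    refine cell_eq (Nat.add_right_comm n m 1) ?_
    refine (mul_map_left _ a b).trans ((map_map M _ _ _).trans ?_).symm
    exact congrArg (fun f => M.K.map (Quiver.Hom.op f) (M.mul a b))
      (Cube.hom_ext fun s => (prod_coconn_left j s).symm)

theorem mul_mem_degenerate_right (a : M.Cell) {b : M.Cell} (hb : b ∈ M.degenerate) :
    a * b ∈ M.degenerate := by
  obtain ⟨n, a⟩ := a
  rcases hb with ⟨m, j, b, rfl⟩ | ⟨m, j, b, rfl⟩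
  · left
    refine ⟨n + m, ⟨n + j.1, by omega⟩, M.mul a b, congrArg cell ?_⟩
    exact (mul_map_right _ a b).trans (congrArg (fun f => M.K.map (Quiver.Hom.op f) (M.mul a b))
      (Cube.hom_ext fun s => prod_codegen_right j s))
  · right
    refine ⟨n + m, ⟨n + j.1, by omega⟩, M.mul a b, congrArg cell ?_⟩
    exact (mul_map_right _ a b).trans (congrArg (fun f => M.K.map (Quiver.Hom.op f) (M.mul a b))
      (Cube.hom_ext fun s => prod_coconn_right j s))

end CubicalMonoid

namespace CubicalMonoid

variable (k : Type v) [CommRing k] (M : CubicalMonoid.{u})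

/-- The `k`-algebra of all cubical chains: the free `k`-module on the cells of all dimensions. -/
abbrev Chains : Type (max u v) := MonoidAlgebra k M.Cell

/-- A cell as a chain. -/
noncomputable abbrev single (a : M.Cell) : Chains k M := MonoidAlgebra.single a 1

/-- The `k`-linear map on chains with given values on cells. -/
noncomputable def chainsLift {V : Type*} [AddCommGroup V] [Module k V] (f : M.Cell → V) :
    Chains k M →ₗ[k] V :=
  Finsupp.linearCombination k f ∘ₗ (MonoidAlgebra.coeffLinearEquiv k).toLinearMap

@[simp] theorem chainsLift_single {V : Type*} [AddCommGroup V] [Module k V] (f : M.Cell → V)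
    (a : M.Cell) : chainsLift k M f (single k M a) = f a := by
  simp [chainsLift, MonoidAlgebra.coeffLinearEquiv]

theorem chains_hom_ext {V : Type*} [AddCommGroup V] [Module k V] {f g : Chains k M →ₗ[k] V}
    (h : ∀ a, f (single k M a) = g (single k M a)) : f = g := by
  refine LinearMap.ext fun x => ?_
  induction x using MonoidAlgebra.induction_linear with
  | zero => simp
  | add f g hf hg => simp [hf, hg]
  | single a r =>
    have : (MonoidAlgebra.single a r : Chains k M) = r • single k M a := by simp
    rw [this, map_smul, map_smul, h]

/-- The boundary of a cell, `∂a = ∑ⱼ (-1)ʲ (∂¹ⱼ a - ∂⁰ⱼ a)` with `1 ≤ j ≤ n`. -/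
noncomputable def cellBoundary (a : M.Cell) : Chains k M :=
  ∑ j : Fin a.dim, (-1 : k) ^ (j.1 + 1) •
    (single k M (M.cellFace true a j) - single k M (M.cellFace false a j))

/-- The boundary map on cubical chains. -/
noncomputable def boundary : Chains k M →ₗ[k] Chains k M := chainsLift k M (cellBoundary k M)

/-- The submodule `D` spanned by the images of degeneracies and connections, as an ideal. -/
noncomputable def degenerateIdeal : Ideal (Chains k M) where
  __ := Submodule.span k (single k M '' M.degenerate)
  smul_mem' x y hy := by
    change x • y ∈ Submodule.span k (single k M '' M.degenerate)
    induction x using MonoidAlgebra.induction_linear with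
    | zero => simp
    | add f g hf hg => rw [add_smul]; exact add_mem hf hg
    | single a r =>
      refine Submodule.span_induction ?_ ?_ ?_ ?_ hy
      · rintro _ ⟨b, hb, rfl⟩
        have : (MonoidAlgebra.single a r • single k M b : Chains k M) =
            r • single k M (a * b) := by simp
        rw [this]
        exact Submodule.smul_mem _ _ (Submodule.subset_span
          ⟨_, mul_mem_degenerate_right M a hb, rfl⟩)
      · rw [smul_zero]; exact zero_mem _
      · intro y z _ _ hy hz
        rw [smul_add]; exact add_mem hy hz
      · intro c y _ hy
        rw [smul_comm]; exact Submodule.smul_mem _ _ hy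

theorem mem_degenerateIdeal {x : Chains k M} :
    x ∈ degenerateIdeal k M ↔ x ∈ Submodule.span k (single k M '' M.degenerate) := Iff.rfl

instance : (degenerateIdeal k M).IsTwoSided where
  mul_mem_of_left {x} y hx := by
    rw [mem_degenerateIdeal] at *
    induction y using MonoidAlgebra.induction_linear with
    | zero => simp
    | add f g hf hg => rw [mul_add]; exact add_mem hf hg
    | single a r =>
      refine Submodule.span_induction ?_ ?_ ?_ ?_ hx
      · rintro _ ⟨b, hb, rfl⟩
        have : (single k M b * MonoidAlgebra.single a r : Chains k M) =
            r • single k M (b * a) := by simp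
        rw [this]
        exact Submodule.smul_mem _ _ (Submodule.subset_span
          ⟨_, mul_mem_degenerate_left M hb a, rfl⟩)
      · rw [zero_mul]; exact zero_mem _
      · intro y z _ _ hy hz
        rw [add_mul]; exact add_mem hy hz
      · intro c y _ hy
        rw [smul_mul_assoc]; exact Submodule.smul_mem _ _ hy

/-- The algebra `Q_{□_c}` of normalized chains. -/
def NormalizedChains : Type (max u v) := Chains k M ⧸ degenerateIdeal k M

noncomputable instance : Ring (NormalizedChains k M) :=
  inferInstanceAs (Ring (Chains k M ⧸ degenerateIdeal k M))

noncomputable instance : Algebra k (NormalizedChains k M) :=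
  inferInstanceAs (Algebra k (Chains k M ⧸ degenerateIdeal k M))

/-- The class of a chain. -/
noncomputable def toQuot : Chains k M →ₐ[k] NormalizedChains k M :=
  Ideal.Quotient.mkₐ k (degenerateIdeal k M)

theorem toQuot_surjective : Function.Surjective (toQuot k M) :=
  Ideal.Quotient.mk_surjective

theorem toQuot_eq_zero {x : Chains k M} (hx : x ∈ degenerateIdeal k M) : toQuot k M x = 0 :=
  Ideal.Quotient.eq_zero_iff_mem.2 hx

/-- The class of a cell. -/
noncomputable def cls (a : M.Cell) : NormalizedChains k M := toQuot k M (single k M a)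

theorem cls_eq_zero {a : M.Cell} (ha : a ∈ M.degenerate) : cls k M a = 0 :=
  toQuot_eq_zero k M (Submodule.subset_span ⟨a, ha, rfl⟩)

theorem cls_one : cls k M 1 = 1 := map_one (toQuot k M)

theorem cls_mul (a b : M.Cell) : cls k M (a * b) = cls k M a * cls k M b := by
  rw [cls, cls, cls, ← map_mul, MonoidAlgebra.single_mul_single, _root_.one_mul]

@[simp] theorem toQuot_single (a : M.Cell) : toQuot k M (single k M a) = cls k M a := rfl

/-! ### The boundary respects degenerate cells -/

theorem toQuot_cellBoundary (a : M.Cell) : toQuot k M (cellBoundary k M a) =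
    ∑ j : Fin a.dim, (-1 : k) ^ (j.1 + 1) •
      (cls k M (M.cellFace true a j) - cls k M (M.cellFace false a j)) := by
  rw [cellBoundary, map_sum]
  simp

variable {M} in
theorem map_eq_map {n m m' l : ℕ} {f : (⟨n⟩ : Cube) ⟶ ⟨m⟩} {g : (⟨m⟩ : Cube) ⟶ ⟨l⟩}
    {f' : (⟨n⟩ : Cube) ⟶ ⟨m'⟩} {g' : (⟨m'⟩ : Cube) ⟶ ⟨l⟩}
    (h : ∀ s, g.1 (f.1 s) = g'.1 (f'.1 s)) (a : M.K.cells l) :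
    M.K.map f.op (M.K.map g.op a) = M.K.map f'.op (M.K.map g'.op a) := by
  rw [map_map, map_map]
  exact congrArg (fun f => M.K.map (Quiver.Hom.op f) a) (Cube.hom_ext h)

variable {M} in
theorem face_degen_self {n : ℕ} (i : Fin (n + 1)) (ε : Bool) (b : M.K.cells n) :
    CubicalSet.face i ε (CubicalSet.degen i b) = b := by
  refine Eq.trans ?_ (map_id M b)
  rw [CubicalSet.face, CubicalSet.degen, map_map]
  exact congrArg (fun f => M.K.map (Quiver.Hom.op f) b)
    (Cube.hom_ext fun s => codegen_coface_self i ε s)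

theorem toQuot_cellBoundary_degen {n : ℕ} (i : Fin (n + 1)) (b : M.K.cells n) :
    toQuot k M (cellBoundary k M (cell (CubicalSet.degen i b))) = 0 := by
  rw [toQuot_cellBoundary]
  refine Finset.sum_eq_zero fun j _ => ?_
  change Fin (n + 1) at j
  change _ • (cls k M (cell (CubicalSet.face j true (CubicalSet.degen i b))) -
    cls k M (cell (CubicalSet.face j false (CubicalSet.degen i b)))) = 0
  by_cases hj : j = i
  · subst hj
    rw [face_degen_self, face_degen_self, sub_self, smul_zero]
  · obtain ⟨l, rfl⟩ := Fin.exists_succAbove_eq hj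
    cases n with
    | zero => exact l.elim0
    | succ n =>
      have h : ∀ ε, cls k M (cell (CubicalSet.face (i.succAbove l) ε (CubicalSet.degen i b))) =
          0 := fun ε => cls_eq_zero k M (Or.inl ⟨n, l.predAbove i, CubicalSet.face l ε b,
            congrArg cell (map_eq_map (fun s => codegen_coface i l ε s) b)⟩)
      rw [h, h, sub_self, smul_zero]

theorem toQuot_cellBoundary_conn {n : ℕ} (i : Fin n) (b : M.K.cells n) :
    toQuot k M (cellBoundary k M (cell (CubicalSet.conn i b))) = 0 := by
  rw [toQuot_cellBoundary]
  cases n with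
  | zero => exact i.elim0
  | succ n =>
    change ∑ j : Fin (n + 2), (-1 : k) ^ (j.1 + 1) •
      (cls k M (cell (CubicalSet.face j true (CubicalSet.conn i b))) -
        cls k M (cell (CubicalSet.face j false (CubicalSet.conn i b)))) = 0
    have h1 : ∀ ε, CubicalSet.face i.succ ε (CubicalSet.conn i b) =
        CubicalSet.face i.castSucc ε (CubicalSet.conn i b) := fun ε =>
      map_eq_map (fun s => coconn_coface_succ i ε s) b
    rw [Fintype.sum_eq_add i.castSucc i.succ (Fin.castSucc_lt_succ).ne]
    · rw [h1, h1, Fin.val_succ, Fin.val_castSucc, pow_succ _ (i.1 + 1), mul_neg_one, neg_smul,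
        add_neg_cancel]
    · rintro j ⟨hj1, hj2⟩
      obtain ⟨i', j', h⟩ := coconn_coface i j hj1 hj2
      have h : ∀ ε, cls k M (cell (CubicalSet.face j ε (CubicalSet.conn i b))) =
          0 := fun ε => cls_eq_zero k M (Or.inr ⟨n, i', CubicalSet.face j' ε b,
            congrArg cell (map_eq_map (fun s => h ε s) b)⟩)
      rw [h, h, sub_self, smul_zero]

theorem boundary_mem {x : Chains k M} (hx : x ∈ degenerateIdeal k M) :
    toQuot k M (boundary k M x) = 0 := by
  rw [mem_degenerateIdeal] at hx
  refine Submodule.span_induction ?_ ?_ ?_ ?_ hx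
  · rintro _ ⟨a, ⟨n, j, b, rfl⟩ | ⟨n, j, b, rfl⟩, rfl⟩
    · rw [boundary, chainsLift_single, toQuot_cellBoundary_degen]
    · rw [boundary, chainsLift_single, toQuot_cellBoundary_conn]
  · simp
  · intro y z _ _ hy hz
    simp [hy, hz]
  · intro c y _ hy
    simp [hy]

/-- The differential of `Q_{□_c}`, induced by the boundary map. -/
noncomputable def differential : NormalizedChains k M →ₗ[k] NormalizedChains k M :=
  Submodule.liftQ ((degenerateIdeal k M).restrictScalars k)
    ((toQuot k M).toLinearMap ∘ₗ boundary k M) (fun _ hx => boundary_mem k M hx) ∘ₗ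
    (Submodule.Quotient.restrictScalarsEquiv k (degenerateIdeal k M)).symm.toLinearMap

theorem differential_toQuot (x : Chains k M) :
    differential k M (toQuot k M x) = toQuot k M (boundary k M x) := rfl

theorem quot_hom_ext {V : Type*} [AddCommGroup V] [Module k V]
    {f g : NormalizedChains k M →ₗ[k] V} (h : ∀ a, f (cls k M a) = g (cls k M a)) : f = g := by
  have : f ∘ₗ (toQuot k M).toLinearMap = g ∘ₗ (toQuot k M).toLinearMap :=
    chains_hom_ext k M h
  refine LinearMap.ext fun x => ?_
  obtain ⟨x, rfl⟩ := toQuot_surjective k M x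
  exact DFunLike.congr_fun this x

theorem differential_cls (a : M.Cell) : differential k M (cls k M a) =
    ∑ j : Fin a.dim, (-1 : k) ^ (j.1 + 1) •
      (cls k M (M.cellFace true a j) - cls k M (M.cellFace false a j)) := by
  rw [← toQuot_cellBoundary, cls, differential_toQuot, boundary, chainsLift_single]

theorem differential_cls_mul (a b : M.Cell) :
    differential k M (cls k M a * cls k M b) = differential k M (cls k M a) * cls k M b +
      (-1) ^ a.dim * (cls k M a * differential k M (cls k M b)) := by
  rw [← cls_mul, differential_cls, differential_cls, differential_cls, Finset.sum_mul,
    Finset.mul_sum, Finset.mul_sum]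
  refine (Fin.sum_univ_add (a := a.dim) (b := b.dim) _).trans (congrArg₂ (· + ·) ?_ ?_)
  · refine Finset.sum_congr rfl fun j _ => ?_
    rw [cellFace_mul_left, cellFace_mul_left, cls_mul, cls_mul, smul_mul_assoc, sub_mul]
    rfl
  · refine Finset.sum_congr rfl fun j _ => ?_
    have h : ((-1) ^ a.dim : NormalizedChains k M) = algebraMap k _ ((-1) ^ a.dim) := by simp
    rw [cellFace_mul_right, cellFace_mul_right, cls_mul, cls_mul, mul_smul_comm, mul_sub,
      mul_smul_comm, h, ← Algebra.smul_def, smul_smul, Fin.val_natAdd, add_assoc, pow_add _ a.dim,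
      mul_comm]

theorem neg_one_pow_swap {n : ℕ} (j : Fin (n + 2)) (i : Fin (n + 1)) :
    (-1 : k) ^ ((j.succAbove i).1 + (i.predAbove j).1) = - (-1 : k) ^ (j.1 + i.1) := by
  rcases lt_or_ge i.castSucc j with h | h
  · rw [Fin.succAbove_of_castSucc_lt _ _ h, Fin.predAbove_of_castSucc_lt _ _ h]
    obtain ⟨j', rfl⟩ : ∃ j', j = Fin.succ j' := ⟨j.pred (Fin.ne_zero_of_lt h), by simp⟩
    simp only [Fin.val_castSucc, Fin.pred_succ, Fin.val_succ]
    ring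
  · rw [Fin.succAbove_of_le_castSucc _ _ h, Fin.predAbove_of_le_castSucc _ _ h]
    simp only [Fin.val_succ, Fin.coe_castPred]
    ring

theorem differential_differential_cls (a : M.Cell) :
    differential k M (differential k M (cls k M a)) = 0 := by
  obtain ⟨_ | _ | n, a⟩ := a
  · rw [differential_cls]
    exact (congrArg _ Finset.sum_empty).trans (map_zero _)
  · rw [differential_cls, map_sum]
    refine Finset.sum_eq_zero fun j _ => ?_
    rw [map_smul, map_sub, differential_cls, differential_cls]
    exact (congrArg _ (congrArg₂ (· - ·) Finset.sum_empty Finset.sum_empty)).trans (by simp)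
  · let G : Fin (n + 2) → Fin (n + 1) → Bool → Bool → NormalizedChains k M := fun j i η ε =>
      cls k M (cell (CubicalSet.face i ε (CubicalSet.face j η a)))
    have hG : ∀ j i η ε, G (j.succAbove i) (i.predAbove j) ε η = G j i η ε := fun j i η ε =>
      congrArg (fun c => cls k M (cell c)) (map_eq_map (fun s => (coface_coface j i η ε s).symm) a)
    let t : Fin (n + 2) × Fin (n + 1) → NormalizedChains k M := fun p =>
      (-1 : k) ^ (p.1.1 + p.2.1) • (G p.1 p.2 true true - G p.1 p.2 true false -
        G p.1 p.2 false true + G p.1 p.2 false false)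
    have h1 : differential k M (differential k M (cls k M (cell a))) = ∑ p, t p := by
      rw [differential_cls, map_sum, Fintype.sum_prod_type]
      refine Finset.sum_congr rfl fun (j : Fin (n + 2)) _ => ?_
      rw [map_smul, map_sub, differential_cls, differential_cls]
      refine (congrArg _ (Finset.sum_sub_distrib _ _).symm).trans ?_
      refine (Finset.smul_sum).trans ?_
      refine Finset.sum_congr rfl fun (i : Fin (n + 1)) _ => ?_
      change (-1 : k) ^ (j.1 + 1) • ((-1 : k) ^ (i.1 + 1) • (G j i true true - G j i true false) -
        (-1 : k) ^ (i.1 + 1) • (G j i false true - G j i false false)) = t (j, i)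
      simp only [t]
      rw [← smul_sub, smul_smul]
      congr 1
      · ring
      · abel
    refine h1.trans (Finset.sum_involution
      (fun p _ => (p.1.succAbove p.2, p.2.predAbove p.1)) ?_ ?_ ?_ ?_)
    · rintro ⟨j, i⟩ -
      simp only [t, hG, neg_one_pow_swap, neg_smul]
      rw [← sub_eq_add_neg, sub_eq_zero]
      congr 1
      abel
    · rintro ⟨j, i⟩ - - h
      simp only [Prod.mk.injEq] at h
      exact Fin.succAbove_ne j i h.1
    · simp
    · rintro ⟨j, i⟩ -
      simp only [Prod.mk.injEq]
      exact ⟨Fin.succAbove_succAbove_predAbove _ _, Fin.predAbove_predAbove_succAbove _ _⟩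

/-! ### The grading -/

/-- The homogeneous component of degree `n`, spanned by the cells of dimension `n`. -/
noncomputable def gr (n : ℕ) : Submodule k (NormalizedChains k M) :=
  Submodule.span k {x | ∃ a : M.K.cells n, x = cls k M (cell a)}

theorem cls_mem_gr (a : M.Cell) : cls k M a ∈ gr k M a.dim :=
  Submodule.subset_span ⟨a.val, rfl⟩

instance : SetLike.GradedMonoid (gr k M) where
  one_mem := Submodule.subset_span ⟨M.one, (cls_one k M).symm⟩
  mul_mem {i j} x y hx hy := by
    have h := Submodule.mul_mem_mul hx hy
    rw [gr, gr, Submodule.span_mul_span] at h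
    refine Submodule.span_mono ?_ h
    rintro _ ⟨_, ⟨a, rfl⟩, _, ⟨b, rfl⟩, rfl⟩
    exact ⟨M.mul a b, (cls_mul k M _ _).symm⟩

open DirectSum in
/-- The decomposition into homogeneous components. -/
noncomputable def decomp : NormalizedChains k M →ₐ[k] ⨁ n, gr k M n :=
  Ideal.Quotient.liftₐ (degenerateIdeal k M)
    (MonoidAlgebra.lift k _ M.Cell
      { toFun := fun a => DirectSum.of (fun n => gr k M n) a.dim ⟨cls k M a, cls_mem_gr k M a⟩
        map_one' := congrArg (DirectSum.of (fun n => gr k M n) 0) (Subtype.ext (cls_one k M))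
        map_mul' := fun a b => by
          rw [DirectSum.of_mul_of]
          exact congrArg (DirectSum.of (fun n => gr k M n) (a.dim + b.dim))
            (Subtype.ext (cls_mul k M a b)) })
    (fun x hx => by
      refine LinearMap.eqOn_span (f := (MonoidAlgebra.lift k _ M.Cell _).toLinearMap) (g := 0) ?_
        ((mem_degenerateIdeal k M).1 hx)
      rintro _ ⟨a, ha, rfl⟩
      have h : (⟨cls k M a, cls_mem_gr k M a⟩ : gr k M a.dim) = 0 :=
        Subtype.ext (cls_eq_zero k M ha)
      refine (MonoidAlgebra.lift_single _ _ _).trans ((one_smul _ _).trans ?_)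
      exact (congrArg (DirectSum.of (fun n => gr k M n) a.dim) h).trans (map_zero _))

theorem decomp_cls (a : M.Cell) : decomp k M (cls k M a) =
    DirectSum.of (fun n => gr k M n) a.dim ⟨cls k M a, cls_mem_gr k M a⟩ :=
  (MonoidAlgebra.lift_single _ _ _).trans (one_smul _ _)

noncomputable instance : GradedAlgebra (gr k M) :=
  GradedAlgebra.ofAlgHom _ (decomp k M)
    (by
      refine AlgHom.toLinearMap_injective (quot_hom_ext k M fun a => ?_)
      exact (congrArg (DirectSum.coeAlgHom (gr k M)) (decomp_cls k M a)).trans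
        (DirectSum.coeAlgHom_of _ _ _))
    (by
      rintro n ⟨x, hx⟩
      refine Submodule.span_induction (p := fun x hx => decomp k M x =
        DirectSum.of (fun n => gr k M n) n ⟨x, hx⟩) ?_ ?_ ?_ ?_ hx
      · rintro _ ⟨a, rfl⟩
        exact decomp_cls k M _
      · exact (map_zero (decomp k M)).trans (map_zero (DirectSum.of (fun n => gr k M n) n)).symm
      · intro x y hx hy h1 h2
        refine (map_add (decomp k M) x y).trans ((congrArg₂ (· + ·) h1 h2).trans ?_)
        exact (map_add (DirectSum.of (fun n => gr k M n) n) ⟨x, hx⟩ ⟨y, hy⟩).symm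
      · intro c x hx h
        refine (map_smul (decomp k M) c x).trans ((congrArg (c • ·) h).trans ?_)
        exact (DirectSum.of_smul (M := fun n => gr k M n) k n c ⟨x, hx⟩).symm)

theorem cellFace_dim (ε : Bool) (a : M.Cell) (j : Fin a.dim) : (M.cellFace ε a j).dim + 1 = a.dim := by
  obtain ⟨n, a⟩ := a
  cases n with
  | zero => exact j.elim0
  | succ n => rfl

/-- The differential graded algebra `Q_{□_c}` of normalized chains. -/
noncomputable def dga : DGAlgebra.{v, max u v} k where
  carrier := NormalizedChains k M
  gr := gr k M
  d := differential k M
  d_zero a ha := by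
    refine LinearMap.mem_ker.1 (Submodule.span_le.2 ?_ ha)
    rintro _ ⟨a, rfl⟩
    exact LinearMap.mem_ker.2 ((differential_cls k M _).trans Finset.sum_empty)
  d_succ n a ha := by
    have h : gr k M (n + 1) ≤ (gr k M n).comap (differential k M) := Submodule.span_le.2 ?_
    · exact h ha
    rintro _ ⟨a, rfl⟩
    change differential k M (cls k M (cell a)) ∈ gr k M n
    rw [differential_cls]
    refine sum_mem fun j _ => Submodule.smul_mem _ _ (sub_mem ?_ ?_)
    · exact cls_mem_gr k M (cell (CubicalSet.face j true a))
    · exact cls_mem_gr k M (cell (CubicalSet.face j false a))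
  d_d a := by
    have : differential k M ∘ₗ differential k M = 0 :=
      quot_hom_ext k M fun a => differential_differential_cls k M a
    exact DFunLike.congr_fun this a
  d_mul n a ha b := by
    have key : ∀ a : M.Cell, differential k M ∘ₗ LinearMap.mulLeft k (cls k M a) =
        LinearMap.mulLeft k (differential k M (cls k M a)) +
          LinearMap.mulLeft k ((-1) ^ a.dim * cls k M a) ∘ₗ differential k M := fun a =>
      quot_hom_ext k M fun b => by
        simp [differential_cls_mul]
    have h : Set.EqOn (differential k M ∘ₗ LinearMap.mulRight k b)
        (LinearMap.mulRight k b ∘ₗ differential k M +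
          LinearMap.mulLeft k ((-1) ^ n) ∘ₗ LinearMap.mulRight k (differential k M b) :
          NormalizedChains k M →ₗ[k] NormalizedChains k M)
        {x | ∃ a : M.K.cells n, x = cls k M (cell a)} := by
      rintro _ ⟨a, rfl⟩
      refine (DFunLike.congr_fun (key (cell a)) b).trans ?_
      simp [cell]
    exact LinearMap.eqOn_span h ha

end CubicalMonoid

/-- The differential graded algebra `Λ(S)(x, x) = Q_{□_c}(ℭ_{□_c}(S)(x, x))`. -/
noncomputable def Lambda (k : Type v) [CommRing k] (S : SSet.{u}) (x : Vertices S) :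
    DGAlgebra.{v, max u v} k :=
  (endMonoid S x).dga k

/-! ## Connected differential graded coalgebras and normalized chains on a simplicial set -/

/-- Connected differential graded coassociative counital coalgebras over `k`, concentrated in
degrees `≥ 0`, with a differential of degree `-1`. -/
structure ConnectedDGCoalgebra (k : Type v) [CommRing k] where
  /-- the homogeneous component of degree `n` -/
  X : ℕ → Type w
  [addCommGroup : ∀ n, AddCommGroup (X n)]
  [module : ∀ n, Module k (X n)]
  /-- the differential -/
  bd : ∀ n, X (n + 1) →ₗ[k] X n
  /-- the component `C_n ⟶ C_p ⊗ C_q` of the coproduct -/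
  comul : ∀ p q n, p + q = n → (X n →ₗ[k] X p ⊗[k] X q)
  /-- the counit, which vanishes in positive degrees -/
  counit : X 0 →ₗ[k] k
  bd_bd : ∀ n x, bd n (bd (n + 1) x) = 0
  coassoc : ∀ p q r m m' n (h₁ : p + q = m) (h₂ : m + r = n) (h₃ : q + r = m')
    (h₄ : p + m' = n) (x : X n),
    TensorProduct.assoc k (X p) (X q) (X r)
      ((comul p q m h₁).rTensor (X r) (comul m r n h₂ x)) =
      (comul q r m' h₃).lTensor (X p) (comul p m' n h₄ x)
  counit_comul : ∀ n (x : X n),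
    TensorProduct.lid k (X n) (counit.rTensor (X n) (comul 0 n n (Nat.zero_add n) x)) = x
  comul_counit : ∀ n (x : X n),
    TensorProduct.rid k (X n) (counit.lTensor (X n) (comul n 0 n (Nat.add_zero n) x)) = x
  comul_bd : ∀ p q n (h : p + q = n) (h₁ : p + 1 + q = n + 1) (h₂ : p + (q + 1) = n + 1)
    (x : X (n + 1)),
    comul p q n h (bd n x) = (bd p).rTensor (X q) (comul (p + 1) q (n + 1) h₁ x) +
      (-1 : k) ^ p • (bd q).lTensor (X p) (comul p (q + 1) (n + 1) h₂ x)
  counit_bd : ∀ x, counit (bd 0 x) = 0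
  connected : Function.Bijective counit

attribute [instance] ConnectedDGCoalgebra.addCommGroup ConnectedDGCoalgebra.module

section SimplicialChains

variable (k : Type v) [CommRing k] (S : SSet.{u})

/-- The set `S_n` of `n`-simplices. -/
abbrev Simp (n : ℕ) : Type u := S.obj (op (SimplexCategory.mk n))

/-- The module `Q_Δ(S)_n`: the free `k`-module on the `n`-simplices modulo the submodule spanned
by the degenerate simplices. -/
def SChains (n : ℕ) : Type (max u v) :=
  (Simp S n →₀ k) ⧸ Submodule.span k ((fun σ => Finsupp.single σ (1 : k)) '' S.degenerate n)

noncomputable instance (n : ℕ) : AddCommGroup (SChains k S n) :=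
  inferInstanceAs (AddCommGroup (_ ⧸ Submodule.span k _))

noncomputable instance (n : ℕ) : Module k (SChains k S n) :=
  inferInstanceAs (Module k (_ ⧸ Submodule.span k _))

variable {S} in
/-- The class of a simplex. -/
noncomputable def scls {n : ℕ} (σ : Simp S n) : SChains k S n :=
  Submodule.mkQ (Submodule.span k ((fun σ => Finsupp.single σ (1 : k)) '' S.degenerate n))
    (Finsupp.single σ 1)

variable {S} in
theorem scls_eq_zero {n : ℕ} {σ : Simp S n} (hσ : σ ∈ S.degenerate n) : scls k σ = 0 :=
  (Submodule.Quotient.mk_eq_zero _).2 (Submodule.subset_span ⟨σ, hσ, rfl⟩)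

/-- The linear map on `Q_Δ(S)_n` with given values on simplices. -/
noncomputable def schainsLift {n : ℕ} {V : Type*} [AddCommGroup V] [Module k V]
    (f : Simp S n → V) (hf : ∀ σ ∈ S.degenerate n, f σ = 0) : SChains k S n →ₗ[k] V :=
  Submodule.liftQ _ (Finsupp.linearCombination k f) (by
    rw [Submodule.span_le]
    rintro _ ⟨σ, hσ, rfl⟩
    simp [hf σ hσ])

@[simp] theorem schainsLift_scls {n : ℕ} {V : Type*} [AddCommGroup V] [Module k V]
    (f : Simp S n → V) (hf : ∀ σ ∈ S.degenerate n, f σ = 0) (σ : Simp S n) :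
    schainsLift k S f hf (scls k σ) = f σ :=
  (Submodule.liftQ_apply _ _ _).trans (by simp)

variable {k S} in
theorem schains_hom_ext {n : ℕ} {V : Type*} [AddCommGroup V] [Module k V]
    {f g : SChains k S n →ₗ[k] V} (h : ∀ σ : Simp S n, f (scls k σ) = g (scls k σ)) : f = g := by
  refine Submodule.linearMap_qext _ (Finsupp.lhom_ext' fun σ => LinearMap.ext_ring ?_)
  exact h σ

/-- The front `p`-face, induced by `[p] ⟶ [n]`, `i ↦ i`. -/
def front {p n : ℕ} (h : p ≤ n) (σ : Simp S n) : Simp S p :=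
  S.map (SimplexCategory.subinterval 0 p (by omega)).op σ

/-- The last `q`-face, induced by `[q] ⟶ [n]`, `i ↦ i + p`, where `p + q = n`. -/
def back {p q n : ℕ} (h : p + q = n) (σ : Simp S n) : Simp S q :=
  S.map (SimplexCategory.subinterval p q h.le).op σ

theorem map_mem_degenerate {n : ℕ} {m : SimplexCategory} (f : SimplexCategory.mk n ⟶ m)
    (hf : ¬ Function.Injective f) (σ : S.obj (op m)) : S.map f.op σ ∈ S.degenerate n := by
  cases n with
  | zero => exact (hf (Function.injective_of_subsingleton (α := Fin 1) f)).elim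
  | succ n =>
    obtain ⟨i, θ, rfl⟩ := SimplexCategory.eq_σ_comp_of_not_injective f hf
    rw [op_comp, Functor.map_comp]
    exact S.σ_mem_degenerate i (S.map θ.op σ)

theorem not_injective_comp_σ {n m : ℕ} (f : SimplexCategory.mk m ⟶ SimplexCategory.mk (n + 1))
    (j : Fin (n + 1)) {a b : Fin (m + 1)} (ha : f a = j.castSucc) (hb : f b = j.succ) :
    ¬ Function.Injective (f ≫ SimplexCategory.σ j) := by
  intro hinj
  have : a = b := hinj (by
    change SimplexCategory.σ j (f a) = SimplexCategory.σ j (f b)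
    rw [ha, hb]
    exact (Fin.predAbove_castSucc_self j).trans (Fin.predAbove_succ_self j).symm)
  subst this
  exact (Fin.castSucc_lt_succ).ne (ha.symm.trans hb)

theorem map_mem_degenerate_of_σ {n m : ℕ} (f : SimplexCategory.mk m ⟶ SimplexCategory.mk (n + 1))
    (j : Fin (n + 1)) {a b : Fin (m + 1)} (ha : f a = j.castSucc) (hb : f b = j.succ)
    (σ : Simp S n) : S.map f.op (S.σ j σ) ∈ S.degenerate m := by
  have := map_mem_degenerate S _ (not_injective_comp_σ f j ha hb) σ
  rw [op_comp, Functor.map_comp] at this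
  exact this

/-- The boundary `∂σ = ∑ᵢ (-1)ⁱ dᵢσ` on normalized chains. -/
noncomputable def sbd (n : ℕ) : SChains k S (n + 1) →ₗ[k] SChains k S n :=
  schainsLift k S (fun σ => ∑ i : Fin (n + 2), (-1 : k) ^ i.1 • scls k (S.δ i σ)) (by
    intro σ hσ
    rw [SSet.degenerate_eq_iUnion_range_σ, Set.mem_iUnion] at hσ
    obtain ⟨j, σ, rfl⟩ := hσ
    rw [Fintype.sum_eq_add j.castSucc j.succ (Fin.castSucc_lt_succ).ne]
    · have h1 : S.δ j.castSucc (S.σ j σ) = σ :=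
        congrArg (fun f => f σ) (S.δ_comp_σ_self (i := j))
      have h2 : S.δ j.succ (S.σ j σ) = σ :=
        congrArg (fun f => f σ) (S.δ_comp_σ_succ (i := j))
      rw [h1, h2, Fin.val_succ, Fin.val_castSucc, pow_succ, mul_neg_one, neg_smul, add_neg_cancel]
    · rintro i ⟨h1, h2⟩
      obtain ⟨a, ha⟩ := Fin.exists_succAbove_eq h1.symm
      obtain ⟨b, hb⟩ := Fin.exists_succAbove_eq h2.symm
      rw [scls_eq_zero, smul_zero]
      exact map_mem_degenerate_of_σ S (SimplexCategory.δ i) j ha hb σ)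

/-- The Alexander–Whitney coproduct, `σ ↦ f^p(σ) ⊗ l^q(σ)`. -/
noncomputable def scomul (p q n : ℕ) (h : p + q = n) :
    SChains k S n →ₗ[k] SChains k S p ⊗[k] SChains k S q :=
  schainsLift k S (fun σ => scls k (front S (p := p) (by omega) σ) ⊗ₜ scls k (back S h σ)) (by
    intro σ hσ
    obtain _ | n := n
    · simp at hσ
    rw [SSet.degenerate_eq_iUnion_range_σ, Set.mem_iUnion] at hσ
    obtain ⟨j, σ, rfl⟩ := hσ
    rcases lt_or_ge j.1 p with hj | hj
    · rw [scls_eq_zero k, TensorProduct.zero_tmul]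
      exact map_mem_degenerate_of_σ S (SimplexCategory.subinterval 0 p _) j
        (a := ⟨j.1, by omega⟩) (b := ⟨j.1 + 1, by omega⟩) (Fin.ext (Nat.add_zero _))
        (Fin.ext (Nat.add_zero _)) σ
    · rw [scls_eq_zero k (σ := back S h _), TensorProduct.tmul_zero]
      exact map_mem_degenerate_of_σ S (SimplexCategory.subinterval p q _) j
        (a := ⟨j.1 - p, by omega⟩) (b := ⟨j.1 + 1 - p, by omega⟩)
        (Fin.ext (Nat.sub_add_cancel hj)) (Fin.ext (Nat.sub_add_cancel (by omega))) σ)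

/-- The counit, with value `1` on vertices. -/
noncomputable def scounit : SChains k S 0 →ₗ[k] k :=
  schainsLift k S (fun _ => 1) (by simp)

end SimplicialChains

section SimplicialChains

variable (k : Type v) [CommRing k] (S : SSet.{u})

@[simp] theorem sbd_scls {n : ℕ} (σ : Simp S (n + 1)) : sbd k S n (scls k σ) =
    ∑ i : Fin (n + 2), (-1 : k) ^ i.1 • scls k (S.δ i σ) := schainsLift_scls k S _ _ σ

@[simp] theorem scomul_scls {p q n : ℕ} (h : p + q = n) (σ : Simp S n) :
    scomul k S p q n h (scls k σ) =
      scls k (front S (p := p) (by omega) σ) ⊗ₜ scls k (back S h σ) := schainsLift_scls k S _ _ σ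

@[simp] theorem scounit_scls (σ : Simp S 0) : scounit k S (scls k σ) = 1 :=
  schainsLift_scls k S _ _ σ

variable {S} in
theorem simp_map_map {a b c : ℕ} (f : SimplexCategory.mk a ⟶ SimplexCategory.mk b)
    (g : SimplexCategory.mk b ⟶ SimplexCategory.mk c) {h : SimplexCategory.mk a ⟶
    SimplexCategory.mk c} (hh : ∀ i, (g (f i)).1 = (h i).1) (σ : Simp S c) :
    S.map f.op (S.map g.op σ) = S.map h.op σ := by
  have : f ≫ g = h := by
    ext i : 3
    exact Fin.ext (hh i)
  rw [← this, op_comp, Functor.map_comp]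
  rfl

variable {S} in
theorem simp_map_id {a : ℕ} (f : SimplexCategory.mk a ⟶ SimplexCategory.mk a)
    (hh : ∀ i, (f i).1 = i.1) (σ : Simp S a) : S.map f.op σ = σ := by
  have : f = 𝟙 _ := by
    ext i : 3
    exact Fin.ext (hh i)
  rw [this, op_id, CategoryTheory.Functor.map_id]
  rfl

variable {S} in
theorem simp_map_map_eq {a b b' c : ℕ} (f : SimplexCategory.mk a ⟶ SimplexCategory.mk b)
    (g : SimplexCategory.mk b ⟶ SimplexCategory.mk c)
    (f' : SimplexCategory.mk a ⟶ SimplexCategory.mk b')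
    (g' : SimplexCategory.mk b' ⟶ SimplexCategory.mk c)
    (hh : ∀ i, (g (f i)).1 = (g' (f' i)).1) (σ : Simp S c) :
    S.map f.op (S.map g.op σ) = S.map f'.op (S.map g'.op σ) := by
  rw [simp_map_map f g (h := f' ≫ g') hh, simp_map_map f' g' (h := f' ≫ g') fun _ => rfl]

theorem subinterval_apply {n j l : ℕ} (h : j + l ≤ n) (i : Fin (l + 1)) :
    (SimplexCategory.subinterval j l h i).1 = i.1 + j := rfl

theorem δ_apply_lt {n : ℕ} {i : Fin (n + 2)} {a : Fin (n + 1)} (h : a.1 < i.1) :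
    (SimplexCategory.δ i a).1 = a.1 :=
  congrArg Fin.val (Fin.succAbove_of_castSucc_lt i a h)

theorem δ_apply_ge {n : ℕ} {i : Fin (n + 2)} {a : Fin (n + 1)} (h : i.1 ≤ a.1) :
    (SimplexCategory.δ i a).1 = a.1 + 1 :=
  congrArg Fin.val (Fin.succAbove_of_le_castSucc i a h)

variable {S} in
theorem front_δ_of_le {p n : ℕ} (h : p ≤ n) (i : Fin (p + 2)) (σ : Simp S (n + 1)) :
    front S h (S.δ ⟨i.1, by omega⟩ σ) = S.δ i (front S (by omega : p + 1 ≤ n + 1) σ) := by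
  refine simp_map_map_eq _ _ _ _ (fun a => ?_) σ
  rw [subinterval_apply]
  rcases lt_or_ge a.1 i.1 with h | h
  · rw [δ_apply_lt h, δ_apply_lt]
    · rfl
    · exact h
  · rw [δ_apply_ge h, δ_apply_ge]
    · rfl
    · exact h

variable {S} in
theorem front_δ_of_gt {p n : ℕ} (h : p ≤ n) (i : Fin (n + 2)) (hi : p < i.1)
    (σ : Simp S (n + 1)) : front S h (S.δ i σ) = front S (by omega : p ≤ n + 1) σ := by
  refine simp_map_map _ _ (fun a => ?_) σ
  have : a.1 < p + 1 := a.2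
  exact δ_apply_lt (show a.1 + 0 < i.1 by omega)

variable {S} in
theorem back_δ_of_le {p q n : ℕ} (h : p + q = n) (i : Fin (n + 2)) (hi : i.1 ≤ p)
    (σ : Simp S (n + 1)) : back S h (S.δ i σ) = back S (by omega : p + 1 + q = n + 1) σ := by
  refine simp_map_map _ _ (fun a => ?_) σ
  refine (δ_apply_ge (show i.1 ≤ a.1 + p by omega)).trans ?_
  rfl

variable {S} in
theorem back_δ_of_ge {p q n : ℕ} (h : p + q = n) (i : Fin (q + 2)) (σ : Simp S (n + 1)) :
    back S h (S.δ ⟨p + i.1, by omega⟩ σ) =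
      S.δ i (back S (by omega : p + (q + 1) = n + 1) σ) := by
  refine simp_map_map_eq _ _ _ _ (fun a => ?_) σ
  rw [subinterval_apply]
  rcases lt_or_ge a.1 i.1 with h | h
  · rw [δ_apply_lt h, δ_apply_lt]
    · rfl
    · change a.1 + p < p + i.1
      omega
  · rw [δ_apply_ge h, δ_apply_ge]
    · change a.1 + p + 1 = a.1 + 1 + p
      omega
    · change p + i.1 ≤ a.1 + p
      omega

theorem sbd_sbd (n : ℕ) (x : SChains k S (n + 2)) : sbd k S n (sbd k S (n + 1) x) = 0 := by
  have : sbd k S n ∘ₗ sbd k S (n + 1) = 0 := schains_hom_ext fun σ => ?_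
  · exact DFunLike.congr_fun this x
  let t : Fin (n + 3) × Fin (n + 2) → SChains k S n := fun p =>
    (-1 : k) ^ (p.1.1 + p.2.1) • scls k (S.δ p.2 (S.δ p.1 σ))
  have h1 : (sbd k S n ∘ₗ sbd k S (n + 1)) (scls k σ) = ∑ p, t p := by
    simp only [LinearMap.comp_apply, sbd_scls, map_sum, map_smul, Finset.smul_sum, smul_smul,
      ← pow_add, t]
    rw [Fintype.sum_prod_type]
  refine h1.trans (Finset.sum_involution
    (fun p _ => (p.1.succAbove p.2, p.2.predAbove p.1)) ?_ ?_ ?_ ?_)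
  · rintro ⟨j, i⟩ -
    have h : S.δ (i.predAbove j) (S.δ (j.succAbove i) σ) = S.δ i (S.δ j σ) :=
      simp_map_map_eq _ _ _ _ (fun a => congrArg Fin.val
        (Fin.succAbove_succAbove_succAbove_predAbove j i a)) σ
    simp only [t, h, CubicalMonoid.neg_one_pow_swap, neg_smul]
    exact add_neg_cancel _
  · rintro ⟨j, i⟩ - - h
    simp only [Prod.mk.injEq] at h
    exact Fin.succAbove_ne j i h.1
  · simp
  · rintro ⟨j, i⟩ -
    simp only [Prod.mk.injEq]
    exact ⟨Fin.succAbove_succAbove_predAbove _ _, Fin.predAbove_predAbove_succAbove _ _⟩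

theorem scomul_coassoc (p q r m m' n : ℕ) (h₁ : p + q = m) (h₂ : m + r = n) (h₃ : q + r = m')
    (h₄ : p + m' = n) (x : SChains k S n) :
    TensorProduct.assoc k (SChains k S p) (SChains k S q) (SChains k S r)
      ((scomul k S p q m h₁).rTensor _ (scomul k S m r n h₂ x)) =
      (scomul k S q r m' h₃).lTensor _ (scomul k S p m' n h₄ x) := by
  have : (TensorProduct.assoc k (SChains k S p) (SChains k S q) (SChains k S r)).toLinearMap ∘ₗ
      (scomul k S p q m h₁).rTensor _ ∘ₗ scomul k S m r n h₂ =
      (scomul k S q r m' h₃).lTensor _ ∘ₗ scomul k S p m' n h₄ := schains_hom_ext fun σ => ?_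
  · exact DFunLike.congr_fun this x
  have e1 : front S (p := p) (n := m) (by omega) (front S (p := m) (n := n) (by omega) σ) =
      front S (by omega) σ := simp_map_map _ _ (fun _ => rfl) σ
  have e2 : back S h₁ (front S (p := m) (n := n) (by omega) σ) =
      front S (p := q) (n := m') (by omega) (back S h₄ σ) :=
    simp_map_map_eq (SimplexCategory.subinterval p q h₁.le)
      (SimplexCategory.subinterval 0 m (by omega)) (SimplexCategory.subinterval 0 q (by omega))
      (SimplexCategory.subinterval p m' h₄.le) (fun _ => rfl) σ
  have e3 : back S h₃ (back S h₄ σ) = back S h₂ σ := simp_map_map _ _ (fun a => by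
    simp only [subinterval_apply]
    omega) σ
  simp [e1, e2, e3]

theorem scomul_sbd (p q n : ℕ) (h : p + q = n) (h₁ : p + 1 + q = n + 1) (h₂ : p + (q + 1) = n + 1)
    (x : SChains k S (n + 1)) : scomul k S p q n h (sbd k S n x) =
      (sbd k S p).rTensor _ (scomul k S (p + 1) q (n + 1) h₁ x) +
      (-1 : k) ^ p • (sbd k S q).lTensor _ (scomul k S p (q + 1) (n + 1) h₂ x) := by
  have : scomul k S p q n h ∘ₗ sbd k S n =
      (sbd k S p).rTensor _ ∘ₗ scomul k S (p + 1) q (n + 1) h₁ +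
      (-1 : k) ^ p • ((sbd k S q).lTensor _ ∘ₗ scomul k S p (q + 1) (n + 1) h₂) :=
    schains_hom_ext fun σ => ?_
  · exact DFunLike.congr_fun this x
  subst h
  let F : ℕ → SChains k S p ⊗[k] SChains k S q := fun i =>
    if hi : i < p + q + 2 then (-1 : k) ^ i • scomul k S p q (p + q) rfl
      (scls k (S.δ ⟨i, hi⟩ σ)) else 0
  have hF : ∀ (i : ℕ) (hi : i < p + q + 2), F i = (-1 : k) ^ i • scomul k S p q (p + q) rfl
      (scls k (S.δ ⟨i, hi⟩ σ)) := fun i hi => dif_pos hi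
  let u : SChains k S p ⊗[k] SChains k S q :=
    scls k (front S (by omega) σ) ⊗ₜ scls k (back S (p := p + 1) h₁ σ)
  have hl : (scomul k S p q (p + q) rfl ∘ₗ sbd k S (p + q)) (scls k σ) =
      ∑ i ∈ Finset.range (p + 1), F i + ∑ i ∈ Finset.range (q + 1), F (p + 1 + i) := by
    rw [← Finset.sum_range_add, LinearMap.comp_apply, sbd_scls, map_sum,
      show p + 1 + (q + 1) = p + q + 2 by omega, Finset.sum_range]
    exact Finset.sum_congr rfl fun i _ => by rw [map_smul, hF i.1 i.2]
  have h3 : (sbd k S p).rTensor _ (scomul k S (p + 1) q (p + q + 1) h₁ (scls k σ)) =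
      ∑ i ∈ Finset.range (p + 1), F i + (-1 : k) ^ (p + 1) • u := by
    rw [scomul_scls, LinearMap.rTensor_tmul, sbd_scls, Fin.sum_univ_castSucc, TensorProduct.add_tmul,
      TensorProduct.sum_tmul, Finset.sum_range]
    refine congrArg₂ (· + ·) (Finset.sum_congr rfl fun i _ => ?_) ?_
    · rw [hF i.1 (by omega), scomul_scls, TensorProduct.smul_tmul',
        back_δ_of_le rfl _ (by have := i.2; simp; omega), ← front_δ_of_le _ i.castSucc]
      rfl
    · rw [TensorProduct.smul_tmul', ← front_δ_of_le (by omega : p ≤ p + q),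
        front_δ_of_gt _ _ (by simp)]
      rfl
  have h4 : (sbd k S q).lTensor _ (scomul k S p (q + 1) (p + q + 1) h₂ (scls k σ)) =
      u + (-1 : k) ^ p • ∑ i ∈ Finset.range (q + 1), F (p + 1 + i) := by
    rw [scomul_scls, LinearMap.lTensor_tmul, sbd_scls, Fin.sum_univ_succ, TensorProduct.tmul_add,
      TensorProduct.tmul_sum, Finset.sum_range, Finset.smul_sum]
    refine congrArg₂ (· + ·) ?_ (Finset.sum_congr rfl fun i _ => ?_)
    · rw [← back_δ_of_ge rfl, back_δ_of_le rfl _ (by simp)]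
      simp [u]
    · rw [hF _ (by omega), scomul_scls, TensorProduct.tmul_smul, ← back_δ_of_ge rfl,
        front_δ_of_gt _ _ (by simp; omega), smul_smul]
      congr 1
      · have : (-1 : k) ^ (p * 2) = 1 := by rw [mul_comm, pow_mul]; simp
        rw [Fin.val_succ]
        linear_combination (-(-1 : k) ^ (i.1 + 1)) * this
      · exact congrArg (fun j => scls k (front S (by omega) σ) ⊗ₜ[k] scls k (back S rfl (S.δ j σ)))
          (Fin.ext (by simp; omega))
  rw [hl, LinearMap.add_apply, LinearMap.smul_apply, LinearMap.comp_apply, LinearMap.comp_apply,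
    h3, h4, smul_add, smul_smul, ← pow_add]
  have : (-1 : k) ^ (p + p) = 1 := by rw [← two_mul, pow_mul]; simp
  have e : ((-1 : k) ^ (p + 1)) • u = -((-1 : k) ^ p • u) := by
    rw [pow_succ, mul_neg_one]
    exact neg_smul (R := k) (M := SChains k S p ⊗[k] SChains k S q) _ _
  rw [this, one_smul, e]
  abel

theorem scounit_sbd (x : SChains k S 1) : scounit k S (sbd k S 0 x) = 0 := by
  have : scounit k S ∘ₗ sbd k S 0 = 0 := schains_hom_ext fun σ => by
    simp [Fin.sum_univ_two]
  exact DFunLike.congr_fun this x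

theorem scounit_scomul (n : ℕ) (x : SChains k S n) : TensorProduct.lid k (SChains k S n)
    ((scounit k S).rTensor _ (scomul k S 0 n n (Nat.zero_add n) x)) = x := by
  have : (TensorProduct.lid k (SChains k S n)).toLinearMap ∘ₗ (scounit k S).rTensor _ ∘ₗ
      scomul k S 0 n n (Nat.zero_add n) = LinearMap.id := schains_hom_ext fun σ => by
    have e : back S (Nat.zero_add n) σ = σ := simp_map_id _ (fun _ => rfl) σ
    simp [e]
  exact DFunLike.congr_fun this x

theorem scomul_scounit (n : ℕ) (x : SChains k S n) : TensorProduct.rid k (SChains k S n)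
    ((scounit k S).lTensor _ (scomul k S n 0 n (Nat.add_zero n) x)) = x := by
  have : (TensorProduct.rid k (SChains k S n)).toLinearMap ∘ₗ (scounit k S).lTensor _ ∘ₗ
      scomul k S n 0 n (Nat.add_zero n) = LinearMap.id := schains_hom_ext fun σ => by
    have e : front S le_rfl σ = σ := simp_map_id _ (fun _ => rfl) σ
    simp [e]
  exact DFunLike.congr_fun this x

theorem scounit_bijective (x : Vertices S) (hS : ∀ y : Vertices S, y = x) :
    Function.Bijective (scounit k S) := by
  let g : k →ₗ[k] SChains k S 0 := LinearMap.toSpanSingleton k _ (scls k (S := S) (n := 0) x)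
  have h1 : scounit k S ∘ₗ g = LinearMap.id := LinearMap.ext_ring (by simp [g])
  have h2 : g ∘ₗ scounit k S = LinearMap.id := schains_hom_ext fun σ => by
    have : σ = x := hS σ
    simp [g, this]
  exact ⟨Function.LeftInverse.injective (g := g) (DFunLike.congr_fun h2),
    Function.RightInverse.surjective (g := g) (DFunLike.congr_fun h1)⟩

/-- The connected differential graded coalgebra `Q_Δ(S)` of normalized chains on a `0`-reduced
simplicial set `S`, with the Alexander–Whitney coproduct. -/
noncomputable def normalizedChains (x : Vertices S) (hS : ∀ y : Vertices S, y = x) :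
    ConnectedDGCoalgebra.{v, max u v} k where
  X := SChains k S
  addCommGroup := fun n => inferInstance
  module := fun n => inferInstance
  bd := sbd k S
  comul := scomul k S
  counit := scounit k S
  bd_bd := sbd_sbd k S
  coassoc p q r m m' n h₁ h₂ h₃ h₄ x := by
    have := scomul_coassoc k S p q r m m' n h₁ h₂ h₃ h₄ x
    exact this
  counit_comul := scounit_scomul k S
  comul_counit := scomul_scounit k S
  comul_bd := scomul_sbd k S
  counit_bd := scounit_sbd k S
  connected := scounit_bijective k S x hS

end SimplicialChains

/-! ## The cobar construction -/

namespace ConnectedDGCoalgebra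

variable {k : Type v} [CommRing k] (C : ConnectedDGCoalgebra.{v, w} k)

/-- The algebra `T(sC̄)` underlying the cobar construction, where `C̄` is the part of `C` of positive
degree and `(sC̄)_n = C̄_{n+1}`. -/
abbrev CobarAlg : Type (max v w) := TensorAlgebra k (DirectSum ℕ fun n => C.X (n + 1))

/-- The map `s : C_{n+1} ⟶ (sC̄)_n`, with values in the tensor algebra. -/
noncomputable def gen (n : ℕ) : C.X (n + 1) →ₗ[k] C.CobarAlg :=
  TensorAlgebra.ι k ∘ₗ DirectSum.lof k ℕ (fun n => C.X (n + 1)) n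

/-- The map `c ⊗ c' ↦ sc ⊗ sc'`. -/
noncomputable def genMul (i j : ℕ) : C.X (i + 1) ⊗[k] C.X (j + 1) →ₗ[k] C.CobarAlg :=
  LinearMap.mul' k C.CobarAlg ∘ₗ TensorProduct.map (C.gen i) (C.gen j)

/-- The values of the differential on generators,
`D(sc) = -s∂c + ∑ (-1)^{deg c'} sc' ⊗ sc''`, where the sum is over the components of the coproduct
of `c` of bidegrees `(i + 1, j + 1)`. -/
noncomputable def dGen : ∀ n, C.X (n + 1) →ₗ[k] C.CobarAlg
  | 0 => 0
  | m + 1 => -(C.gen m ∘ₗ C.bd (m + 1)) + ∑ p : Finset.HasAntidiagonal.antidiagonal m,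
      (-1 : k) ^ (p.1.1 + 1) • (C.genMul p.1.1 p.1.2 ∘ₗ
        C.comul (p.1.1 + 1) (p.1.2 + 1) (m + 2)
          (by have := Finset.HasAntidiagonal.mem_antidiagonal.1 p.2; omega))

/-- The automorphism which is multiplication by `(-1)ⁿ` in degree `n`. -/
noncomputable def sgn : C.CobarAlg →ₐ[k] C.CobarAlg :=
  TensorAlgebra.lift k (DirectSum.toModule k ℕ _ fun n => (-1 : k) ^ n • C.gen n)

/-- The homomorphism `a ↦ ((ā, D a), (0, a))` where `ā` is the image of `a` under `sgn`: as `D` is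
a derivation, `D(ab) = (D a) b + ā (D b)`, this is a homomorphism of algebras, determined by its
values on generators. -/
noncomputable def dMatrix : C.CobarAlg →ₐ[k] Matrix (Fin 2) (Fin 2) C.CobarAlg :=
  TensorAlgebra.lift k (DirectSum.toModule k ℕ _ fun n =>
    { toFun := fun x => !![(-1 : k) ^ n • C.gen n x, C.dGen n x; 0, C.gen n x]
      map_add' := fun x y => by
        ext i j
        fin_cases i <;> fin_cases j <;> simp
      map_smul' := fun c x => by
        ext i j
        fin_cases i <;> fin_cases j <;> simp [smul_comm c] })

/-- The differential: the derivation which extends `dGen` (see `D_gen` and `D_mul`). -/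
noncomputable def D : C.CobarAlg →ₗ[k] C.CobarAlg where
  toFun a := C.dMatrix a 0 1
  map_add' a b := by rw [map_add]; rfl
  map_smul' c a := by rw [map_smul]; rfl

theorem sgn_gen (n : ℕ) (x : C.X (n + 1)) : C.sgn (C.gen n x) = (-1 : k) ^ n • C.gen n x := by
  simp [sgn, gen]

theorem dMatrix_gen (n : ℕ) (x : C.X (n + 1)) : C.dMatrix (C.gen n x) =
    !![(-1 : k) ^ n • C.gen n x, C.dGen n x; 0, C.gen n x] := by
  simp [dMatrix, gen]

theorem D_gen (n : ℕ) (x : C.X (n + 1)) : C.D (C.gen n x) = C.dGen n x :=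
  congrArg (fun M => M 0 1) (C.dMatrix_gen n x)

variable {C} in
theorem gen_induction {P : C.CobarAlg → Prop} (h1 : ∀ r, P (algebraMap k _ r))
    (hgen : ∀ n x, P (C.gen n x)) (hmul : ∀ a b, P a → P b → P (a * b))
    (hadd : ∀ a b, P a → P b → P (a + b)) (a : C.CobarAlg) : P a := by
  induction a using TensorAlgebra.induction with
  | algebraMap r => exact h1 r
  | ι v =>
    induction v using DirectSum.induction_on with
    | zero => simpa using h1 0
    | of n x => exact hgen n x
    | add v w hv hw => rw [map_add]; exact hadd _ _ hv hw
  | mul a b ha hb => exact hmul a b ha hb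
  | add a b ha hb => exact hadd a b ha hb

theorem dMatrix_entries (a : C.CobarAlg) :
    C.dMatrix a 0 0 = C.sgn a ∧ C.dMatrix a 1 0 = 0 ∧ C.dMatrix a 1 1 = a := by
  induction a using gen_induction with
  | h1 r => simp [Matrix.algebraMap_matrix_apply]
  | hgen n x => simp [dMatrix_gen, sgn_gen]
  | hmul a b ha hb => simp [Matrix.mul_apply, Fin.sum_univ_two, ha, hb]
  | hadd a b ha hb => simp [ha, hb]

theorem D_mul (a b : C.CobarAlg) : C.D (a * b) = C.D a * b + C.sgn a * C.D b := by
  change C.dMatrix (a * b) 0 1 = C.dMatrix a 0 1 * b + C.sgn a * C.dMatrix b 0 1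
  obtain ⟨ha, -, -⟩ := C.dMatrix_entries a
  obtain ⟨-, -, hb⟩ := C.dMatrix_entries b
  rw [map_mul, Matrix.mul_apply, Fin.sum_univ_two, ha, hb, add_comm]

theorem D_algebraMap (r : k) : C.D (algebraMap k _ r) = 0 := by
  change C.dMatrix (algebraMap k _ r) 0 1 = 0
  rw [AlgHom.commutes]
  simp [Matrix.algebraMap_matrix_apply]

theorem genMul_tmul (i j : ℕ) (x : C.X (i + 1)) (y : C.X (j + 1)) :
    C.genMul i j (x ⊗ₜ y) = C.gen i x * C.gen j y := by
  simp [genMul]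

/-! ### The square of the differential -/

/-- The coproduct, extended by zero. -/
noncomputable def comul0 (p q n : ℕ) : C.X n →ₗ[k] C.X p ⊗[k] C.X q :=
  if h : p + q = n then C.comul p q n h else 0

theorem comul0_eq {p q n : ℕ} (h : p + q = n) : C.comul0 p q n = C.comul p q n h := dif_pos h

theorem dGen_zero : C.dGen 0 = 0 := rfl

theorem dGen_succ (m : ℕ) (x : C.X (m + 2)) : C.dGen (m + 1) x = -C.gen m (C.bd (m + 1) x) +
    ∑ p ∈ Finset.HasAntidiagonal.antidiagonal m,
      (-1 : k) ^ (p.1 + 1) • C.genMul p.1 p.2 (C.comul0 (p.1 + 1) (p.2 + 1) (m + 2) x) := by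
  rw [← Finset.sum_coe_sort, dGen]
  simp only [LinearMap.add_apply, LinearMap.neg_apply, LinearMap.comp_apply, LinearMap.sum_apply,
    LinearMap.smul_apply]
  congr 1
  refine Finset.sum_congr rfl fun p _ => ?_
  rw [comul0_eq]

theorem sgn_genMul (i j : ℕ) (t : C.X (i + 1) ⊗[k] C.X (j + 1)) :
    C.sgn (C.genMul i j t) = (-1 : k) ^ (i + j) • C.genMul i j t := by
  have : C.sgn.toLinearMap ∘ₗ C.genMul i j = (-1 : k) ^ (i + j) • C.genMul i j :=
    TensorProduct.ext' fun x y => by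
      simp [genMul_tmul, sgn_gen, smul_smul, pow_add, mul_comm]
  exact DFunLike.congr_fun this t

theorem sgn_dGen (n : ℕ) (x : C.X (n + 1)) :
    C.sgn (C.dGen n x) = -((-1 : k) ^ n • C.dGen n x) := by
  cases n with
  | zero => simp [dGen]
  | succ m =>
    rw [dGen_succ, map_add, map_neg, map_sum, sgn_gen, smul_add, neg_add, smul_neg, neg_neg,
      pow_succ, mul_neg_one, neg_smul, neg_smul, neg_neg]
    congr 1
    rw [Finset.smul_sum]
    refine Finset.sum_congr rfl fun p hp => ?_
    rw [map_smul, sgn_genMul, Finset.HasAntidiagonal.mem_antidiagonal.1 hp, smul_comm]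

theorem sgn_D (a : C.CobarAlg) : C.sgn (C.D a) = -C.D (C.sgn a) := by
  induction a using gen_induction with
  | h1 r => simp [D_algebraMap]
  | hgen n x => rw [D_gen, sgn_dGen, sgn_gen, map_smul, D_gen]
  | hmul a b ha hb =>
    rw [D_mul, map_add, map_mul, map_mul, map_mul, D_mul, ha, hb]
    simp [add_comm]
  | hadd a b ha hb => rw [map_add, map_add, map_add, map_add, ha, hb, neg_add]

theorem D_genMul (i j : ℕ) (t : C.X (i + 1) ⊗[k] C.X (j + 1)) : C.D (C.genMul i j t) =
    LinearMap.mul' k _ (TensorProduct.map (C.dGen i) (C.gen j) t) +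
      (-1 : k) ^ i • LinearMap.mul' k _ (TensorProduct.map (C.gen i) (C.dGen j) t) := by
  have : C.D ∘ₗ C.genMul i j = LinearMap.mul' k _ ∘ₗ TensorProduct.map (C.dGen i) (C.gen j) +
      (-1 : k) ^ i • (LinearMap.mul' k _ ∘ₗ TensorProduct.map (C.gen i) (C.dGen j)) :=
    TensorProduct.ext' fun x y => by
      simp [genMul_tmul, D_mul, D_gen, sgn_gen]
  exact DFunLike.congr_fun this t

theorem mul_dGen_left (i j : ℕ) (t : C.X (i + 2) ⊗[k] C.X (j + 1)) :
    LinearMap.mul' k _ (TensorProduct.map (C.dGen (i + 1)) (C.gen j) t) =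
      -C.genMul i j ((C.bd (i + 1)).rTensor _ t) + ∑ p ∈ Finset.HasAntidiagonal.antidiagonal i,
        (-1 : k) ^ (p.1 + 1) • LinearMap.mul' k _ (TensorProduct.map (C.genMul p.1 p.2) (C.gen j)
          ((C.comul0 (p.1 + 1) (p.2 + 1) (i + 2)).rTensor _ t)) := by
  induction t using TensorProduct.induction_on with
  | zero => simp
  | tmul x y => simp [dGen_succ, genMul_tmul, add_mul, Finset.sum_mul]
  | add x y hx hy =>
    simp only [map_add, hx, hy, smul_add, Finset.sum_add_distrib]
    abel

theorem mul_dGen_right (i j : ℕ) (t : C.X (i + 1) ⊗[k] C.X (j + 2)) :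
    LinearMap.mul' k _ (TensorProduct.map (C.gen i) (C.dGen (j + 1)) t) =
      -C.genMul i j ((C.bd (j + 1)).lTensor _ t) + ∑ p ∈ Finset.HasAntidiagonal.antidiagonal j,
        (-1 : k) ^ (p.1 + 1) • LinearMap.mul' k _ (TensorProduct.map (C.gen i) (C.genMul p.1 p.2)
          ((C.comul0 (p.1 + 1) (p.2 + 1) (j + 2)).lTensor _ t)) := by
  induction t using TensorProduct.induction_on with
  | zero => simp
  | tmul x y => simp [dGen_succ, genMul_tmul, mul_add, Finset.mul_sum]
  | add x y hx hy =>
    simp only [map_add, hx, hy, smul_add, Finset.sum_add_distrib]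
    abel

theorem genMul_assoc (a b c : ℕ) (t : (C.X (a + 1) ⊗[k] C.X (b + 1)) ⊗[k] C.X (c + 1)) :
    LinearMap.mul' k _ (TensorProduct.map (C.genMul a b) (C.gen c) t) =
      LinearMap.mul' k _ (TensorProduct.map (C.gen a) (C.genMul b c)
        (TensorProduct.assoc k _ _ _ t)) := by
  have : LinearMap.mul' k _ ∘ₗ TensorProduct.map (C.genMul a b) (C.gen c) =
      LinearMap.mul' k _ ∘ₗ TensorProduct.map (C.gen a) (C.genMul b c) ∘ₗ
        (TensorProduct.assoc k (C.X (a + 1)) (C.X (b + 1)) (C.X (c + 1))).toLinearMap :=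
    TensorProduct.ext_threefold fun x y z => by simp [genMul_tmul, mul_assoc]
  exact DFunLike.congr_fun this t

theorem D_dGen (n : ℕ) (x : C.X (n + 1)) : C.D (C.dGen n x) = 0 := by
  obtain _ | _ | m := n
  · rw [dGen_zero]; simp
  · simp [dGen_succ, D_gen, D_genMul, dGen_zero]
  · rw [dGen_succ, map_add, map_neg, map_sum, D_gen, dGen_succ, C.bd_bd, map_zero, neg_zero,
      zero_add]
    have hR : ∀ p ∈ Finset.HasAntidiagonal.antidiagonal m,
        (-1 : k) ^ (p.1 + 1) • C.genMul p.1 p.2 (C.comul0 (p.1 + 1) (p.2 + 1) (m + 2)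
          (C.bd (m + 2) x)) =
        (-1 : k) ^ (p.1 + 1) • C.genMul p.1 p.2 ((C.bd (p.1 + 1)).rTensor _
          (C.comul0 (p.1 + 2) (p.2 + 1) (m + 3) x)) + C.genMul p.1 p.2 ((C.bd (p.2 + 1)).lTensor _
          (C.comul0 (p.1 + 1) (p.2 + 2) (m + 3) x)) := by
      rintro ⟨i, j⟩ hp
      have hp : i + j = m := Finset.HasAntidiagonal.mem_antidiagonal.1 hp
      have hs : (-1 : k) ^ (i + 1) * (-1) ^ (i + 1) = 1 := by
        rw [← mul_pow]; simp
      rw [comul0_eq C (by omega : i + 1 + (j + 1) = m + 2),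
        comul0_eq C (by omega : i + 2 + (j + 1) = m + 3),
        comul0_eq C (by omega : i + 1 + (j + 2) = m + 3), C.comul_bd _ _ _ _ (by omega) (by omega),
        map_add, map_smul, smul_add, smul_smul, hs, one_smul]
    rw [Finset.sum_congr rfl hR, Finset.sum_add_distrib]
    simp only [map_smul, D_genMul, smul_add, Finset.sum_add_distrib]
    rw [Finset.Nat.sum_antidiagonal_succ, Finset.Nat.sum_antidiagonal_succ']
    simp only [dGen_zero, TensorProduct.map_zero_left, TensorProduct.map_zero_right,
      LinearMap.zero_apply, map_zero, smul_zero, zero_add, mul_dGen_left, mul_dGen_right,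
      smul_add, Finset.sum_add_distrib]
    have h1 : ∀ i : ℕ, (-1 : k) ^ (i + 1) * (-1) ^ i = -1 := fun i => by
      rw [pow_succ, mul_assoc, mul_comm, mul_assoc, ← mul_pow]; simp
    have hA : ∀ f : ℕ × ℕ → C.CobarAlg, ∑ p ∈ Finset.HasAntidiagonal.antidiagonal m,
        (-1 : k) ^ (p.1 + 1 + 1) • -f p =
        ∑ p ∈ Finset.HasAntidiagonal.antidiagonal m, (-1 : k) ^ (p.1 + 1) • f p := fun f =>
      Finset.sum_congr rfl fun p _ => by rw [pow_succ, mul_neg_one, neg_smul, smul_neg, neg_neg]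
    have hB : ∀ f : ℕ × ℕ → C.CobarAlg, ∑ p ∈ Finset.HasAntidiagonal.antidiagonal m,
        (-1 : k) ^ (p.1 + 1) • (-1 : k) ^ p.1 • -f p =
        ∑ p ∈ Finset.HasAntidiagonal.antidiagonal m, f p := fun f =>
      Finset.sum_congr rfl fun p _ => by rw [smul_smul, h1, smul_neg, neg_smul, one_smul, neg_neg]
    have hQ : ∀ f g : ℕ → ℕ → ℕ → ℕ → ℕ → C.CobarAlg,
        (∀ a b c, a + b + c = m → f (a + b) c a b c = g a (b + c) a b c) →
        ∑ p ∈ Finset.HasAntidiagonal.antidiagonal m, (-1 : k) ^ (p.1 + 1 + 1) •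
          ∑ q ∈ Finset.HasAntidiagonal.antidiagonal p.1, (-1 : k) ^ (q.1 + 1) •
            f p.1 p.2 q.1 q.2 p.2 =
        -∑ p ∈ Finset.HasAntidiagonal.antidiagonal m, (-1 : k) ^ (p.1 + 1) • (-1 : k) ^ p.1 •
          ∑ q ∈ Finset.HasAntidiagonal.antidiagonal p.2, (-1 : k) ^ (q.1 + 1) •
            g p.1 p.2 p.1 q.1 q.2 := by
      intro f g hfg
      simp only [smul_smul, Finset.smul_sum, ← Finset.sum_neg_distrib]
      rw [Finset.sum_sigma', Finset.sum_sigma']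
      refine Finset.sum_nbij' (fun x => ⟨(x.2.1, x.2.2 + x.1.2), (x.2.2, x.1.2)⟩)
        (fun x => ⟨(x.1.1 + x.2.1, x.2.2), (x.1.1, x.2.1)⟩) ?_ ?_ ?_ ?_ ?_
      · rintro ⟨⟨i, j⟩, ⟨a, b⟩⟩ h
        simp at h ⊢
        omega
      · rintro ⟨⟨i, j⟩, ⟨a, b⟩⟩ h
        simp at h ⊢
        omega
      · rintro ⟨⟨i, j⟩, ⟨a, b⟩⟩ h
        simp at h
        obtain ⟨rfl, rfl⟩ := h
        rfl
      · rintro ⟨⟨i, j⟩, ⟨a, b⟩⟩ h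
        simp at h
        obtain ⟨rfl, rfl⟩ := h
        rfl
      · rintro ⟨⟨i, j⟩, ⟨a, b⟩⟩ h
        simp at h
        obtain ⟨rfl, rfl⟩ := h
        simp only
        rw [hfg a b j rfl, ← neg_smul]
        congr 1
        ring
    rw [hA, hB, hQ (fun i j a b c => LinearMap.mul' k _ (TensorProduct.map (C.genMul a b) (C.gen c)
        ((C.comul0 (a + 1) (b + 1) (i + 2)).rTensor _ (C.comul0 (i + 2) (c + 1) (m + 3) x))))
      (fun i j a b c => LinearMap.mul' k _ (TensorProduct.map (C.gen a) (C.genMul b c)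
        ((C.comul0 (b + 1) (c + 1) (j + 2)).lTensor _ (C.comul0 (a + 1) (j + 2) (m + 3) x))))]
    · abel
    · rintro a b c rfl
      rw [genMul_assoc, comul0_eq C (by omega : a + 1 + (b + 1) = a + b + 2),
        comul0_eq C (by omega : a + b + 2 + (c + 1) = a + b + c + 3),
        comul0_eq C (by omega : b + 1 + (c + 1) = b + c + 2),
        comul0_eq C (by omega : a + 1 + (b + c + 2) = a + b + c + 3), C.coassoc]

theorem D_D (a : C.CobarAlg) : C.D (C.D a) = 0 := by
  induction a using gen_induction with
  | h1 r => simp [D_algebraMap]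
  | hgen n x => rw [D_gen, D_dGen]
  | hmul a b ha hb =>
    rw [D_mul, map_add, D_mul, D_mul, ha, hb, sgn_D]
    simp
  | hadd a b ha hb => rw [map_add, map_add, ha, hb, add_zero]

end ConnectedDGCoalgebra

namespace ConnectedDGCoalgebra

variable {k : Type v} [CommRing k] (C : ConnectedDGCoalgebra.{v, w} k)

/-! ### The grading of the cobar construction -/

/-- The monomial `sc₁ ⊗ ⋯ ⊗ scᵣ`. -/
noncomputable def word : List (Σ n, C.X (n + 1)) → C.CobarAlg
  | [] => 1
  | a :: l => C.gen a.1 a.2 * word l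

/-- The degree of a monomial: the sum of the degrees of its factors `scᵢ`. -/
def wordDeg : List (Σ n, C.X (n + 1)) → ℕ
  | [] => 0
  | a :: l => a.1 + wordDeg l

/-- The homogeneous component of degree `n`, spanned by the monomials of degree `n`. -/
noncomputable def gr (n : ℕ) : Submodule k C.CobarAlg :=
  Submodule.span k {x | ∃ l, C.wordDeg l = n ∧ x = C.word l}

theorem word_mem_gr (l : List (Σ n, C.X (n + 1))) : C.word l ∈ C.gr (C.wordDeg l) :=
  Submodule.subset_span ⟨l, rfl, rfl⟩

theorem gen_mem_gr (n : ℕ) (x : C.X (n + 1)) : C.gen n x ∈ C.gr n :=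
  Submodule.subset_span ⟨[⟨n, x⟩], rfl, by simp [word]⟩

theorem word_append (l l' : List (Σ n, C.X (n + 1))) :
    C.word (l ++ l') = C.word l * C.word l' := by
  induction l with
  | nil => simp [word]
  | cons a l ih => simp [word, ih, mul_assoc]

theorem wordDeg_append (l l' : List (Σ n, C.X (n + 1))) :
    C.wordDeg (l ++ l') = C.wordDeg l + C.wordDeg l' := by
  induction l with
  | nil => simp [wordDeg]
  | cons a l ih => simp [wordDeg, ih, add_assoc]

instance : SetLike.GradedMonoid C.gr where
  one_mem := C.word_mem_gr []
  mul_mem {i j} x y hx hy := by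
    have h := Submodule.mul_mem_mul hx hy
    rw [gr, gr, Submodule.span_mul_span] at h
    refine Submodule.span_mono ?_ h
    rintro _ ⟨_, ⟨l, rfl, rfl⟩, _, ⟨l', rfl, rfl⟩, rfl⟩
    exact ⟨l ++ l', C.wordDeg_append l l', (C.word_append l l').symm⟩

open DirectSum in
/-- The decomposition into homogeneous components. -/
noncomputable def decomp : C.CobarAlg →ₐ[k] ⨁ n, C.gr n :=
  TensorAlgebra.lift k (DirectSum.toModule k ℕ _ fun n =>
    DirectSum.lof k ℕ (fun n => C.gr n) n ∘ₗ (C.gen n).codRestrict (C.gr n) (C.gen_mem_gr n))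

theorem decomp_gen (n : ℕ) (x : C.X (n + 1)) : C.decomp (C.gen n x) =
    DirectSum.of (fun n => C.gr n) n ⟨C.gen n x, C.gen_mem_gr n x⟩ := by
  simp only [decomp, gen, LinearMap.comp_apply, TensorAlgebra.lift_ι_apply,
    DirectSum.toModule_lof]
  rfl

theorem decomp_word (l : List (Σ n, C.X (n + 1))) : C.decomp (C.word l) =
    DirectSum.of (fun n => C.gr n) (C.wordDeg l) ⟨C.word l, C.word_mem_gr l⟩ := by
  induction l with
  | nil => exact map_one C.decomp
  | cons a l ih =>
    refine (map_mul C.decomp _ _).trans ?_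
    rw [ih, decomp_gen, DirectSum.of_mul_of]
    rfl

noncomputable instance : GradedAlgebra C.gr :=
  GradedAlgebra.ofAlgHom _ C.decomp
    (by
      ext n x
      refine (congrArg (DirectSum.coeAlgHom C.gr) (C.decomp_gen n x)).trans ?_
      exact DirectSum.coeAlgHom_of _ _ _)
    (by
      rintro n ⟨x, hx⟩
      refine Submodule.span_induction (p := fun x hx => C.decomp x =
        DirectSum.of (fun n => C.gr n) n ⟨x, hx⟩) ?_ ?_ ?_ ?_ hx
      · rintro _ ⟨l, rfl, rfl⟩
        exact C.decomp_word l
      · exact (map_zero C.decomp).trans (map_zero (DirectSum.of (fun n => C.gr n) n)).symm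
      · intro x y hx hy h1 h2
        refine (map_add C.decomp x y).trans ((congrArg₂ (· + ·) h1 h2).trans ?_)
        exact (map_add (DirectSum.of (fun n => C.gr n) n) ⟨x, hx⟩ ⟨y, hy⟩).symm
      · intro c x hx h
        refine (map_smul C.decomp c x).trans ((congrArg (c • ·) h).trans ?_)
        exact (DirectSum.of_smul (M := fun n => C.gr n) k n c ⟨x, hx⟩).symm)

theorem sgn_word (l : List (Σ n, C.X (n + 1))) :
    C.sgn (C.word l) = (-1 : k) ^ C.wordDeg l • C.word l := by
  induction l with
  | nil => simp [word, wordDeg]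
  | cons a l ih => simp [word, wordDeg, ih, sgn_gen, smul_smul, pow_add, mul_comm]

theorem sgn_of_mem {n : ℕ} {a : C.CobarAlg} (ha : a ∈ C.gr n) :
    C.sgn a = (-1 : k) ^ n • a := by
  have h : Set.EqOn C.sgn.toLinearMap ((-1 : k) ^ n • LinearMap.id : C.CobarAlg →ₗ[k] C.CobarAlg)
      {x | ∃ l, C.wordDeg l = n ∧ x = C.word l} := by
    rintro _ ⟨l, rfl, rfl⟩
    exact C.sgn_word l
  exact LinearMap.eqOn_span h ha

theorem genMul_mem_gr (i j : ℕ) (t : C.X (i + 1) ⊗[k] C.X (j + 1)) :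
    C.genMul i j t ∈ C.gr (i + j) := by
  induction t using TensorProduct.induction_on with
  | zero => rw [map_zero]; exact zero_mem _
  | tmul x y =>
    rw [genMul_tmul]
    exact SetLike.mul_mem_graded (C.gen_mem_gr i x) (C.gen_mem_gr j y)
  | add x y hx hy => rw [map_add]; exact add_mem hx hy

theorem dGen_mem_gr (m : ℕ) (x : C.X (m + 2)) : C.dGen (m + 1) x ∈ C.gr m := by
  rw [dGen_succ]
  refine add_mem (neg_mem (C.gen_mem_gr m _)) (sum_mem fun p hp => Submodule.smul_mem _ _ ?_)
  have e : C.gr (p.1 + p.2) = C.gr m :=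
    congrArg C.gr (Finset.HasAntidiagonal.mem_antidiagonal.1 hp)
  rw [← e]
  exact C.genMul_mem_gr _ _ _

theorem D_word_mem_gr (l : List (Σ n, C.X (n + 1))) :
    (C.wordDeg l = 0 → C.D (C.word l) = 0) ∧
      ∀ n, C.wordDeg l = n + 1 → C.D (C.word l) ∈ C.gr n := by
  induction l with
  | nil =>
    have : C.D 1 = 0 := by simpa using C.D_algebraMap 1
    exact ⟨fun _ => this, fun n h => absurd h (Nat.succ_ne_zero n).symm⟩
  | cons a l ih =>
    obtain ⟨i, x⟩ := a
    have hD : C.D (C.word (⟨i, x⟩ :: l)) =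
        C.dGen i x * C.word l + C.sgn (C.gen i x) * C.D (C.word l) := by
      rw [word, D_mul, D_gen]
    rw [hD, sgn_gen]
    constructor
    · intro h
      have hi : i = 0 := Nat.eq_zero_of_add_eq_zero_right h
      have hl : C.wordDeg l = 0 := Nat.eq_zero_of_add_eq_zero_left h
      subst hi
      simp [dGen_zero, ih.1 hl]
    · intro n h
      have h : i + C.wordDeg l = n + 1 := h
      refine add_mem ?_ ?_
      · cases i with
        | zero => rw [dGen_zero]; simp
        | succ i =>
          have : i + C.wordDeg l = n := by omega
          rw [← this]
          exact SetLike.mul_mem_graded (C.dGen_mem_gr i x) (C.word_mem_gr l)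
      · rw [smul_mul_assoc]
        refine Submodule.smul_mem _ _ ?_
        rcases Nat.eq_zero_or_pos (C.wordDeg l) with hl | hl
        · rw [ih.1 hl]; simp
        · have := SetLike.mul_mem_graded (C.gen_mem_gr i x) (ih.2 (C.wordDeg l - 1) (by omega))
          rwa [show i + (C.wordDeg l - 1) = n by omega] at this

/-- The cobar construction `ΩC`. -/
noncomputable def cobar : DGAlgebra.{v, max v w} k where
  carrier := C.CobarAlg
  gr := C.gr
  d := C.D
  d_zero a ha := by
    have h : C.gr 0 ≤ LinearMap.ker C.D := Submodule.span_le.2 ?_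
    · exact h ha
    rintro _ ⟨l, hl, rfl⟩
    exact (C.D_word_mem_gr l).1 hl
  d_succ n a ha := by
    have h : C.gr (n + 1) ≤ (C.gr n).comap C.D := Submodule.span_le.2 ?_
    · exact h ha
    rintro _ ⟨l, hl, rfl⟩
    exact (C.D_word_mem_gr l).2 n hl
  d_d := C.D_D
  d_mul n a ha b := by
    rw [D_mul, C.sgn_of_mem ha, smul_mul_assoc]
    congr 1
    rw [Algebra.smul_def]
    simp

end ConnectedDGCoalgebra

end CubicalCobar

/-!
# Necklaces and the cobar construction

Let `S` be a simplicial set with one vertex.  A simplex `σ` of dimension `n + 1` is a necklace with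
one bead over `S`; as such it represents an `n`-cell of the cubical monoid of necklaces, its *bead*.
The isomorphism from the cobar construction to the normalized cubical chains, `ofCobar`, is the
homomorphism of algebras which sends the generator `sσ` to the class of the bead of `σ`, minus `1`
if `n = 0`.  The shift is forced by degenerate edges, which vanish in the normalized simplicial
chains but whose beads are equal to the unit of the monoid.

*Normal form of cells.* The entries of a morphism of `□_c` are constant or maxima over disjoint
blocks (`IsCubeMap.exists_blocks`), hence the morphism is determined by its values at the least
and at the greatest string as soon as these differ in as many coordinates as the source has;
otherwise it factors through a codegeneracy or a coconnection (`isCubeMap_factors_of_card_lt`). So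
a cell represented by `σ : 𝟏ⁿ ⟶ 𝟏ᴺ` over a necklace `T` depends, up to degenerate cells, only on
the two sets of vertices `J ⊆ V` of `T` which correspond to the least and the greatest string
(`PreCell.toCell_eq`).

*Injectivity.*  A function on simplices which is `1` on degenerate edges and `0` on the other
degenerate simplices of positive dimension extends to such data: cut the vertices in `V` at the
elements of `J` and multiply the values at the simplices of `S` spanned by the pieces
(`BeadWeight.word`).  This is invariant under morphisms of necklaces and multiplicative, so that it
defines a homomorphism on normalized chains (`BeadWeight.chainsHom`).  For the function which sends
`σ` to `sσ`, plus `1` in dimension one, it is a left inverse `toCobar` of `ofCobar`.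

*Surjectivity.*  The data `J ⊆ V` of a cell which is not visibly degenerate is the image of a
wedge of simplices, one for each piece, so that the cell is a product of beads
(`exists_initial_part`, `ofCobar_surjective`).

*Differentials.*  Inserting `0` in a string omits an inner vertex of the simplex and inserting `1`
turns it into a joint, so that the faces of the bead of `σ` are the beads of the inner faces of `σ`
and the products of the beads of front and last faces (`PreCell.beadFace_false`,
`PreCell.beadFace_true`).  These are the terms of `D(sσ)`, apart from the two outer faces of `σ`,
which are provided by the shifts by `1` in the products with an edge (`ofCobar_dGen_scls`).
-/

namespace CubicalCobar

open scoped TensorProduct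

/-! ### A normal form for the morphisms of the category of cubes -/

/-- The string `0…0` or `1…1`. -/
abbrev constStr (n : ℕ) (ε : Bool) : Str n := fun _ => ε

/-- The coordinates in which a map `𝟏ⁿ ⟶ 𝟏ᵐ` is not constant, when it is monotone: those with
value `0` at the least string and value `1` at the greatest one. -/
def freeCoords {n m : ℕ} (F : Str n → Str m) : Finset (Fin m) :=
  Finset.univ.filter fun i => F (constStr n true) i = true ∧ F (constStr n false) i = false

theorem mem_freeCoords {n m : ℕ} {F : Str n → Str m} {i : Fin m} : i ∈ freeCoords F ↔
    F (constStr n true) i = true ∧ F (constStr n false) i = false := by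
  simp [freeCoords]

/-- Every morphism of `□_c` sends a string `s` to the string whose `i`-th entry is the maximum of
a constant `C i` and of the entries of `s` in a block `B i`, where the blocks are disjoint and
ordered like their indices.  Unlike the criterion `CubeCriterion`, this description is visibly
closed under composition. -/
theorem IsCubeMap.exists_blocks {n m : ℕ} {F : Str n → Str m} (hF : IsCubeMap F) :
    ∃ (C : Fin m → Prop) (B : Fin m → Fin n → Prop),
      (∀ i i' j j', i < i' → B i j → B i' j' → j < j') ∧
        ∀ s i, F s i = true ↔ C i ∨ ∃ j, B i j ∧ s j = true := by
  have key : ∀ {n m : ℕ} {F : Str n → Str m}, CubeCriterion F →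
      ∃ (C : Fin m → Prop) (B : Fin m → Fin n → Prop),
        (∀ i i' j j', i < i' → B i j → B i' j' → j < j') ∧
          ∀ s i, F s i = true ↔ C i ∨ ∃ j, B i j ∧ s j = true := by
    rintro n m F ⟨L, _, g, h, C, hg, hh, hF⟩
    refine ⟨C, fun i j => g j = h i, fun i i' j j' hi hj hj' => ?_, fun s i => ?_⟩
    · exact hg.reflect_lt (hj ▸ hj' ▸ hh hi)
    · simp only [hF, and_comm]
  induction hF with
  | refl n => exact key (cubeCriterion_id n)
  | coface j ε => exact key (cubeCriterion_coface j ε)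
  | codegen j => exact key (cubeCriterion_codegen j)
  | coconn j => exact key (cubeCriterion_coconn j)
  | comp _ _ hf hg =>
    obtain ⟨C, B, hB, hf⟩ := hf
    obtain ⟨C', B', hB', hg⟩ := hg
    refine ⟨fun l => C' l ∨ ∃ i, B' l i ∧ C i, fun l j => ∃ i, B' l i ∧ B i j, ?_, fun s l => ?_⟩
    · rintro l l' j j' hl ⟨i, hi, hj⟩ ⟨i', hi', hj'⟩
      exact hB i i' j j' (hB' l l' i i' hl hi hi') hj hj'
    · rw [hg]
      simp only [hf]
      constructor
      · rintro (h | ⟨i, hi, h | ⟨j, hj, hs⟩⟩)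
        exacts [Or.inl (Or.inl h), Or.inl (Or.inr ⟨i, hi, h⟩), Or.inr ⟨j, ⟨i, hi, hj⟩, hs⟩]
      · rintro ((h | ⟨i, hi, h⟩) | ⟨j, ⟨i, hi, hj⟩, hs⟩)
        exacts [Or.inl h, Or.inr ⟨i, hi, Or.inl h⟩, Or.inr ⟨i, hi, Or.inr ⟨j, hj, hs⟩⟩]

theorem IsCubeMap.monotone {n m : ℕ} {F : Str n → Str m} (hF : IsCubeMap F) {s s' : Str n}
    (h : ∀ j, s j = true → s' j = true) (i : Fin m) (hi : F s i = true) : F s' i = true := by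
  obtain ⟨C, B, -, hF⟩ := hF.exists_blocks
  rw [hF] at hi ⊢
  exact hi.imp_right fun ⟨j, hj, hs⟩ => ⟨j, hj, h j hs⟩

section Blocks

variable {n m : ℕ} {F : Str n → Str m} {C : Fin m → Prop} {B : Fin m → Fin n → Prop}

theorem mem_freeCoords_of_blocks (hF : ∀ s i, F s i = true ↔ C i ∨ ∃ j, B i j ∧ s j = true)
    {i : Fin m} : i ∈ freeCoords F ↔ ¬ C i ∧ ∃ j, B i j := by
  rw [mem_freeCoords, hF, ← Bool.not_eq_true, hF]
  simp only [and_true, Bool.false_eq_true, and_false, exists_false, or_false]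
  tauto

theorem blocks_disjoint (hB : ∀ i i' j j', i < i' → B i j → B i' j' → j < j')
    {i i' : Fin m} {j : Fin n} (h : B i j) (h' : B i' j) : i = i' := by
  rcases lt_trichotomy i i' with hi | hi | hi
  exacts [absurd (hB _ _ _ _ hi h h') (lt_irrefl _), hi, absurd (hB _ _ _ _ hi h' h) (lt_irrefl _)]

end Blocks

/-- A morphism of `□_c` has at most as many non-constant coordinates as its source. -/
theorem IsCubeMap.card_freeCoords_le {n m : ℕ} {F : Str n → Str m} (hF : IsCubeMap F) :
    (freeCoords F).card ≤ n := by
  obtain ⟨C, B, hB, hF⟩ := hF.exists_blocks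
  choose r hr using fun i : freeCoords F => ((mem_freeCoords_of_blocks hF).1 i.2).2
  have hr' : Function.Injective r := fun i i' h =>
    Subtype.ext (blocks_disjoint hB (hr i) (h ▸ hr i'))
  simpa using Fintype.card_le_of_injective r hr'

/-- A morphism of `□_c` with as many non-constant coordinates as its source is the inclusion of a
face, so that it is determined by its values at the least and at the greatest string. -/
theorem IsCubeMap.apply_of_card {n m : ℕ} {F : Str n → Str m} (hF : IsCubeMap F)
    (h : (freeCoords F).card = n) (s : Str n) (i : Fin m) : F s i = true ↔
      F (constStr n false) i = true ∨ ∃ j, (freeCoords F).orderEmbOfFin h j = i ∧ s j = true := by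
  obtain ⟨C, B, hB, hF⟩ := hF.exists_blocks
  set o := (freeCoords F).orderEmbOfFin h
  have ho : ∀ j, o j ∈ freeCoords F := Finset.orderEmbOfFin_mem _ h
  choose φ hφ using fun j => ((mem_freeCoords_of_blocks hF).1 (ho j)).2
  have hmono : StrictMono φ := fun j j' hj => hB _ _ _ _ (o.strictMono hj) (hφ j) (hφ j')
  have hid : φ = id := (hmono.range_inj strictMono_id).1 (by
    rw [(Finite.injective_iff_surjective.1 hmono.injective).range_eq, Set.range_id])
  subst hid
  have hC : F (constStr n false) i = true ↔ C i := by simp [hF]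
  rw [hC, hF]
  refine or_congr_right' fun hi => exists_congr fun j => and_congr_left fun _ => ⟨fun hj => ?_, ?_⟩
  · exact blocks_disjoint hB (hφ j) hj
  · rintro rfl
    exact hφ j

theorem IsCubeMap.eq_of_card {n m : ℕ} {F F' : Str n → Str m} (hF : IsCubeMap F)
    (hF' : IsCubeMap F') (h0 : F (constStr n false) = F' (constStr n false))
    (h1 : F (constStr n true) = F' (constStr n true)) (h : (freeCoords F).card = n) : F = F' := by
  have e : freeCoords F' = freeCoords F := by
    ext i
    rw [mem_freeCoords, mem_freeCoords, h0, h1]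
  funext s i
  rw [Bool.eq_iff_iff, hF.apply_of_card h, hF'.apply_of_card (e ▸ h), h0]
  simp only [e]

/-- A morphism of `□_c` with fewer non-constant coordinates than its source factors through a
co-degeneracy or a co-connection. -/
theorem isCubeMap_factors_of_card_lt {n m : ℕ} {F : Str (n + 1) → Str m} (hF : IsCubeMap F)
    (h : (freeCoords F).card < n + 1) :
    (∃ j, ∀ s, F (coface j false (codegen j s)) = F s) ∨
      ∃ j : Fin n, ∀ s, F (coface j.succ false (coconn j s)) = F s := by
  obtain ⟨C, B, hB, hF⟩ := hF.exists_blocks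
  by_cases hA : ∃ j, ∀ i, B i j → C i
  · obtain ⟨j, hj⟩ := hA
    refine Or.inl ⟨j, fun s => funext fun i => ?_⟩
    rw [Bool.eq_iff_iff, hF, hF]
    refine or_congr_right' fun hi => exists_congr fun a => and_congr_right fun ha => ?_
    obtain ⟨b, rfl⟩ := Fin.exists_succAbove_eq (x := a) (y := j) (by rintro rfl; exact hi (hj i ha))
    simp [coface, codegen, Fin.removeNth]
  · -- every input matters, so two consecutive inputs belong to the same block
    push Not at hA
    choose r hr using hA
    have hmono : Monotone r := fun a b hab => by
      by_contra hlt
      exact absurd (hB _ _ _ _ (not_le.1 hlt) (hr b).1 (hr a).1) (not_lt.2 hab)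
    have hinj : ¬ StrictMono r := fun hs => by
      refine absurd (Finset.card_le_card_of_injOn (s := Finset.univ) (t := freeCoords F) r ?_
        hs.injective.injOn) (by simpa using h)
      exact fun a _ => (mem_freeCoords_of_blocks hF).2 ⟨(hr a).2, _, (hr a).1⟩
    rw [Fin.strictMono_iff_lt_succ] at hinj
    push Not at hinj
    obtain ⟨j, hj⟩ := hinj
    have hj : r j.castSucc = r j.succ := le_antisymm (hmono Fin.castSucc_lt_succ.le) hj
    have hB' : ∀ i, B i j.castSucc ↔ B i j.succ := fun i =>
      ⟨fun hi => by rw [blocks_disjoint hB hi (hr _).1, hj]; exact (hr _).1,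
        fun hi => by rw [blocks_disjoint hB hi (hr _).1, ← hj]; exact (hr _).1⟩
    have hval : ∀ s a, coface j.succ false (coconn j s) a =
        if a = j.succ then false else if a = j.castSucc then s j.castSucc || s j.succ else s a := by
      intro s a
      simp only [coface_apply, coconn_apply, Fin.ext_iff, Fin.val_succ, Fin.val_castSucc]
      split_ifs <;> first | rfl | (exfalso; omega) | (congr 2; omega) |
        (congr 2 <;> (simp only [Fin.ext_iff, Fin.val_succ, Fin.val_castSucc]; omega))
    refine Or.inr ⟨j, fun s => funext fun i => ?_⟩
    rw [Bool.eq_iff_iff, hF, hF]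
    refine or_congr_right ⟨?_, ?_⟩
    · rintro ⟨a, ha, has⟩
      rw [hval] at has
      split_ifs at has with h1 h2
      · subst h2
        rcases Bool.or_eq_true_iff.1 has with h | h
        exacts [⟨_, ha, h⟩, ⟨_, (hB' i).1 ha, h⟩]
      · exact ⟨a, ha, has⟩
    · rintro ⟨a, ha, has⟩
      by_cases h1 : a = j.succ
      · subst h1
        exact ⟨_, (hB' i).2 ha, by simp [hval, has, Fin.castSucc_lt_succ.ne]⟩
      · refine ⟨a, ha, ?_⟩
        rw [hval, if_neg h1]
        split_ifs with h2
        · subst h2; simp [has]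
        · exact has

/-! ### The vertex sets attached to a cell -/

namespace Necklace

theorem mem_ofStr_freeVertex (T : Necklace.{u}) (s : Str T.dim) (i : Fin T.dim) :
    T.freeVertex i ∈ T.ofStr s ↔ s i = true := by
  simp [ofStr, freeVertex_notMem]

theorem toStr_eq_true (T : Necklace.{u}) (X : Finset (Fin (T.last + 1))) (i : Fin T.dim) :
    T.toStr X i = true ↔ T.freeVertex i ∈ X := by
  simp [toStr]

theorem ofStr_injective (T : Necklace.{u}) : Function.Injective T.ofStr :=
  Function.LeftInverse.injective T.toStr_ofStr

theorem ofStr_strMap {T U : Necklace.{u}} (f : T ⟶ U) (s : Str T.dim) :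
    U.ofStr (strMap f s) = (T.ofStr s).image (vert f.1) :=
  U.ofStr_toStr ((joints_subset_image f).trans (Finset.image_subset_image (T.joints_subset_ofStr s)))

end Necklace

namespace PreCell

variable {S : SSet.{u}} {x y z : Vertices S} {n m : ℕ}

/-- The map `𝟏ⁿ ⟶ P_𝟏(T)` of a representative `(T ⟶ S, 𝟏ⁿ ⟶ P_𝟏(T))` of a cell. -/
def strs (a : PreCell S x y ⟨n⟩) : Str n → Str a.obj.nec.dim := a.cell.1

theorem isCubeMap_strs (a : PreCell S x y ⟨n⟩) : IsCubeMap a.strs := a.cell.2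

/-- For a cell `σ : 𝟏ⁿ ⟶ P_𝟏(T)`, the set `X` with `J_T ⊆ X ⊆ V_T` given by the value of `σ` at the
constant string `ε`.  The value at `0…0` is the set of joints, and that at `1…1` the set of
vertices, of the subnecklace of `T` which corresponds to the face spanned by `σ`. -/
def bound (ε : Bool) (a : PreCell S x y ⟨n⟩) : Finset (Fin (a.obj.nec.last + 1)) :=
  a.obj.nec.ofStr (a.strs (constStr n ε))

/-- The joints of the subnecklace spanned by a cell. -/
abbrev low (a : PreCell S x y ⟨n⟩) : Finset (Fin (a.obj.nec.last + 1)) := a.bound false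

/-- The vertices of the subnecklace spanned by a cell. -/
abbrev high (a : PreCell S x y ⟨n⟩) : Finset (Fin (a.obj.nec.last + 1)) := a.bound true

theorem joints_subset_bound (ε : Bool) (a : PreCell S x y ⟨n⟩) : a.obj.nec.joints ⊆ a.bound ε :=
  a.obj.nec.joints_subset_ofStr _

theorem zero_mem_bound (ε : Bool) (a : PreCell S x y ⟨n⟩) : 0 ∈ a.bound ε :=
  a.joints_subset_bound ε a.obj.nec.zero_mem

theorem last_mem_bound (ε : Bool) (a : PreCell S x y ⟨n⟩) : Fin.last _ ∈ a.bound ε :=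
  a.joints_subset_bound ε a.obj.nec.last_mem

theorem high_sdiff_low (a : PreCell S x y ⟨n⟩) :
    a.high \ a.low = (freeCoords a.strs).map a.obj.nec.freeVertex.toEmbedding := by
  ext v
  rw [Finset.mem_sdiff, Finset.mem_map]
  constructor
  · rintro ⟨h1, h0⟩
    have hv : v ∉ a.obj.nec.joints := fun h => h0 (a.joints_subset_bound _ h)
    obtain ⟨i, rfl⟩ := a.obj.nec.exists_freeVertex hv
    refine ⟨i, mem_freeCoords.2 ⟨(a.obj.nec.mem_ofStr_freeVertex _ i).1 h1, ?_⟩, rfl⟩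
    exact Bool.eq_false_iff.2 fun h => h0 ((a.obj.nec.mem_ofStr_freeVertex _ i).2 h)
  · rintro ⟨i, hi, rfl⟩
    obtain ⟨h1, h0⟩ := mem_freeCoords.1 hi
    exact ⟨(a.obj.nec.mem_ofStr_freeVertex _ i).2 h1, fun h =>
      Bool.eq_false_iff.1 h0 ((a.obj.nec.mem_ofStr_freeVertex _ i).1 h)⟩

theorem card_high_sdiff_low (a : PreCell S x y ⟨n⟩) :
    (a.high \ a.low).card = (freeCoords a.strs).card := by
  rw [high_sdiff_low, Finset.card_map]

theorem card_high_sdiff_low_le (a : PreCell S x y ⟨n⟩) : (a.high \ a.low).card ≤ n := by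
  rw [card_high_sdiff_low]
  exact a.isCubeMap_strs.card_freeCoords_le

theorem low_subset_high (a : PreCell S x y ⟨n⟩) : a.low ⊆ a.high := by
  intro v hv
  by_cases hvj : v ∈ a.obj.nec.joints
  · exact a.joints_subset_bound _ hvj
  · obtain ⟨i, rfl⟩ := a.obj.nec.exists_freeVertex hvj
    rw [low, bound, Necklace.mem_ofStr_freeVertex] at hv
    rw [high, bound, Necklace.mem_ofStr_freeVertex]
    exact a.isCubeMap_strs.monotone (fun _ _ => rfl) i hv

theorem bound_mul (ε : Bool) (a : PreCell S x y ⟨n⟩) (b : PreCell S y z ⟨m⟩) :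
    (a.mul b).bound ε = Necklace.unionSet a.obj.nec b.obj.nec (a.bound ε) (b.bound ε) :=
  Necklace.ofStr_unionStr a.obj.nec b.obj.nec _ _

theorem Rel.bound_eq {a b : PreCell S x y ⟨n⟩} (f : a.obj.Hom b.obj)
    (hf : a.cell ≫ Necklace.toCube.map f.hom = b.cell) (ε : Bool) :
    b.bound ε = (a.bound ε).image (Necklace.vert f.hom.1) := by
  have h : Necklace.strMap f.hom (a.strs (constStr n ε)) = b.strs (constStr n ε) :=
    congrArg (fun c => c.1 (constStr n ε)) hf
  exact (congrArg b.obj.nec.ofStr h.symm).trans (Necklace.ofStr_strMap f.hom _)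

variable {x : Vertices S}

/-- The cell of the endomorphism monoid of `x` represented by `a`. -/
noncomputable def toCell (a : PreCell S x x ⟨n⟩) : (endMonoid S x).Cell :=
  CubicalMonoid.cell (M := endMonoid S x) (Quot.mk _ a)

theorem toCell_mul (a : PreCell S x x ⟨n⟩) (b : PreCell S x x ⟨m⟩) :
    (a.mul b).toCell = a.toCell * b.toCell := rfl

/-- A representative of a cell which spans a face of full dimension is determined, up to morphisms
of necklaces over `S`, by the joints and the vertices of the subnecklace it spans. -/
theorem toCell_eq (a : PreCell S x x ⟨n⟩) (b : PreCell S x x ⟨m⟩) (f : a.obj.Hom b.obj)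
    (hnm : n = m) (h : ∀ ε, (a.bound ε).image (Necklace.vert f.hom.1) = b.bound ε)
    (hb : (b.high \ b.low).card = m) : a.toCell = b.toCell := by
  subst hnm
  refine congrArg (CubicalMonoid.cell (M := endMonoid S x)) (Quot.sound ⟨f, ?_⟩)
  have e : ∀ ε, (a.cell ≫ Necklace.toCube.map f.hom).1 (constStr n ε) = b.cell.1 (constStr n ε) :=
    fun ε => b.obj.nec.ofStr_injective ((Necklace.ofStr_strMap f.hom _).trans (h ε))
  refine Subtype.ext (IsCubeMap.eq_of_card b.isCubeMap_strs (a.cell ≫ _).2 (e false).symm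
    (e true).symm (b.card_high_sdiff_low.symm.trans hb)).symm

theorem toCell_eq_of_injective (a : PreCell S x x ⟨n⟩) (b : PreCell S x x ⟨m⟩)
    (f : a.obj.Hom b.obj) (hf : Function.Injective (Necklace.vert f.hom.1)) (hnm : n = m)
    (h : ∀ ε, (a.bound ε).image (Necklace.vert f.hom.1) = b.bound ε)
    (ha : (a.high \ a.low).card = n) : a.toCell = b.toCell := by
  refine toCell_eq a b f hnm h ?_
  rw [high, low, ← h, ← h, ← Finset.image_sdiff_of_injOn hf.injOn a.low_subset_high,
    Finset.card_image_of_injective _ hf, ha, hnm]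

theorem toCell_mem_degenerate (a : PreCell S x x ⟨n⟩) (ha : (a.high \ a.low).card < n) :
    a.toCell ∈ (endMonoid S x).degenerate := by
  obtain _ | n := n
  · simp at ha
  rw [card_high_sdiff_low] at ha
  obtain ⟨j, hj⟩ | ⟨j, hj⟩ := isCubeMap_factors_of_card_lt a.isCubeMap_strs ha
  · refine Or.inl ⟨n, j, Quot.mk _ ⟨a.obj, Cube.ofMap _ (IsCubeMap.coface j false) ≫ a.cell⟩, ?_⟩
    refine congrArg (fun c => CubicalMonoid.cell (M := endMonoid S x) (Quot.mk _ ⟨a.obj, c⟩)) ?_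
    exact Cube.hom_ext fun s => (hj s).symm
  · refine Or.inr ⟨n, j, Quot.mk _ ⟨a.obj, Cube.ofMap _ (IsCubeMap.coface j.succ false) ≫ a.cell⟩,
      ?_⟩
    refine congrArg (fun c => CubicalMonoid.cell (M := endMonoid S x) (Quot.mk _ ⟨a.obj, c⟩)) ?_
    exact Cube.hom_ext fun s => (hj s).symm

end PreCell

/-! ### Simplices as necklaces with one bead -/

namespace Necklace

/-- The necklace `Δᵈ`, with one bead if `d` is positive. -/
def ofSimplex (d : ℕ) : Necklace.{u} where
  last := d
  joints := {0, Fin.last d}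
  zero_mem := Finset.mem_insert_self _ _
  last_mem := Finset.mem_insert_of_mem (Finset.mem_singleton_self _)

/-- A simplex of `Δᵈ`, as a morphism of the simplex category. -/
def simplexHom {d : ℕ} {m : SimplexCategoryᵒᵖ} (τ : (ofSimplex.{u} d).toSSet.obj m) :
    m.unop ⟶ SimplexCategory.mk d :=
  SimplexCategory.Hom.mk ((ofSimplex d).pt τ)

/-- The map `Δᵈ ⟶ S` given by a `d`-simplex of `S`. -/
def simplexMap {S : SSet.{u}} {d : ℕ} (σ : Simp S d) : (ofSimplex.{u} d).toSSet ⟶ S where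
  app m := ↾fun τ => S.map (simplexHom τ).op σ
  naturality m m' θ := by
    ext τ
    change S.map _ σ = S.map θ (S.map _ σ)
    rw [← Functor.map_comp_apply]
    rfl

theorem simplexMap_comp {S S' : SSet.{u}} {d : ℕ} (σ : Simp S d) (f : S ⟶ S') :
    simplexMap σ ≫ f = simplexMap (f.app _ σ) :=
  NatTrans.ext (funext fun _ => ConcreteCategory.hom_ext _ _ fun _ =>
    NatTrans.naturality_apply f _ σ)

end Necklace

section OneVertex

variable {S : SSet.{u}} {x : Vertices S} (hS : ∀ y : Vertices S, y = x)

/-- A simplex of a simplicial set with one vertex, as a necklace over it. -/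
def NecklaceIn.ofSimplex {d : ℕ} (σ : Simp S d) : NecklaceIn S x x :=
  ⟨Necklace.ofSimplex d, Necklace.simplexMap σ, hS _, hS _⟩

namespace PreCell

/-- The set of vertices of `Δⁿ⁺¹` which consists of the first and the last vertex and of the inner
vertices given by a string. -/
def beadSet {n : ℕ} (s : Str n) : Finset (Fin (n + 2)) :=
  {0, Fin.last _} ∪ (Finset.univ.filter fun j => s j = true).image fun j => j.succ.castSucc

theorem isCubeMap_bead (n : ℕ) : IsCubeMap fun s : Str n =>
    (Necklace.ofSimplex.{u} (n + 1)).toStr (beadSet s) := by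
  refine isCubeMap_of_monotone _ rfl _ (fun j : Fin n => (j.succ.castSucc : Fin (n + 2)))
    (Necklace.ofSimplex (n + 1)).freeVertex (fun _ => False) ?_
    (Necklace.ofSimplex (n + 1)).freeVertex.strictMono fun s i => ?_
  · exact fun a b h => Fin.castSucc_le_castSucc_iff.2 (Fin.succ_le_succ_iff.2 h)
  · rw [false_or]
    refine (Necklace.toStr_eq_true _ _ _).trans ?_
    refine Finset.mem_union.trans ((or_iff_right
      ((Necklace.ofSimplex (n + 1)).freeVertex_notMem i)).trans ?_)
    refine Finset.mem_image.trans (exists_congr fun j => and_congr_left fun _ => ?_)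
    simp

/-- The `n`-cell represented by an `(n + 1)`-simplex of a simplicial set with one vertex. -/
def bead {n : ℕ} (σ : Simp S (n + 1)) : PreCell S x x ⟨n⟩ :=
  ⟨NecklaceIn.ofSimplex hS σ, Cube.ofMap _ (isCubeMap_bead n)⟩

theorem ofStr_strs_bead {n : ℕ} (σ : Simp S (n + 1)) (s : Str n) :
    (bead hS σ).obj.nec.ofStr ((bead hS σ).strs s) = beadSet s :=
  (Necklace.ofSimplex (n + 1)).ofStr_toStr (X := beadSet s) Finset.subset_union_left

theorem mem_beadSet {n : ℕ} {s : Str n} {v : Fin (n + 2)} : v ∈ beadSet s ↔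
    v = 0 ∨ v = Fin.last _ ∨ ∃ j, s j = true ∧ j.succ.castSucc = v := by
  simp only [beadSet, Finset.mem_union, Finset.mem_image, Finset.mem_filter, Finset.mem_univ,
    true_and, Finset.mem_insert, Finset.mem_singleton, or_assoc]

theorem eq_zero_or_last_or_inner {n : ℕ} (v : Fin (n + 2)) :
    v = 0 ∨ v = Fin.last _ ∨ ∃ j : Fin n, j.succ.castSucc = v := by
  rcases Fin.eq_castSucc_or_eq_last v with ⟨w, rfl⟩ | rfl
  · rcases Fin.eq_zero_or_eq_succ w with rfl | ⟨w, rfl⟩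
    · exact Or.inl rfl
    · exact Or.inr (Or.inr ⟨w, rfl⟩)
  · exact Or.inr (Or.inl rfl)

theorem bound_bead {n : ℕ} (ε : Bool) (σ : Simp S (n + 1)) : (bead hS σ).bound ε =
    if ε then Finset.univ else ({0, Fin.last _} : Finset (Fin (n + 1 + 1))) := by
  refine (ofStr_strs_bead hS σ _).trans ?_
  ext v
  rw [mem_beadSet]
  cases ε
  · simp
  · simpa using eq_zero_or_last_or_inner v

theorem card_bead {n : ℕ} (σ : Simp S (n + 1)) :
    ((bead hS σ).high \ (bead hS σ).low).card = n := by
  rw [high, low, bound_bead, bound_bead]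
  change (Finset.univ \ ({0, Fin.last _} : Finset (Fin (n + 1 + 1)))).card = n
  rw [← Finset.compl_eq_univ_sdiff, Finset.card_compl, Finset.card_pair (by simp [Fin.ext_iff])]
  simp

end PreCell

end OneVertex

/-! ### Functions on simplices which extend to necklaces -/

/-- The part of `V` between `p` and `v`. -/
abbrev between {N : ℕ} (V : Finset (Fin N)) (p v : Fin N) : Finset (Fin N) :=
  V.filter fun r => p ≤ r ∧ r ≤ v

/-- The joint `p` immediately precedes the vertex `v`. -/
def IsPrev {N : ℕ} (J : Finset (Fin N)) (p v : Fin N) : Prop :=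
  p ∈ J ∧ p < v ∧ ∀ q ∈ J, q < v → q ≤ p

theorem exists_isPrev {N : ℕ} {J : Finset (Fin (N + 1))} (h0 : 0 ∈ J)
    {v : Fin (N + 1)} (hv : v ≠ 0) : ∃ p, IsPrev J p v := by
  have h : (J.filter (· < v)).Nonempty := ⟨0, Finset.mem_filter.2 ⟨h0, Fin.pos_of_ne_zero hv⟩⟩
  obtain ⟨h1, h2⟩ := Finset.mem_filter.1 ((J.filter (· < v)).max'_mem h)
  exact ⟨_, h1, h2, fun q hq hqv => Finset.le_max' _ q (Finset.mem_filter.2 ⟨hq, hqv⟩)⟩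

theorem IsPrev.unique {N : ℕ} {J : Finset (Fin N)} {p q v : Fin N}
    (hp : IsPrev J p v) (hq : IsPrev J q v) : p = q :=
  le_antisymm (hq.2.2 p hp.1 hp.2.1) (hp.2.2 q hq.1 hq.2.1)

/-- The functions on the simplices of `S`, with values in a monoid with zero, which give rise to a
function on necklaces over `S` by taking products over the beads: a bead which collapses to a point
contributes the factor `1`, and a degenerate bead of dimension at least `2` the factor `0`. -/
structure BeadWeight (S : SSet.{u}) (M : Type w) [MonoidWithZero M] where
  /-- the value at a simplex -/
  val : ∀ {d : ℕ}, Simp S d → M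
  val_degenerate_one : ∀ σ ∈ S.degenerate 1, val σ = 1
  val_degenerate : ∀ d, ∀ σ ∈ S.degenerate (d + 2), val σ = 0

namespace Necklace

/-- The vertices in `A` belong to a common bead of `T`. -/
def Spans (T : Necklace.{u}) (A : Finset (Fin (T.last + 1))) : Prop :=
  ∀ j ∈ T.joints, (∀ a ∈ A, a ≤ j) ∨ ∀ a ∈ A, j ≤ a

/-- A simplex of a necklace with two equal vertices is sent to a degenerate simplex by every map. -/
theorem app_mem_degenerate {T : Necklace.{u}} {S : SSet.{u}} (t : T.toSSet ⟶ S) {d : ℕ}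
    (τ : Simp T.toSSet d) (h : ¬ Function.Injective (T.pt τ)) :
    t.app _ τ ∈ S.degenerate d := by
  obtain _ | d := d
  · exact (h (Function.injective_of_subsingleton (α := Fin 1) _)).elim
  have h' : ¬ StrictMono (T.pt τ) := fun hs => h hs.injective
  rw [Fin.strictMono_iff_lt_succ] at h'
  push Not at h'
  obtain ⟨i, hi⟩ := h'
  have hi : T.pt τ i.castSucc = T.pt τ i.succ :=
    le_antisymm ((T.pt τ).monotone Fin.castSucc_lt_succ.le) hi
  have e : τ = T.toSSet.σ i (T.toSSet.δ i.succ τ) := T.pt_ext fun a => by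
    change T.pt τ a = T.pt τ (i.succ.succAbove (i.predAbove a))
    by_cases ha : a = i.succ
    · subst ha
      rw [Fin.predAbove_succ_self, Fin.succAbove_succ_self, hi]
    · exact congrArg _ (Fin.succ_succAbove_predAbove ha).symm
  rw [e]
  have := NatTrans.naturality_apply t (SimplexCategory.σ i).op (T.toSSet.δ i.succ τ)
  exact Set.mem_of_eq_of_mem this (S.σ_mem_degenerate i _)

theorem Spans.exists_simplex {T : Necklace.{u}} {A : Finset (Fin (T.last + 1))} (hA : T.Spans A)
    (hne : A.Nonempty) : ∃ (d : ℕ) (τ : Simp T.toSSet d), d + 1 = A.card ∧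
      StrictMono (T.pt τ) ∧ Finset.univ.image (T.pt τ) = A := by
  obtain ⟨d, hd⟩ : ∃ d, A.card = d + 1 := ⟨A.card - 1, by have := hne.card_pos; omega⟩
  have hm := Finset.orderEmbOfFin_mem A hd
  refine ⟨d, T.simplex (A.orderEmbOfFin hd).toOrderHom fun j hj => ?_, hd.symm,
    (A.orderEmbOfFin hd).strictMono, ?_⟩
  · exact (hA j hj).imp (fun h a => h _ (hm a)) (fun h a => h _ (hm a))
  · exact Finset.image_orderEmbOfFin_univ A hd

theorem simplex_ext_of_image {T : Necklace.{u}} {d : ℕ} {τ τ' : Simp T.toSSet d}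
    (h : StrictMono (T.pt τ)) (h' : StrictMono (T.pt τ'))
    (e : Finset.univ.image (T.pt τ) = Finset.univ.image (T.pt τ')) : τ = τ' := by
  refine T.pt_ext fun a => congrFun ((h.range_inj h').1 ?_) a
  have := congrArg (fun A : Finset (Fin (T.last + 1)) => (A : Set (Fin (T.last + 1)))) e
  simpa using this

end Necklace

namespace BeadWeight

variable {S : SSet.{u}} {M : Type w} [MonoidWithZero M] (g : BeadWeight S M)

open Necklace

open Classical in
/-- The value at the simplex of `S` which is the image of the simplex of `T` spanned by a set of
vertices of a common bead. -/
noncomputable def weight {T : Necklace.{u}} (t : T.toSSet ⟶ S) (A : Finset (Fin (T.last + 1))) : M :=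
  if h : A.Nonempty ∧ T.Spans A then
    g.val (t.app _ (h.2.exists_simplex h.1).choose_spec.choose) else 0

theorem weight_eq {T : Necklace.{u}} (t : T.toSSet ⟶ S) {A : Finset (Fin (T.last + 1))} {d : ℕ}
    (τ : Simp T.toSSet d) (hτ : StrictMono (T.pt τ)) (hA : Finset.univ.image (T.pt τ) = A) :
    g.weight t A = g.val (t.app _ τ) := by
  have hcard : A.card = d + 1 := by
    rw [← hA, Finset.card_image_of_injective _ hτ.injective]
    exact Finset.card_fin (d + 1)
  have hne : A.Nonempty := Finset.card_pos.1 (by omega)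
  have hspan : T.Spans A := fun j hj => by
    rw [← hA]
    refine (T.pt_joint τ hj).imp (fun h a ha => ?_) (fun h a ha => ?_) <;>
    · obtain ⟨b, -, rfl⟩ := Finset.mem_image.1 ha
      exact h b
  rw [weight, dif_pos ⟨hne, hspan⟩]
  obtain ⟨h1, h2, h3⟩ := (hspan.exists_simplex hne).choose_spec.choose_spec
  generalize (hspan.exists_simplex hne).choose_spec.choose = τ' at *
  generalize (hspan.exists_simplex hne).choose = d' at *
  obtain rfl : d' = d := by omega
  rw [simplex_ext_of_image h2 hτ (h3.trans hA.symm)]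

section Map

variable {T U : Necklace.{u}} (f : T.toSSet ⟶ U.toSSet) (r : U.toSSet ⟶ S)
  {A : Finset (Fin (T.last + 1))}

theorem weight_image (hA : T.Spans A) (hne : A.Nonempty) (hf : Set.InjOn (vert f) A) :
    g.weight r (A.image (vert f)) = g.weight (f ≫ r) A := by
  obtain ⟨d, τ, -, hτ, rfl⟩ := hA.exists_simplex hne
  rw [g.weight_eq _ τ hτ rfl, g.weight_eq r (f.app _ τ)]
  · rfl
  · have hpt : ∀ a, U.pt (f.app _ τ) a = vert f (T.pt τ a) := pt_app f τ
    refine (U.pt _).monotone.strictMono_of_injective fun a b hab => hτ.injective ?_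
    rw [hpt, hpt] at hab
    exact hf (by simp) (by simp) hab
  · rw [Finset.image_image]
    exact Finset.image_congr fun a _ => pt_app f τ a

theorem weight_eq_zero (hA : T.Spans A) (hcard : 3 ≤ A.card) (hf : ¬ Set.InjOn (vert f) A) :
    g.weight (f ≫ r) A = 0 := by
  obtain ⟨d, τ, hd, hτ, rfl⟩ := hA.exists_simplex (Finset.card_pos.1 (by omega))
  obtain ⟨d, rfl⟩ : ∃ e, d = e + 2 := ⟨d - 2, by omega⟩
  rw [g.weight_eq _ τ hτ rfl]
  refine g.val_degenerate _ _ (app_mem_degenerate r (f.app _ τ) fun hinj => hf ?_)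
  intro a ha b hb hab
  obtain ⟨a, rfl⟩ : ∃ a', T.pt τ a' = a := by simpa using ha
  obtain ⟨b, rfl⟩ : ∃ b', T.pt τ b' = b := by simpa using hb
  rw [← pt_app, ← pt_app] at hab
  rw [hinj hab]

theorem weight_eq_one (hA : T.Spans A) (hcard : A.card = 2) (hf : ¬ Set.InjOn (vert f) A) :
    g.weight (f ≫ r) A = 1 := by
  obtain ⟨d, τ, hd, hτ, rfl⟩ := hA.exists_simplex (Finset.card_pos.1 (by omega))
  obtain rfl : d = 1 := by omega
  rw [g.weight_eq _ τ hτ rfl]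
  refine g.val_degenerate_one _ (app_mem_degenerate r (f.app _ τ) fun hinj => hf ?_)
  intro a ha b hb hab
  obtain ⟨a, rfl⟩ : ∃ a', T.pt τ a' = a := by simpa using ha
  obtain ⟨b, rfl⟩ : ∃ b', T.pt τ b' = b := by simpa using hb
  rw [← pt_app, ← pt_app] at hab
  rw [hinj hab]

end Map

open Classical in
/-- For the subnecklace of `T` with joints `J` and vertices `V`, the product of the values at the
beads between the first vertex and the vertex `v`. -/
noncomputable def word {T : Necklace.{u}} (t : T.toSSet ⟶ S) (J V : Finset (Fin (T.last + 1)))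
    (v : Fin (T.last + 1)) : M :=
  if h : ∃ p, IsPrev J p v then word t J V h.choose * g.weight t (between V h.choose v) else 1
termination_by v
decreasing_by exact h.choose_spec.2.1

variable {T : Necklace.{u}} {t : T.toSSet ⟶ S} {J V : Finset (Fin (T.last + 1))}

theorem word_zero : g.word t J V 0 = 1 := by
  rw [word, dif_neg]
  rintro ⟨p, -, hp, -⟩
  exact absurd hp (Fin.not_lt_zero p)

theorem word_of_isPrev {p v : Fin (T.last + 1)} (h : IsPrev J p v) :
    g.word t J V v = g.word t J V p * g.weight t (between V p v) := by
  have h' : ∃ p, IsPrev J p v := ⟨p, h⟩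
  rw [word, dif_pos h', h'.choose_spec.unique h]

theorem spans_between (hJ : T.joints ⊆ J) {p v : Fin (T.last + 1)} (h : IsPrev J p v) :
    T.Spans (between V p v) := by
  intro j hj
  rcases lt_or_ge j v with hjv | hjv
  · exact Or.inr fun a ha => (h.2.2 j (hJ hj) hjv).trans (Finset.mem_filter.1 ha).2.1
  · exact Or.inl fun a ha => (Finset.mem_filter.1 ha).2.2.trans hjv

/-- Along a map of necklaces the words agree up to a factor if this holds bead by bead. -/
theorem word_map {U : Necklace.{u}} {r : U.toSSet ⟶ S} {J' V' : Finset (Fin (U.last + 1))}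
    (φ : Fin (T.last + 1) → Fin (U.last + 1)) (h0 : 0 ∈ J)
    (h : ∀ p v, v ∈ J → IsPrev J p v →
      g.word r J' V' (φ v) = g.word r J' V' (φ p) * g.weight t (between V p v))
    (v : Fin (T.last + 1)) (hv : v ∈ J) :
    g.word r J' V' (φ v) = g.word r J' V' (φ 0) * g.word t J V v := by
  induction v using WellFoundedLT.induction with
  | ind v ih =>
    by_cases hv0 : v = 0
    · subst hv0
      rw [word_zero, mul_one]
    · obtain ⟨p, hp⟩ := exists_isPrev h0 hv0
      rw [h p v hv hp, ih p hp.2.1 hp.1, g.word_of_isPrev hp, mul_assoc]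

theorem word_eq_zero (h0 : 0 ∈ J) {p q v : Fin (T.last + 1)} (hpq : IsPrev J p q)
    (hw : g.weight t (between V p q) = 0) (hq : q ∈ J) (hqv : q ≤ v) : g.word t J V v = 0 := by
  induction v using WellFoundedLT.induction with
  | ind v ih =>
    rcases hqv.eq_or_lt with rfl | hqv
    · rw [g.word_of_isPrev hpq, hw, mul_zero]
    · obtain ⟨p', hp'⟩ := exists_isPrev h0 (Fin.ne_zero_of_lt hqv)
      rw [g.word_of_isPrev hp', ih p' hp'.2.1 (hp'.2.2 q hq hqv), zero_mul]

end BeadWeight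

/-! ### Words of wedges and of morphisms of necklaces -/

namespace Necklace

theorem mem_unionSet {T U : Necklace.{u}} {X : Finset (Fin (T.last + 1))}
    {Y : Finset (Fin (U.last + 1))} {v : Fin ((wedge T U).last + 1)} : v ∈ unionSet T U X Y ↔
      (∃ a ∈ X, inlV T U a = v) ∨ ∃ b ∈ Y, inrV T U b = v := by
  simp only [unionSet, Finset.mem_union, Finset.mem_image]

theorem inlV_injective {T U : Necklace.{u}} : Function.Injective (inlV T U) :=
  fun _ _ h => Fin.ext (congrArg Fin.val h :)

theorem inrV_injective {T U : Necklace.{u}} : Function.Injective (inrV T U) :=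
  fun _ _ h => Fin.ext (Nat.add_left_cancel (congrArg Fin.val h :))

theorem inrV_lt {T U : Necklace.{u}} {a b : Fin (U.last + 1)} :
    inrV T U a < inrV T U b ↔ a < b := by
  change T.last + a.1 < T.last + b.1 ↔ a.1 < b.1
  omega

theorem inrV_le {T U : Necklace.{u}} {a b : Fin (U.last + 1)} :
    inrV T U a ≤ inrV T U b ↔ a ≤ b := by
  change T.last + a.1 ≤ T.last + b.1 ↔ a.1 ≤ b.1
  omega

theorem inlV_le_inrV {T U : Necklace.{u}} (a : Fin (T.last + 1)) (b : Fin (U.last + 1)) :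
    inlV T U a ≤ inrV T U b := by
  change a.1 ≤ T.last + b.1
  omega

theorem inrV_le_inlV {T U : Necklace.{u}} {a : Fin (T.last + 1)} {b : Fin (U.last + 1)}
    (h : inrV T U b ≤ inlV T U a) : a = Fin.last _ ∧ b = 0 := by
  change T.last + b.1 ≤ a.1 at h
  have := a.2
  exact ⟨Fin.ext (by change a.1 = T.last; omega), Fin.ext (by change b.1 = 0; omega)⟩

theorem unionSet_sdiff {T U : Necklace.{u}} {X X' : Finset (Fin (T.last + 1))}
    {Y Y' : Finset (Fin (U.last + 1))} (hX : Fin.last _ ∈ X') (hY : 0 ∈ Y') :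
    unionSet T U X Y \ unionSet T U X' Y' =
      (X \ X').image (inlV T U) ∪ (Y \ Y').image (inrV T U) := by
  ext v
  simp only [Finset.mem_sdiff, mem_unionSet, Finset.mem_union, Finset.mem_image]
  constructor
  · rintro ⟨⟨a, ha, rfl⟩ | ⟨b, hb, rfl⟩, h⟩
    · exact Or.inl ⟨a, ⟨ha, fun h' => h (Or.inl ⟨a, h', rfl⟩)⟩, rfl⟩
    · exact Or.inr ⟨b, ⟨hb, fun h' => h (Or.inr ⟨b, h', rfl⟩)⟩, rfl⟩
  · rintro (⟨a, ⟨ha, ha'⟩, rfl⟩ | ⟨b, ⟨hb, hb'⟩, rfl⟩)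
    · refine ⟨Or.inl ⟨a, ha, rfl⟩, ?_⟩
      rintro (⟨c, hc, h⟩ | ⟨c, hc, h⟩)
      · exact ha' (inlV_injective h ▸ hc)
      · exact ha' ((inrV_le_inlV h.le).1 ▸ hX)
    · refine ⟨Or.inr ⟨b, hb, rfl⟩, ?_⟩
      rintro (⟨c, hc, h⟩ | ⟨c, hc, h⟩)
      · exact hb' ((inrV_le_inlV h.ge).2 ▸ hY)
      · exact hb' (inrV_injective h ▸ hc)

theorem card_unionSet_sdiff {T U : Necklace.{u}} {X X' : Finset (Fin (T.last + 1))}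
    {Y Y' : Finset (Fin (U.last + 1))} (hX : Fin.last _ ∈ X') (hY : 0 ∈ Y') :
    (unionSet T U X Y \ unionSet T U X' Y').card = (X \ X').card + (Y \ Y').card := by
  rw [unionSet_sdiff hX hY, Finset.card_union_of_disjoint,
    Finset.card_image_of_injective _ inlV_injective, Finset.card_image_of_injective _ inrV_injective]
  rw [Finset.disjoint_left]
  rintro v hv hv'
  obtain ⟨a, ha, rfl⟩ := Finset.mem_image.1 hv
  obtain ⟨b, hb, h⟩ := Finset.mem_image.1 hv'
  exact (Finset.mem_sdiff.1 hb).2 ((inrV_le_inlV h.le).2 ▸ hY)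

end Necklace

namespace BeadWeight

variable {S : SSet.{u}} {M : Type w} [MonoidWithZero M] (g : BeadWeight S M)

open Necklace

/-- If a bead of a subnecklace is mapped bijectively onto a bead, then the last factor of the word of
the image is the value at the bead. -/
theorem word_step {T U : Necklace.{u}} (f : T.toSSet ⟶ U.toSSet) (r : U.toSSet ⟶ S)
    {J V : Finset (Fin (T.last + 1))} {J' V' : Finset (Fin (U.last + 1))} (hJ : T.joints ⊆ J)
    (hJV : J ⊆ V) {p v : Fin (T.last + 1)} (hp : IsPrev J p v)
    (hf : Set.InjOn (vert f) (between V p v)) (hp' : IsPrev J' (vert f p) (vert f v))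
    (hV : between V' (vert f p) (vert f v) = (between V p v).image (vert f)) :
    g.word r J' V' (vert f v) = g.word r J' V' (vert f p) * g.weight (f ≫ r) (between V p v) := by
  rw [g.word_of_isPrev hp', hV, g.weight_image f r (spans_between hJ hp) _ hf]
  exact ⟨p, Finset.mem_filter.2 ⟨hJV hp.1, le_rfl, hp.2.1.le⟩⟩

section Wedge

variable {x y z : Vertices S} (t : NecklaceIn S x y) (r : NecklaceIn S y z)
  {J V : Finset (Fin (t.nec.last + 1))} {J' V' : Finset (Fin (r.nec.last + 1))}

theorem word_inlV (hJ : t.nec.joints ⊆ J) (hJV : J ⊆ V) {v : Fin (t.nec.last + 1)} (hv : v ∈ J) :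
    g.word (t.wedge r).map (unionSet t.nec r.nec J J') (unionSet t.nec r.nec V V')
      (inlV t.nec r.nec v) = g.word t.map J V v := by
  refine (g.word_map (t := t.map) (V := V) (inlV t.nec r.nec) (hJ t.nec.zero_mem)
    (fun p v hv hp => ?_) v hv).trans ?_
  · rw [← NecklaceIn.inl_wedge t r]
    refine g.word_step (inl t.nec r.nec) (t.wedge r).map hJ hJV hp inlV_injective.injOn ?_ ?_
    · refine ⟨mem_unionSet.2 (Or.inl ⟨p, hp.1, rfl⟩), hp.2.1, fun q hq hqv => ?_⟩
      obtain ⟨a, ha, rfl⟩ | ⟨b, hb, rfl⟩ := mem_unionSet.1 hq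
      · exact hp.2.2 a ha hqv
      · exact absurd hqv (not_lt.2 (inlV_le_inrV v b))
    · ext w
      simp only [Finset.mem_filter, mem_unionSet, Finset.mem_image, vert_inl]
      constructor
      · rintro ⟨⟨a, ha, rfl⟩ | ⟨b, hb, rfl⟩, h1, h2⟩
        · exact ⟨a, ⟨ha, h1, h2⟩, rfl⟩
        · obtain ⟨rfl, rfl⟩ := inrV_le_inlV h2
          exact ⟨_, ⟨hJV hv, hp.2.1.le, le_rfl⟩, rfl⟩
      · rintro ⟨a, ⟨ha, h1, h2⟩, rfl⟩
        exact ⟨Or.inl ⟨a, ha, rfl⟩, h1, h2⟩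
  · exact (congrArg (· * _) g.word_zero).trans (one_mul _)

theorem word_wedge (hJ : t.nec.joints ⊆ J) (hJV : J ⊆ V) (hJ' : r.nec.joints ⊆ J')
    (hJV' : J' ⊆ V') :
    g.word (t.wedge r).map (unionSet t.nec r.nec J J') (unionSet t.nec r.nec V V')
      (Fin.last _) = g.word t.map J V (Fin.last _) * g.word r.map J' V' (Fin.last _) := by
  refine (g.word_map (t := r.map) (V := V') (inrV t.nec r.nec) (hJ' r.nec.zero_mem)
    (fun p v hv hp => ?_) (Fin.last _) (hJ' r.nec.last_mem)).trans ?_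
  · rw [← NecklaceIn.inr_wedge t r]
    refine g.word_step (inr t.nec r.nec) (t.wedge r).map hJ' hJV' hp inrV_injective.injOn ?_ ?_
    · refine ⟨mem_unionSet.2 (Or.inr ⟨p, hp.1, rfl⟩), inrV_lt.2 hp.2.1, fun q hq hqv => ?_⟩
      obtain ⟨a, ha, rfl⟩ | ⟨b, hb, rfl⟩ := mem_unionSet.1 hq
      · exact inlV_le_inrV a p
      · exact inrV_le.2 (hp.2.2 b hb (inrV_lt.1 hqv))
    · ext w
      simp only [Finset.mem_filter, mem_unionSet, Finset.mem_image, vert_inr]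
      constructor
      · rintro ⟨⟨a, ha, rfl⟩ | ⟨b, hb, rfl⟩, h1, h2⟩
        · obtain ⟨rfl, rfl⟩ := inrV_le_inlV h1
          exact ⟨_, ⟨hJV' hp.1, le_rfl, hp.2.1.le⟩, rfl⟩
        · exact ⟨b, ⟨hb, inrV_le.1 h1, inrV_le.1 h2⟩, rfl⟩
      · rintro ⟨a, ⟨ha, h1, h2⟩, rfl⟩
        exact ⟨Or.inr ⟨a, ha, rfl⟩, inrV_le.2 h1, inrV_le.2 h2⟩
  · exact congrArg (· * _) (g.word_inlV t r hJ hJV (hJ t.nec.last_mem))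

end Wedge

section Morphism

variable {T U : Necklace.{u}} (f : T ⟶ U) (r : U.toSSet ⟶ S) {J V : Finset (Fin (T.last + 1))}

/-- A morphism of necklaces which keeps the dimension of a subnecklace collapses at most some of
its one-dimensional beads. -/
theorem word_morphism (hJ : T.joints ⊆ J) (hJV : J ⊆ V)
    (hcard : (V.image (vert f.1) \ J.image (vert f.1)).card = (V \ J).card) :
    g.word r (J.image (vert f.1)) (V.image (vert f.1)) (Fin.last _) =
      g.word (f.1 ≫ r) J V (Fin.last _) := by
  have hmono := vert_monotone f.1
  have hsub : V.image (vert f.1) \ J.image (vert f.1) ⊆ (V \ J).image (vert f.1) := by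
    intro y hy
    obtain ⟨hy1, hy2⟩ := Finset.mem_sdiff.1 hy
    obtain ⟨w, hw, rfl⟩ := Finset.mem_image.1 hy1
    exact Finset.mem_image_of_mem _
      (Finset.mem_sdiff.2 ⟨hw, fun h => hy2 (Finset.mem_image_of_mem _ h)⟩)
  have himage : V.image (vert f.1) \ J.image (vert f.1) = (V \ J).image (vert f.1) :=
    Finset.eq_of_subset_of_card_le hsub (Finset.card_image_le.trans hcard.ge)
  have hinj : Set.InjOn (vert f.1) (V \ J : Finset _) :=
    Finset.card_image_iff.1 (himage ▸ hcard)
  -- the free vertices stay distinct and free, so that a vertex can only be identified with another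
  -- one if it is a joint
  have key' : ∀ a ∈ V, ∀ b ∈ V, vert f.1 a = vert f.1 b → a ≠ b → a ∈ J := by
    intro a ha b hb hab hne
    by_contra haJ
    have ha' : a ∈ V \ J := Finset.mem_sdiff.2 ⟨ha, haJ⟩
    by_cases hbJ : b ∈ J
    · have := himage.ge (Finset.mem_image_of_mem _ ha')
      rw [hab] at this
      exact (Finset.mem_sdiff.1 this).2 (Finset.mem_image_of_mem _ hbJ)
    · exact hne (hinj (Finset.mem_coe.2 ha') (Finset.mem_coe.2 (Finset.mem_sdiff.2 ⟨hb, hbJ⟩)) hab)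
  refine (congrArg (g.word r _ _) (vert_last f).symm).trans ?_
  refine (g.word_map (t := f.1 ≫ r) (V := V) (vert f.1) (hJ T.zero_mem)
    (fun p v hv hp => ?_) _ (hJ T.last_mem)).trans (by rw [vert_zero, word_zero, one_mul])
  have hpV := hJV hp.1
  have hvV := hJV hv
  -- either the bead from `p` to `v` is collapsed, in which case it is an edge, or it is mapped
  -- injectively
  rcases (hmono hp.2.1.le).eq_or_lt with hpv | hpv
  · rw [g.weight_eq_one f.1 r (spans_between hJ hp), mul_one, hpv]
    · have : between V p v = {p, v} := by
        ext w
        simp only [Finset.mem_filter, Finset.mem_insert, Finset.mem_singleton]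
        constructor
        · rintro ⟨hw, hpw, hwv⟩
          by_contra hcon
          push Not at hcon
          have hwJ := key' w hw p hpV (le_antisymm ((hmono hwv).trans hpv.ge) (hmono hpw)) hcon.1
          exact hcon.1 (le_antisymm (hp.2.2 w hwJ (lt_of_le_of_ne hwv hcon.2)) hpw)
        · rintro (rfl | rfl)
          exacts [⟨hpV, le_rfl, hp.2.1.le⟩, ⟨hvV, hp.2.1.le, le_rfl⟩]
      rw [this, Finset.card_pair hp.2.1.ne]
    · intro h
      exact hp.2.1.ne (h (Finset.mem_coe.2 (Finset.mem_filter.2 ⟨hpV, le_rfl, hp.2.1.le⟩))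
        (Finset.mem_coe.2 (Finset.mem_filter.2 ⟨hvV, hp.2.1.le, le_rfl⟩)) hpv)
  · refine g.word_step f.1 r hJ hJV hp ?_ ?_ ?_
    · have hend : ∀ a ∈ J, p ≤ a → a ≤ v → a = p ∨ a = v := fun a ha h1 h2 =>
        h2.eq_or_lt.symm.imp_left fun h2 => le_antisymm (hp.2.2 a ha h2) h1
      intro a ha b hb hab
      by_contra hne
      obtain ⟨haV, ha1, ha2⟩ := Finset.mem_filter.1 (Finset.mem_coe.1 ha)
      obtain ⟨hbV, hb1, hb2⟩ := Finset.mem_filter.1 (Finset.mem_coe.1 hb)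
      rcases hend a (key' a haV b hbV hab hne) ha1 ha2 with rfl | rfl <;>
        rcases hend b (key' b hbV _ haV hab.symm (Ne.symm hne)) hb1 hb2 with rfl | rfl
      exacts [hne rfl, hpv.ne hab, hpv.ne hab.symm, hne rfl]
    · refine ⟨Finset.mem_image_of_mem _ hp.1, hpv, fun q hq hqv => ?_⟩
      obtain ⟨q, hqJ, rfl⟩ := Finset.mem_image.1 hq
      exact hmono (hp.2.2 q hqJ (hmono.reflect_lt hqv))
    · ext y
      simp only [Finset.mem_filter, Finset.mem_image]
      constructor
      · rintro ⟨⟨w, hw, rfl⟩, h1, h2⟩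
        rcases le_total w p with hwp | hwp
        · exact ⟨p, ⟨hpV, le_rfl, hp.2.1.le⟩, le_antisymm h1 (hmono hwp)⟩
        rcases le_total w v with hwv | hwv
        · exact ⟨w, ⟨hw, hwp, hwv⟩, rfl⟩
        · exact ⟨v, ⟨hvV, hp.2.1.le, le_rfl⟩, le_antisymm (hmono hwv) h2⟩
      · rintro ⟨w, ⟨hw, h1, h2⟩, rfl⟩
        exact ⟨⟨w, hw, rfl⟩, hmono h1, hmono h2⟩

/-- A morphism of necklaces which lowers the dimension of a subnecklace makes one of its beads of
dimension at least `2` degenerate. -/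
theorem word_morphism_eq_zero (hJ : T.joints ⊆ J) (hJV : J ⊆ V)
    (hcard : (V.image (vert f.1) \ J.image (vert f.1)).card < (V \ J).card) :
    g.word (f.1 ≫ r) J V (Fin.last _) = 0 := by
  have hmono := vert_monotone f.1
  -- otherwise the free vertices would map injectively to free vertices
  obtain ⟨w, hw, w', hw', hne, heq⟩ : ∃ w ∈ V \ J, ∃ w' ∈ V, w ≠ w' ∧
      vert f.1 w = vert f.1 w' := by
    by_contra hcon
    push Not at hcon
    refine absurd (Finset.card_le_card_of_injOn (s := V \ J) (vert f.1) ?_ ?_) (not_le.2 hcard)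
    · intro w hw
      have hw := Finset.mem_coe.1 hw
      obtain ⟨hwV, hwJ⟩ := Finset.mem_sdiff.1 hw
      refine Finset.mem_coe.2 (Finset.mem_sdiff.2 ⟨Finset.mem_image_of_mem _ hwV, fun h => ?_⟩)
      obtain ⟨q, hq, h⟩ := Finset.mem_image.1 h
      exact hcon w hw q (hJV hq) (fun h' => hwJ (h' ▸ hq)) h.symm
    · intro a ha b hb hab
      by_contra hne
      exact hcon a ha b (Finset.mem_sdiff.1 hb).1 hne hab
  obtain ⟨hwV, hwJ⟩ := Finset.mem_sdiff.1 hw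
  have h0 := hJ T.zero_mem
  -- the bead which contains the free vertex `w` extends from `p` to `v`
  obtain ⟨p, hp⟩ := exists_isPrev h0 (v := w) fun h => hwJ (h ▸ h0)
  have hfil : (J.filter (w ≤ ·)).Nonempty :=
    ⟨_, Finset.mem_filter.2 ⟨hJ T.last_mem, Fin.le_last w⟩⟩
  obtain ⟨hv, hwv⟩ := Finset.mem_filter.1 (Finset.min'_mem _ hfil)
  set v := (J.filter (w ≤ ·)).min' hfil
  have hwv' : w < v := lt_of_le_of_ne hwv fun h => hwJ (h ▸ hv)
  have hpv : IsPrev J p v := ⟨hp.1, hp.2.1.trans hwv', fun q hq hqv => hp.2.2 q hq (by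
    by_contra hcon
    exact absurd (Finset.min'_le _ q (Finset.mem_filter.2 ⟨hq, not_lt.1 hcon⟩)) (not_le.2 hqv))⟩
  have hpm : p ∈ between V p v := Finset.mem_filter.2 ⟨hJV hp.1, le_rfl, hpv.2.1.le⟩
  have hvm : v ∈ between V p v := Finset.mem_filter.2 ⟨hJV hv, hpv.2.1.le, le_rfl⟩
  have hwm : w ∈ between V p v := Finset.mem_filter.2 ⟨hwV, hp.2.1.le, hwv⟩
  refine g.word_eq_zero h0 hpv (g.weight_eq_zero f.1 r (spans_between hJ hpv) ?_ ?_) hv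
    (Fin.le_last v)
  · have h3 : ({p, w, v} : Finset (Fin (T.last + 1))).card = 3 :=
      Finset.card_eq_three.2 ⟨p, w, v, hp.2.1.ne, hpv.2.1.ne, hwv'.ne, rfl⟩
    rw [← h3]
    refine Finset.card_le_card fun a ha => ?_
    simp only [Finset.mem_insert, Finset.mem_singleton] at ha
    rcases ha with rfl | rfl | rfl <;> assumption
  · intro hinj
    rcases lt_or_ge w' p with h1 | h1
    · refine hp.2.1.ne (hinj hpm hwm (le_antisymm (hmono hp.2.1.le) ?_))
      exact heq.le.trans (hmono h1.le)
    rcases lt_or_ge v w' with h2 | h2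
    · refine hwv'.ne (hinj hwm hvm (le_antisymm (hmono hwv) ?_))
      exact (hmono h2.le).trans heq.ge
    · exact hne (hinj hwm (Finset.mem_coe.2 (Finset.mem_filter.2 ⟨hw', h1, h2⟩)) heq)

end Morphism

/-! ### The value at a cell -/

section Cell

variable {x y z : Vertices S} {n m : ℕ}

/-- The value at a representative of a cell: the product of the values at the beads of the
subnecklace it spans if that has full dimension, and otherwise `0`. -/
noncomputable def preVal (a : PreCell S x y ⟨n⟩) : M :=
  if (a.high \ a.low).card = n then g.word a.obj.map a.low a.high (Fin.last _) else 0

theorem preVal_rel {a b : PreCell S x y ⟨n⟩} (h : a.Rel b) : g.preVal a = g.preVal b := by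
  obtain ⟨f, hf⟩ := h
  have hb : ∀ ε, b.bound ε = (a.bound ε).image (vert f.hom.1) :=
    PreCell.Rel.bound_eq f hf
  have hJ := a.joints_subset_bound false
  have hJV := a.low_subset_high
  have hle : (b.high \ b.low).card ≤ (a.high \ a.low).card := by
    rw [PreCell.high, PreCell.low, hb, hb]
    refine (Finset.card_le_card (t := (a.high \ a.low).image (vert f.hom.1)) ?_).trans
      Finset.card_image_le
    intro w hw
    obtain ⟨hw1, hw2⟩ := Finset.mem_sdiff.1 hw
    obtain ⟨v, hv, rfl⟩ := Finset.mem_image.1 hw1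
    exact Finset.mem_image_of_mem _
      (Finset.mem_sdiff.2 ⟨hv, fun h => hw2 (Finset.mem_image_of_mem _ h)⟩)
  have hn := a.card_high_sdiff_low_le
  rw [preVal, preVal, ← f.w]
  by_cases ha : (a.high \ a.low).card = n
  · rw [if_pos ha]
    by_cases hbn : (b.high \ b.low).card = n
    · rw [if_pos hbn]
      simp only [PreCell.high, PreCell.low, hb] at hbn ⊢
      exact (g.word_morphism f.hom b.obj.map hJ hJV (hbn.trans ha.symm)).symm
    · rw [if_neg hbn]
      have hlt : (b.high \ b.low).card < (a.high \ a.low).card := by omega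
      rw [PreCell.high, PreCell.low, hb, hb] at hlt
      exact g.word_morphism_eq_zero f.hom b.obj.map hJ hJV hlt
  · rw [if_neg ha, if_neg (by omega)]

theorem preVal_mul (a : PreCell S x y ⟨n⟩) (b : PreCell S y z ⟨m⟩) :
    g.preVal (a.mul b) = g.preVal a * g.preVal b := by
  have hcard : ((a.mul b).high \ (a.mul b).low).card =
      (a.high \ a.low).card + (b.high \ b.low).card := by
    rw [PreCell.high, PreCell.low, PreCell.bound_mul, PreCell.bound_mul]
    exact card_unionSet_sdiff (a.last_mem_bound false) (b.zero_mem_bound false)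
  have ha := a.card_high_sdiff_low_le
  have hb := b.card_high_sdiff_low_le
  rw [preVal, preVal, preVal, hcard]
  by_cases h1 : (a.high \ a.low).card = n
  · by_cases h2 : (b.high \ b.low).card = m
    · rw [if_pos h1, if_pos h2, if_pos (by rw [h1, h2]), PreCell.high, PreCell.low,
        PreCell.bound_mul, PreCell.bound_mul]
      exact g.word_wedge a.obj b.obj (a.joints_subset_bound false) a.low_subset_high
        (b.joints_subset_bound false) b.low_subset_high
    · rw [if_neg h2, mul_zero, if_neg (by omega)]
  · rw [if_neg h1, zero_mul, if_neg (by omega)]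

/-- The value at a cell of the endomorphism monoid of a vertex. -/
noncomputable def cellVal (a : (endMonoid S x).Cell) : M :=
  Quot.lift (r := PreCell.Rel) g.preVal (fun _ _ h => g.preVal_rel h) a.val

theorem cellVal_mul (a b : (endMonoid S x).Cell) :
    g.cellVal (a * b) = g.cellVal a * g.cellVal b := by
  obtain ⟨n, a⟩ := a
  obtain ⟨m, b⟩ := b
  induction a using Quot.ind with | mk a => ?_
  induction b using Quot.ind with | mk b => ?_
  exact g.preVal_mul a b

theorem cellVal_one : g.cellVal (1 : (endMonoid S x).Cell) = 1 := by
  have h : g.preVal (PreCell.one x) = 1 := by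
    rw [preVal, if_pos (Nat.le_zero.1 (PreCell.one x).card_high_sdiff_low_le)]
    exact g.word_zero
  exact h

theorem cellVal_degenerate {a : (endMonoid S x).Cell} (ha : a ∈ (endMonoid S x).degenerate) :
    g.cellVal a = 0 := by
  obtain ⟨n, j, b, rfl⟩ | ⟨n, j, b, rfl⟩ := ha
  · induction b using Quot.ind with | mk b => ?_
    refine if_neg (Nat.ne_of_lt (Nat.lt_succ_of_le ?_))
    exact b.card_high_sdiff_low_le
  · induction b using Quot.ind with | mk b => ?_
    refine if_neg (Nat.ne_of_lt (Nat.lt_succ_of_le ?_))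
    refine le_of_eq_of_le (congrArg Finset.card ?_) b.card_high_sdiff_low_le
    have h : ∀ ε, coconn j (constStr (n + 1) ε) = constStr n ε := fun ε =>
      funext fun i => by simp [coconn]
    exact congrArg₂ (fun s s' => b.obj.nec.ofStr (b.strs s) \ b.obj.nec.ofStr (b.strs s'))
      (h true) (h false)

end Cell

/-- The homomorphism on normalized chains given by the values at cells. -/
noncomputable def chainsHom (k : Type v) [CommRing k] {A : Type w} [Ring A] [Algebra k A]
    (g : BeadWeight S A) (x : Vertices S) :
    CubicalMonoid.NormalizedChains k (endMonoid S x) →ₐ[k] A :=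
  Ideal.Quotient.liftₐ (CubicalMonoid.degenerateIdeal k (endMonoid S x))
    (MonoidAlgebra.lift k _ (endMonoid S x).Cell
      { toFun := g.cellVal
        map_one' := g.cellVal_one
        map_mul' := g.cellVal_mul })
    (fun c hc => by
      refine LinearMap.eqOn_span (f := (MonoidAlgebra.lift k _ (endMonoid S x).Cell _).toLinearMap)
        (g := 0) ?_ ((CubicalMonoid.mem_degenerateIdeal k _).1 hc)
      rintro _ ⟨a, ha, rfl⟩
      refine (MonoidAlgebra.lift_single _ _ _).trans ((one_smul _ _).trans ?_)
      exact g.cellVal_degenerate ha)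

theorem chainsHom_cls (k : Type v) [CommRing k] {A : Type w} [Ring A] [Algebra k A]
    (g : BeadWeight S A) (x : Vertices S) (a : (endMonoid S x).Cell) :
    g.chainsHom k x (CubicalMonoid.cls k _ a) = g.cellVal a :=
  (MonoidAlgebra.lift_single _ _ _).trans (one_smul _ _)

end BeadWeight

/-! ### Morphisms between simplices, and degenerate beads -/

namespace Necklace

theorem dim_ofSimplex (d : ℕ) : (ofSimplex.{u} (d + 1)).dim = d := by
  refine (Finset.card_compl _).trans ?_
  change Fintype.card (Fin (d + 2)) - ({0, Fin.last (d + 1)} : Finset (Fin (d + 2))).card = d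
  rw [Finset.card_pair (by simp [Fin.ext_iff]), Fintype.card_fin]
  rfl

/-- A simplex of `Δᵉ` given by a morphism of the simplex category. -/
def ofHom {d e : ℕ} (φ : SimplexCategory.mk d ⟶ SimplexCategory.mk e) :
    Simp (ofSimplex.{u} e).toSSet d :=
  (ofSimplex e).simplex φ.toOrderHom fun j hj => by
    rcases Finset.mem_insert.1 hj with rfl | hj
    · exact Or.inr fun a => Fin.zero_le _
    · obtain rfl := Finset.mem_singleton.1 hj
      exact Or.inl fun a => Fin.le_last _

theorem simplexMap_ofHom {S : SSet.{u}} {d e : ℕ}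
    (φ : SimplexCategory.mk d ⟶ SimplexCategory.mk e) (σ : Simp S e) :
    (simplexMap σ).app _ (ofHom φ) = S.map φ.op σ := rfl

theorem simplexMap_vertex {T : Necklace.{u}} {d : ℕ} (τ : Simp T.toSSet d) (v : Fin (d + 1)) :
    (simplexMap τ).app _ ((ofSimplex d).vertex v) = T.vertex (T.pt τ v) :=
  T.pt_ext fun _ => rfl

/-- The morphism of necklaces from `Δᵈ` to `T` given by a simplex of `T` from the first to the last
vertex. -/
def simplexMor {T : Necklace.{u}} {d : ℕ} (τ : Simp T.toSSet d) (h0 : T.pt τ 0 = 0)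
    (h1 : T.pt τ (Fin.last d) = Fin.last _) : ofSimplex.{u} d ⟶ T :=
  ⟨simplexMap τ, (simplexMap_vertex τ 0).trans (congrArg T.vertex h0),
    (simplexMap_vertex τ (Fin.last d)).trans (congrArg T.vertex h1)⟩

end Necklace

namespace PreCell

open Necklace

variable {S : SSet.{u}} {x : Vertices S} (hS : ∀ y : Vertices S, y = x)

theorem toCell_bead_of_degenerate_one {σ : Simp S 1} (hσ : σ ∈ S.degenerate 1) :
    (bead hS σ).toCell = 1 := by
  rw [SSet.degenerate_eq_iUnion_range_σ, Set.mem_iUnion] at hσ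
  obtain ⟨j, τ, rfl⟩ := hσ
  obtain rfl : τ = x := hS τ
  let p : Simp point.{u}.toSSet 1 := point.simplex (OrderHom.const _ 0) fun _ _ =>
    Or.inl fun _ => Fin.zero_le _
  have hp : (Necklace.const τ).app _ p = S.σ j τ := by
    change S.map _ τ = S.map _ τ
    refine congrArg (fun φ => S.map φ τ) (Quiver.Hom.unop_inj ?_)
    ext a : 3
    exact Subsingleton.elim (α := Fin 1) _ _
  refine toCell_eq (bead hS (S.σ j τ)) (PreCell.one τ)
    ⟨simplexMor p (Subsingleton.elim (α := Fin 1) _ _) (Subsingleton.elim (α := Fin 1) _ _), ?_⟩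
    rfl (fun ε => ?_) (Nat.le_zero.1 (PreCell.one τ).card_high_sdiff_low_le)
  · exact (simplexMap_comp p (Necklace.const τ)).trans (congrArg simplexMap hp)
  · have h : ∀ A : Finset (Fin 1), A.Nonempty → A = Finset.univ := fun A hA =>
      Finset.eq_univ_of_forall fun v => by
        obtain ⟨w, hw⟩ := hA
        rwa [Subsingleton.elim v w]
    exact (h _ (Finset.Nonempty.image ⟨_, zero_mem_bound ε _⟩ _)).trans
      (h _ ⟨_, zero_mem_bound ε _⟩).symm

theorem toCell_bead_of_degenerate {n : ℕ} {σ : Simp S (n + 2)} (hσ : σ ∈ S.degenerate (n + 2)) :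
    (bead hS σ).toCell ∈ (endMonoid S x).degenerate := by
  rw [SSet.degenerate_eq_iUnion_range_σ, Set.mem_iUnion] at hσ
  obtain ⟨j, τ, rfl⟩ := hσ
  let f : (NecklaceIn.ofSimplex hS (S.σ j τ)).Hom (NecklaceIn.ofSimplex hS τ) :=
    ⟨simplexMor (ofHom (SimplexCategory.σ j)) (Fin.predAbove_right_zero (i := j))
      (Fin.predAbove_right_last (i := j)), simplexMap_comp _ _⟩
  have e : (bead hS (S.σ j τ)).toCell =
      toCell ⟨NecklaceIn.ofSimplex hS τ, (bead hS (S.σ j τ)).cell ≫ Necklace.toCube.map f.hom⟩ :=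
    congrArg (CubicalMonoid.cell (M := endMonoid S x)) (Quot.sound ⟨f, rfl⟩)
  rw [e]
  refine toCell_mem_degenerate _ ?_
  rw [card_high_sdiff_low]
  refine (Finset.card_le_univ _).trans_lt ?_
  rw [Fintype.card_fin]
  exact (dim_ofSimplex n).trans_lt (Nat.lt_succ_self n)

end PreCell

/-! ### The two homomorphisms -/

section Homs

variable (k : Type v) [CommRing k] {S : SSet.{u}} {x : Vertices S} (hS : ∀ y : Vertices S, y = x)

/-- The cobar construction on the normalized chains of a simplicial set with one vertex. -/
abbrev ChainsCobar : Type (max u v) := (normalizedChains k S x hS).CobarAlg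

/-- The generator of the cobar construction given by a simplex. -/
noncomputable def sgen {n : ℕ} (σ : Simp S (n + 1)) : ChainsCobar k hS :=
  (normalizedChains k S x hS).gen n (scls k σ)

theorem sgen_degenerate {n : ℕ} {σ : Simp S (n + 1)} (hσ : σ ∈ S.degenerate (n + 1)) :
    sgen k hS σ = 0 :=
  (congrArg ((normalizedChains k S x hS).gen n) (scls_eq_zero k hσ)).trans (map_zero _)

/-- The element of the cobar construction which corresponds to a bead.  A degenerate edge collapses
to the unit of the monoid of necklaces but vanishes in the normalized chains, whence the shift by
`1` in dimension one. -/
noncomputable def cobarWeight : BeadWeight S (ChainsCobar k hS) where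
  val {d} := match d with
    | 0 => fun _ => 1
    | 1 => fun σ => sgen k hS σ + 1
    | _ + 2 => fun σ => sgen k hS σ
  val_degenerate_one σ hσ := by
    change sgen k hS σ + 1 = 1
    rw [sgen_degenerate k hS hσ, zero_add]
  val_degenerate d σ hσ := sgen_degenerate k hS hσ

theorem cobarWeight_val {n : ℕ} (σ : Simp S (n + 1)) :
    (cobarWeight k hS).val σ = sgen k hS σ + if n = 0 then 1 else 0 := by
  obtain _ | n := n
  · rfl
  · exact (add_zero _).symm

/-- The homomorphism from the normalized cubical chains to the cobar construction. -/
noncomputable abbrev toCobar :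
    CubicalMonoid.NormalizedChains k (endMonoid S x) →ₐ[k] ChainsCobar k hS :=
  (cobarWeight k hS).chainsHom k x

/-- The class of a bead in the normalized cubical chains. -/
noncomputable def beadCls {n : ℕ} (σ : Simp S (n + 1)) :
    CubicalMonoid.NormalizedChains k (endMonoid S x) :=
  CubicalMonoid.cls k _ (PreCell.bead hS σ).toCell

/-- The homomorphism from the cobar construction to the normalized cubical chains, inverse to
`toCobar`. -/
noncomputable def ofCobar :
    ChainsCobar k hS →ₐ[k] CubicalMonoid.NormalizedChains k (endMonoid S x) :=
  TensorAlgebra.lift k (DirectSum.toModule k ℕ _ fun n =>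
    schainsLift k S (fun σ : Simp S (n + 1) => beadCls k hS σ - if n = 0 then 1 else 0) (by
      intro σ hσ
      obtain _ | n := n
      · rw [beadCls, PreCell.toCell_bead_of_degenerate_one hS hσ, CubicalMonoid.cls_one, if_pos rfl,
          sub_self]
      · rw [if_neg (Nat.succ_ne_zero n), sub_zero]
        exact CubicalMonoid.cls_eq_zero k _ (PreCell.toCell_bead_of_degenerate hS hσ)))

theorem ofCobar_sgen {n : ℕ} (σ : Simp S (n + 1)) :
    ofCobar k hS (sgen k hS σ) = beadCls k hS σ - if n = 0 then 1 else 0 := by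
  refine (TensorAlgebra.lift_ι_apply _ _).trans ?_
  refine (DirectSum.toModule_lof k n _).trans ?_
  exact schainsLift_scls k S _ _ σ

theorem toCobar_beadCls {n : ℕ} (σ : Simp S (n + 1)) :
    toCobar k hS (beadCls k hS σ) = (cobarWeight k hS).val σ := by
  refine ((cobarWeight k hS).chainsHom_cls k x _).trans ?_
  refine (if_pos (PreCell.card_bead hS σ)).trans ?_
  have hbd := fun ε => PreCell.bound_bead hS ε σ
  have hlow : (PreCell.bead hS σ).low = ({0, Fin.last _} : Finset (Fin (n + 1 + 1))) := hbd false
  have hhigh : (PreCell.bead hS σ).high = (Finset.univ : Finset (Fin (n + 1 + 1))) := hbd true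
  have hprev : IsPrev (PreCell.bead hS σ).low 0 (Fin.last _) := by
    refine ⟨PreCell.zero_mem_bound _ _, Fin.last_pos (n := n), fun q hq hq1 => ?_⟩
    rw [hlow] at hq
    rcases Finset.mem_insert.1 hq with rfl | hq
    · exact le_rfl
    · exact absurd (Finset.mem_singleton.1 hq) hq1.ne
  refine ((cobarWeight k hS).word_of_isPrev hprev).trans ?_
  rw [BeadWeight.word_zero, one_mul]
  refine ((cobarWeight k hS).weight_eq _ (Necklace.ofHom (𝟙 (SimplexCategory.mk (n + 1))))
    strictMono_id ?_).trans ?_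
  · refine Finset.image_id.trans (Eq.symm (Finset.eq_univ_of_forall fun v => ?_))
    refine Finset.mem_filter.2 ⟨?_, Fin.zero_le _, Fin.le_last _⟩
    exact hhigh.ge (Finset.mem_univ _)
  · refine congrArg _ ((Necklace.simplexMap_ofHom _ σ).trans ?_)
    exact simp_map_id _ (fun _ => rfl) σ

theorem toCobar_ofCobar (a : ChainsCobar k hS) : toCobar k hS (ofCobar k hS a) = a := by
  have hgen : ∀ {n : ℕ} (σ : Simp S (n + 1)),
      toCobar k hS (ofCobar k hS (sgen k hS σ)) = sgen k hS σ := by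
    intro n σ
    rw [ofCobar_sgen, map_sub, toCobar_beadCls, cobarWeight_val]
    split_ifs <;> simp
  induction a using ConnectedDGCoalgebra.gen_induction with
  | h1 r => rw [AlgHom.commutes, AlgHom.commutes]
  | hgen n c =>
    have : (toCobar k hS).toLinearMap ∘ₗ (ofCobar k hS).toLinearMap ∘ₗ
        (normalizedChains k S x hS).gen n = (normalizedChains k S x hS).gen n :=
      schains_hom_ext fun σ => hgen σ
    exact DFunLike.congr_fun this c
  | hmul a b ha hb => rw [map_mul, map_mul, ha, hb]
  | hadd a b ha hb => rw [map_add, map_add, ha, hb]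

end Homs

/-! ### Cells are products of beads -/

section Generation

variable (k : Type v) [CommRing k] {S : SSet.{u}} {x : Vertices S} (hS : ∀ y : Vertices S, y = x)

open Necklace

theorem beadCls_mem_range {n : ℕ} (σ : Simp S (n + 1)) :
    beadCls k hS σ ∈ (ofCobar k hS).range :=
  ⟨sgen k hS σ + if n = 0 then 1 else 0, by
    refine (map_add (ofCobar k hS) _ _).trans ?_
    rw [ofCobar_sgen]
    split_ifs <;> simp⟩

/-- The number of free vertices before `v` is the number of those before `p`, plus the number of
inner vertices of the bead from `p` to `v`. -/
theorem card_filter_le_of_isPrev {N : ℕ} {J V : Finset (Fin N)} (hJV : J ⊆ V) {p v : Fin N}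
    (hv : v ∈ J) (hp : IsPrev J p v) : ((V \ J).filter (· ≤ v)).card + 2 =
      ((V \ J).filter (· ≤ p)).card + (between V p v).card := by
  have h1 : (V \ J).filter (· ≤ v) = (V \ J).filter (· ≤ p) ∪ (between V p v \ {p, v}) := by
    ext w
    simp only [Finset.mem_filter, Finset.mem_sdiff, Finset.mem_union, Finset.mem_insert,
      Finset.mem_singleton, not_or]
    constructor
    · rintro ⟨⟨hw, hwJ⟩, hwv⟩
      rcases le_or_gt w p with h | h
      · exact Or.inl ⟨⟨hw, hwJ⟩, h⟩
      · exact Or.inr ⟨⟨hw, h.le, hwv⟩, h.ne', fun h' => hwJ (h' ▸ hv)⟩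
    · rintro (⟨h, hwp⟩ | ⟨⟨hw, h1, h2⟩, h3, h4⟩)
      · exact ⟨h, hwp.trans hp.2.1.le⟩
      · refine ⟨⟨hw, fun hwJ => ?_⟩, h2⟩
        exact h3 (le_antisymm (hp.2.2 w hwJ (lt_of_le_of_ne h2 h4)) h1)
  have h2 : Disjoint ((V \ J).filter (· ≤ p)) (between V p v \ {p, v}) := by
    rw [Finset.disjoint_left]
    intro w hw hw'
    have h1 := (Finset.mem_filter.1 hw).2
    obtain ⟨h2, h3⟩ := Finset.mem_sdiff.1 hw'
    exact h3 (Finset.mem_insert.2 (Or.inl (le_antisymm h1 (Finset.mem_filter.1 h2).2.1)))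
  have h3 : ({p, v} : Finset (Fin N)) ⊆ between V p v := by
    intro w hw
    rcases Finset.mem_insert.1 hw with rfl | hw
    · exact Finset.mem_filter.2 ⟨hJV hp.1, le_rfl, hp.2.1.le⟩
    · obtain rfl := Finset.mem_singleton.1 hw
      exact Finset.mem_filter.2 ⟨hJV hv, hp.2.1.le, le_rfl⟩
  have h4 := Finset.card_sdiff_add_card_eq_card h3
  rw [Finset.card_pair hp.2.1.ne] at h4
  rw [h1, Finset.card_union_of_disjoint h2]
  omega

/-- The part of the subnecklace spanned by a cell up to one of its joints is an iterated wedge of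
simplices. -/
theorem exists_initial_part {n : ℕ} (a : PreCell S x x ⟨n⟩) (v : Fin (a.obj.nec.last + 1))
    (hv : v ∈ a.low) : ∃ (m : ℕ) (b : PreCell S x x ⟨m⟩) (f : b.obj.nec.toSSet ⟶ a.obj.nec.toSSet),
      f ≫ a.obj.map = b.obj.map ∧ f.app _ (b.obj.nec.vertex 0) = a.obj.nec.vertex 0 ∧
      f.app _ (b.obj.nec.vertex (Fin.last _)) = a.obj.nec.vertex v ∧
      (∀ ε, (b.bound ε).image (vert f) = (a.bound ε).filter (· ≤ v)) ∧
      m = ((a.high \ a.low).filter (· ≤ v)).card ∧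
      CubicalMonoid.cls k _ b.toCell ∈ (ofCobar k hS).range := by
  induction v using WellFoundedLT.induction with
  | ind v ih =>
    have hJ := a.joints_subset_bound false
    have hJV := a.low_subset_high
    by_cases hv0 : v = 0
    · subst hv0
      refine ⟨0, PreCell.one x, Necklace.const (a.obj.nec.vertex 0), ?_, const_app _ _, const_app _ _,
        fun ε => ?_, ?_, ?_⟩
      · exact (const_comp _ _).trans (congrArg Necklace.const a.obj.map_first)
      · ext w
        simp only [Finset.mem_image, Finset.mem_filter, Fin.le_zero_iff]
        constructor
        · rintro ⟨-, -, rfl⟩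
          exact ⟨a.zero_mem_bound ε, rfl⟩
        · rintro ⟨-, rfl⟩
          exact ⟨_, PreCell.zero_mem_bound ε _, rfl⟩
      · refine (Finset.card_eq_zero.2 (Finset.filter_eq_empty_iff.2 fun w hw hw0 => ?_)).symm
        rw [Fin.le_zero_iff] at hw0
        subst hw0
        exact (Finset.mem_sdiff.1 hw).2 (a.zero_mem_bound false)
      · have : (PreCell.one x).toCell = 1 := rfl
        rw [this, CubicalMonoid.cls_one]
        exact one_mem _
    · obtain ⟨p, hp⟩ := exists_isPrev (a.zero_mem_bound false) hv0
      obtain ⟨m, b, f, hf, hf0, hf1, hbd, hm, hb⟩ := ih p hp.2.1 hp.1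
      have hpm : p ∈ between a.high p v := Finset.mem_filter.2 ⟨hJV hp.1, le_rfl, hp.2.1.le⟩
      have hvm : v ∈ between a.high p v := Finset.mem_filter.2 ⟨hJV hv, hp.2.1.le, le_rfl⟩
      obtain ⟨d, τ, hd, hτ, himg⟩ := (BeadWeight.spans_between hJ hp).exists_simplex ⟨p, hpm⟩
      have hcard2 : 1 < (between a.high p v).card :=
        Finset.one_lt_card.2 ⟨p, hpm, v, hvm, hp.2.1.ne⟩
      obtain ⟨d, rfl⟩ : ∃ e, d = e + 1 := ⟨d - 1, by omega⟩
      have hmem : ∀ i, a.obj.nec.pt τ i ∈ between a.high p v := fun i =>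
        himg ▸ Finset.mem_image_of_mem _ (Finset.mem_univ i)
      have hτ0 : a.obj.nec.pt τ 0 = p := by
        obtain ⟨i, -, hi⟩ := Finset.mem_image.1 (himg.ge hpm)
        exact le_antisymm ((hτ.monotone (Fin.zero_le i)).trans hi.le)
          (Finset.mem_filter.1 (hmem 0)).2.1
      have hτ1 : a.obj.nec.pt τ (Fin.last (d + 1)) = v := by
        obtain ⟨i, -, hi⟩ := Finset.mem_image.1 (himg.ge hvm)
        exact le_antisymm (Finset.mem_filter.1 (hmem (Fin.last (d + 1)))).2.2
          (hi.ge.trans (hτ.monotone (Fin.le_last i)))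
      -- the bead from `p` to `v` is attached to the initial part which ends at `p`
      let c : PreCell S x x ⟨d⟩ := PreCell.bead hS (a.obj.map.app _ τ)
      have hglue : f.app _ (b.obj.nec.vertex (Fin.last _)) =
          (simplexMap τ).app _ ((Necklace.ofSimplex (d + 1)).vertex 0) :=
        hf1.trans ((simplexMap_vertex τ 0).trans (congrArg a.obj.nec.vertex hτ0)).symm
      have hcimg : ∀ ε, (c.bound ε).image (vert (simplexMap τ)) =
          if ε then between a.high p v else {p, v} := by
        intro ε
        refine (congrArg (Finset.image _) (PreCell.bound_bead hS ε _)).trans ?_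
        cases ε
        · refine (Finset.image_insert _ _ _).trans
            ((congrArg (insert _) (Finset.image_singleton _ _)).trans ?_)
          exact congrArg₂ (fun p v => ({p, v} : Finset _)) hτ0 hτ1
        · exact himg
      refine ⟨m + d, b.mul c, desc f (simplexMap τ) hglue, ?_, (desc_zero _ _ hglue).trans hf0,
        (desc_last _ _ hglue).trans ?_, fun ε => ?_, ?_, ?_⟩
      · refine wedge_hom_ext ?_ ?_
        · refine Eq.trans ?_ (NecklaceIn.inl_wedge b.obj c.obj).symm
          exact (congrArg (· ≫ a.obj.map) (inl_desc _ _ hglue)).trans hf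
        · refine Eq.trans ?_ (NecklaceIn.inr_wedge b.obj c.obj).symm
          exact (congrArg (· ≫ a.obj.map) (inr_desc _ _ hglue)).trans (simplexMap_comp τ a.obj.map)
      · exact (simplexMap_vertex τ _).trans (congrArg a.obj.nec.vertex hτ1)
      · have h1 : ((b.mul c).bound ε).image (vert (desc f (simplexMap τ) hglue)) =
            (b.bound ε).image (vert f) ∪ (c.bound ε).image (vert (simplexMap τ)) := by
          refine (congrArg (Finset.image _) (PreCell.bound_mul ε b c)).trans ?_
          refine (Finset.image_union _ _).trans (congrArg₂ (· ∪ ·) ?_ ?_)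
          · refine Finset.image_image.trans (Finset.image_congr fun w _ => ?_)
            exact vert_desc_inlV f (simplexMap τ) hglue w
          · refine Finset.image_image.trans (Finset.image_congr fun w _ => ?_)
            exact vert_desc_inrV f (simplexMap τ) hglue w
        refine h1.trans ?_
        rw [hbd, hcimg]
        ext w
        cases ε
        · simp only [Finset.mem_union, Finset.mem_filter, Bool.false_eq_true, if_false,
            Finset.mem_insert, Finset.mem_singleton]
          constructor
          · rintro (⟨hw, hwp⟩ | rfl | rfl)
            exacts [⟨hw, hwp.trans hp.2.1.le⟩, ⟨hp.1, hp.2.1.le⟩, ⟨hv, le_rfl⟩]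
          · rintro ⟨hw, hwv⟩
            rcases hwv.eq_or_lt with rfl | hwv
            exacts [Or.inr (Or.inr rfl), Or.inl ⟨hw, hp.2.2 w hw hwv⟩]
        · simp only [Finset.mem_union, Finset.mem_filter, if_true]
          constructor
          · rintro (⟨hw, hwp⟩ | ⟨hw, -, hwv⟩)
            exacts [⟨hw, hwp.trans hp.2.1.le⟩, ⟨hw, hwv⟩]
          · rintro ⟨hw, hwv⟩
            exact (le_total w p).imp (fun h => ⟨hw, h⟩) (fun h => ⟨hw, h, hwv⟩)
      · have := card_filter_le_of_isPrev hJV hv hp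
        omega
      · rw [PreCell.toCell_mul, CubicalMonoid.cls_mul]
        exact mul_mem hb (beadCls_mem_range k hS _)

/-- Every cell which is not degenerate is, by `exists_initial_part` for the last vertex, a product of
beads. -/
theorem ofCobar_surjective : Function.Surjective (ofCobar k hS) := by
  have key : ∀ a : (endMonoid S x).Cell, CubicalMonoid.cls k _ a ∈ (ofCobar k hS).range := by
    rintro ⟨n, a⟩
    induction a using Quot.ind with | mk a => ?_
    change CubicalMonoid.cls k _ a.toCell ∈ _
    rcases a.card_high_sdiff_low_le.lt_or_eq with ha | ha
    · rw [CubicalMonoid.cls_eq_zero k _ (a.toCell_mem_degenerate ha)]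
      exact zero_mem _
    · obtain ⟨m, b, f, hf, hf0, hf1, hbd, hm, hb⟩ :=
        exists_initial_part k hS a (Fin.last _) (a.last_mem_bound false)
      have hfil : ∀ A : Finset (Fin (a.obj.nec.last + 1)), A.filter (· ≤ Fin.last _) = A := fun A =>
        Finset.filter_true_of_mem fun w _ => Fin.le_last w
      simp only [hfil] at hbd hm
      rwa [← PreCell.toCell_eq b a ⟨⟨f, hf0, hf1⟩, hf⟩ (hm.trans ha) hbd ha]
  have htop : (ofCobar k hS).range.toSubmodule = ⊤ := by
    refine eq_top_iff.2 fun c _ => ?_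
    obtain ⟨c, rfl⟩ := CubicalMonoid.toQuot_surjective k _ c
    induction c using MonoidAlgebra.induction_linear with
    | zero => rw [map_zero]; exact zero_mem _
    | add c d hc hd => rw [map_add]; exact add_mem (hc trivial) (hd trivial)
    | single a r =>
      have : (MonoidAlgebra.single a r : CubicalMonoid.Chains k (endMonoid S x)) =
          r • CubicalMonoid.single k _ a := by simp
      rw [this, map_smul]
      exact Submodule.smul_mem _ _ (key a)
  intro c
  exact htop.ge (Submodule.mem_top (x := c))

/-- The isomorphism of algebras between the cobar construction and the normalized cubical
chains. -/
noncomputable def cobarEquiv :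
    CubicalMonoid.NormalizedChains k (endMonoid S x) ≃ₐ[k] ChainsCobar k hS :=
  AlgEquiv.ofAlgHom (toCobar k hS) (ofCobar k hS)
    (AlgHom.ext (toCobar_ofCobar k hS))
    (AlgHom.ext fun c => by
      obtain ⟨a, rfl⟩ := ofCobar_surjective k hS c
      exact congrArg _ (toCobar_ofCobar k hS a))

end Generation

/-! ### The faces of a bead -/

section Faces

variable {S : SSet.{u}} {x : Vertices S} (hS : ∀ y : Vertices S, y = x)

open Necklace

namespace PreCell

/-- A face of a bead, as a cell of the standard cube of the same simplex. -/
def beadFace {m : ℕ} (σ : Simp S (m + 2)) (j : Fin (m + 1)) (ε : Bool) : PreCell S x x ⟨m⟩ :=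
  ⟨NecklaceIn.ofSimplex hS σ,
    Cube.ofMap (coface j ε) (IsCubeMap.coface j ε) ≫ (bead hS σ).cell⟩

theorem toCell_beadFace {m : ℕ} (σ : Simp S (m + 2)) (j : Fin (m + 1)) (ε : Bool) :
    (beadFace hS σ j ε).toCell = (endMonoid S x).cellFace ε (bead hS σ).toCell j := rfl

theorem mem_bound_beadFace {m : ℕ} (σ : Simp S (m + 2)) (j : Fin (m + 1)) (ε ε' : Bool)
    {v : Fin (m + 3)} : v ∈ (beadFace hS σ j ε).bound ε' ↔ v = 0 ∨ v = Fin.last _ ∨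
      if v = j.succ.castSucc then ε = true else ε' = true := by
  have h : (beadFace hS σ j ε).bound ε' = beadSet (coface j ε (constStr m ε')) :=
    ofStr_strs_bead hS σ _
  refine (Finset.ext_iff.1 h v).trans (mem_beadSet.trans ?_)
  refine or_congr_right' fun h0 => or_congr_right' fun h1 => ?_
  obtain ⟨i, rfl⟩ := ((eq_zero_or_last_or_inner v).resolve_left h0).resolve_left h1
  simp only [Fin.castSucc_inj, Fin.succ_inj, exists_eq_right]
  refine Fin.succAboveCases j ?_ (fun i => ?_) i
  · simp [coface]
  · simp [coface, Fin.succAbove_ne]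

/-- The image of the bounds of a standard cube under a coface of simplices. -/
theorem mem_image_succAbove {n : ℕ} {c : Fin (n + 2)} (h0 : c ≠ 0) (h1 : c ≠ Fin.last _) (ε : Bool)
    (v : Fin (n + 2)) : v ∈ Finset.image c.succAbove
      (if ε then Finset.univ else ({0, Fin.last _} : Finset (Fin (n + 1)))) ↔
      v = 0 ∨ v = Fin.last _ ∨ if v = c then false = true else ε = true := by
  cases n with
  | zero =>
    rcases Fin.eq_castSucc_or_eq_last c with ⟨d, rfl⟩ | rfl
    · exact absurd (by rw [Subsingleton.elim d 0]; rfl) h0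
    · exact absurd rfl h1
  | succ n =>
    refine Fin.succAboveCases c ?_ (fun w => ?_) v
    · simp [h0, h1, Fin.succAbove_ne]
    · have e0 : (c.succAbove w = 0) ↔ w = 0 := by
        rw [← Fin.succAbove_ne_zero_zero h0, Fin.succAbove_right_inj]
      have e1 : (c.succAbove w = Fin.last _) ↔ w = Fin.last _ := by
        rw [← Fin.succAbove_ne_last_last h1, Fin.succAbove_right_inj]
      rw [e0, e1]
      cases ε <;> simp [Fin.succAbove_ne]

/-- Inserting `0` into a string omits a vertex, so that it corresponds to a face of the simplex. -/
theorem beadFace_false {m : ℕ} (σ : Simp S (m + 2)) (j : Fin (m + 1)) :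
    (beadFace hS σ j false).toCell = (bead hS (S.δ j.succ.castSucc σ)).toCell := by
  have h0 : j.succ.castSucc ≠ (0 : Fin (m + 3)) := Fin.ne_of_val_ne (Nat.succ_ne_zero j.1)
  have h1 : j.succ.castSucc ≠ Fin.last (m + 2) :=
    Fin.ne_of_val_ne (show j.1 + 1 ≠ m + 2 by omega)
  refine (toCell_eq_of_injective (bead hS (S.δ j.succ.castSucc σ)) (beadFace hS σ j false)
    ⟨simplexMor (ofHom (SimplexCategory.δ j.succ.castSucc)) ?_ ?_, simplexMap_comp _ _⟩ ?_ rfl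
    (fun ε => ?_) (card_bead hS _)).symm
  · exact Fin.succAbove_ne_zero_zero h0
  · exact Fin.succAbove_ne_last_last h1
  · exact Fin.succAbove_right_injective (p := (j.succ.castSucc : Fin (m + 3)))
  · refine (congrArg (Finset.image _) (bound_bead hS ε _)).trans ?_
    ext (v : Fin (m + 3))
    exact (mem_image_succAbove h0 h1 ε v).trans (mem_bound_beadFace hS σ j false ε).symm

end PreCell

namespace Necklace

/-- The inclusion of `Δ^p ∨ Δ^q` into `Δ^{p + q}`. -/
theorem exists_wedge_ofSimplex (S : SSet.{u}) (p q n : ℕ) (h : p + q = n) :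
    ∃ f : wedge (Necklace.ofSimplex (p + 1)) (Necklace.ofSimplex (q + 1)) ⟶
      Necklace.ofSimplex.{u} (n + 2),
      (∀ v, (vert f.1 v).1 = v.1) ∧ ∀ σ : Simp S (n + 2),
        inl _ _ ≫ f.1 ≫ simplexMap σ = simplexMap (front S (p := p + 1) (by omega) σ) ∧
        inr _ _ ≫ f.1 ≫ simplexMap σ =
          simplexMap (back S (p := p + 1) (q := q + 1) (by omega) σ) := by
  subst h
  let τ : Simp (Necklace.ofSimplex.{u} (p + q + 2)).toSSet (p + 1) :=
    ofHom (SimplexCategory.subinterval 0 (p + 1) (by omega))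
  let ρ : Simp (Necklace.ofSimplex.{u} (p + q + 2)).toSSet (q + 1) :=
    ofHom (SimplexCategory.subinterval (p + 1) (q + 1) (by omega))
  have hglue : (simplexMap τ).app _ ((Necklace.ofSimplex (p + 1)).vertex (Fin.last _)) =
      (simplexMap ρ).app _ ((Necklace.ofSimplex (q + 1)).vertex 0) := by
    refine (simplexMap_vertex τ _).trans (Eq.trans ?_ (simplexMap_vertex ρ _).symm)
    refine congrArg _ (Fin.ext ?_)
    change p + 1 + 0 = 0 + (p + 1)
    omega
  let f : wedge (Necklace.ofSimplex (p + 1)) (Necklace.ofSimplex (q + 1)) ⟶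
      Necklace.ofSimplex (p + q + 2) :=
    ⟨desc (simplexMap τ) (simplexMap ρ) hglue, (desc_zero _ _ hglue).trans
      ((simplexMap_vertex τ _).trans rfl), (desc_last _ _ hglue).trans
      ((simplexMap_vertex ρ _).trans (congrArg _ (Fin.ext (by
        change q + 1 + (p + 1) = p + q + 2
        omega))))⟩
  have hl : ∀ v, (vert f.1 (inlV _ _ v)).1 = v.1 := fun v =>
    congrArg Fin.val (vert_desc_inlV (simplexMap τ) (simplexMap ρ) hglue v)
  have hr : ∀ v, (vert f.1 (inrV _ _ v)).1 = p + 1 + v.1 := fun v =>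
    (congrArg Fin.val (vert_desc_inrV (simplexMap τ) (simplexMap ρ) hglue v)).trans
      (Nat.add_comm _ _)
  refine ⟨f, fun v => ?_, fun σ => ⟨?_, ?_⟩⟩
  · have hv : v.1 < p + 1 + (q + 1) + 1 := v.2
    rcases lt_or_ge v.1 (p + 1) with h | h
    · exact hl ⟨v.1, by change v.1 < p + 1 + 1; omega⟩
    · have e : inrV _ _ (⟨v.1 - (p + 1), by change _ < q + 1 + 1; omega⟩ :
          Fin ((Necklace.ofSimplex.{u} (q + 1)).last + 1)) = v :=
        Fin.ext (Nat.add_sub_cancel' h)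
      have := hr ⟨v.1 - (p + 1), by change _ < q + 1 + 1; omega⟩
      rw [e] at this
      exact this.trans (Nat.add_sub_cancel' h)
  · exact (congrArg (· ≫ simplexMap σ) (inl_desc _ _ hglue)).trans (simplexMap_comp τ _)
  · exact (congrArg (· ≫ simplexMap σ) (inr_desc _ _ hglue)).trans (simplexMap_comp ρ _)

theorem mem_image_unionSet {T U V : Necklace.{u}} {f : (wedge T U).toSSet ⟶ V.toSSet}
    (hf : ∀ v, (vert f v).1 = v.1) (X : Finset (Fin (T.last + 1))) (Y : Finset (Fin (U.last + 1)))
    (v : Fin (V.last + 1)) : v ∈ (unionSet T U X Y).image (vert f) ↔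
      (∃ w ∈ X, w.1 = v.1) ∨ ∃ w ∈ Y, T.last + w.1 = v.1 := by
  simp only [Finset.mem_image, mem_unionSet]
  constructor
  · rintro ⟨_, ⟨w, hw, rfl⟩ | ⟨w, hw, rfl⟩, rfl⟩
    exacts [Or.inl ⟨w, hw, (hf (inlV T U w)).symm⟩, Or.inr ⟨w, hw, (hf (inrV T U w)).symm⟩]
  · rintro (⟨w, hw, h⟩ | ⟨w, hw, h⟩)
    exacts [⟨_, Or.inl ⟨w, hw, rfl⟩, Fin.ext ((hf _).trans h)⟩,
      ⟨_, Or.inr ⟨w, hw, rfl⟩, Fin.ext ((hf _).trans h)⟩]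

end Necklace

namespace PreCell

theorem mem_bound_bead {n : ℕ} (ε : Bool) (σ : Simp S (n + 1))
    (v : Fin ((bead hS σ).obj.nec.last + 1)) :
    v ∈ (bead hS σ).bound ε ↔ v.1 = 0 ∨ v.1 = n + 1 ∨ ε = true := by
  refine (Finset.ext_iff.1 (bound_bead hS ε σ) v).trans ?_
  cases ε
  · exact Finset.mem_insert.trans (or_congr Fin.ext_iff
      ((Finset.mem_singleton.trans Fin.ext_iff).trans (iff_of_eq (or_false _).symm) |>.trans
        (or_congr Iff.rfl (by simp))))
  · exact iff_of_true (Finset.mem_univ _) (Or.inr (Or.inr rfl))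

/-- Inserting `1` into a string turns a vertex into a joint, so that it corresponds to the wedge of
a front face and a last face of the simplex. -/
theorem beadFace_true {p q m : ℕ} (h : p + q = m) (σ : Simp S (m + 2)) :
    (beadFace hS σ ⟨p, by omega⟩ true).toCell =
      (bead hS (front S (p := p + 1) (by omega) σ)).toCell *
        (bead hS (back S (p := p + 1) (q := q + 1) (by omega) σ)).toCell := by
  obtain ⟨f, hval, hf⟩ := exists_wedge_ofSimplex S p q m h
  generalize ha : bead hS (front S (p := p + 1) (by omega) σ) = a
  generalize hb : bead hS (back S (p := p + 1) (q := q + 1) (by omega) σ) = b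
  rw [← toCell_mul]
  subst ha hb
  refine (toCell_eq_of_injective (mul (bead hS _) (bead hS _))
    (beadFace hS σ ⟨p, by omega⟩ true) ⟨f, wedge_hom_ext
      ((hf σ).1.trans (NecklaceIn.inl_wedge (NecklaceIn.ofSimplex hS _)
        (NecklaceIn.ofSimplex hS _)).symm)
      ((hf σ).2.trans (NecklaceIn.inr_wedge (NecklaceIn.ofSimplex hS _)
        (NecklaceIn.ofSimplex hS _)).symm)⟩
    (fun v w hvw => Fin.ext ((hval v).symm.trans ((congrArg Fin.val hvw).trans (hval w)))) h
    (fun ε => ?_) ?_).symm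
  · refine (congrArg (Finset.image _) (bound_mul ε _ _)).trans ?_
    ext (v : Fin (m + 3))
    refine (mem_image_unionSet hval _ _ v).trans (Iff.trans ?_
      (mem_bound_beadFace hS σ ⟨p, by omega⟩ true ε).symm)
    have hr : (v = 0 ∨ v = Fin.last _ ∨
        if v = (⟨p, by omega⟩ : Fin (m + 1)).succ.castSucc then true = true else ε = true) ↔
        v.1 = 0 ∨ v.1 = m + 2 ∨ v.1 = p + 1 ∨ ε = true := by
      rw [Fin.ext_iff, Fin.ext_iff]
      refine or_congr Iff.rfl (or_congr Iff.rfl ?_)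
      by_cases hv : v.1 = p + 1
      · rw [if_pos (Fin.ext hv)]
        simp [hv]
      · rw [if_neg fun e => hv (congrArg Fin.val e)]
        simp [hv]
    have hv : v.1 < m + 3 := v.2
    refine Iff.trans ?_ hr.symm
    constructor
    · rintro (⟨w, hw, e⟩ | ⟨w, hw, e⟩)
      · have h2 := (mem_bound_bead hS ε _ w).1 hw
        rw [e] at h2
        rcases h2 with h2 | h2 | h2
        exacts [Or.inl h2, Or.inr (Or.inr (Or.inl h2)), Or.inr (Or.inr (Or.inr h2))]
      · have h2 := (mem_bound_bead hS ε _ w).1 hw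
        change p + 1 + w.1 = v.1 at e
        rcases h2 with h2 | h2 | h2
        exacts [by omega, by omega, Or.inr (Or.inr (Or.inr h2))]
    · intro hw
      by_cases hvp : v.1 ≤ p + 1
      · refine Or.inl ⟨⟨v.1, Nat.lt_succ_of_le hvp⟩, (mem_bound_bead hS ε _ _).2 ?_, rfl⟩
        change v.1 = 0 ∨ v.1 = p + 1 ∨ ε = true
        rcases hw with hw | hw | hw | hw
        exacts [Or.inl hw, by omega, Or.inr (Or.inl hw), Or.inr (Or.inr hw)]
      · refine Or.inr ⟨⟨v.1 - (p + 1), show _ < q + 1 + 1 by omega⟩,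
          (mem_bound_bead hS ε _ _).2 ?_, show p + 1 + (v.1 - (p + 1)) = v.1 by omega⟩
        change v.1 - (p + 1) = 0 ∨ v.1 - (p + 1) = q + 1 ∨ ε = true
        rcases hw with hw | hw | hw | hw
        exacts [by omega, by omega, by omega, Or.inr (Or.inr hw)]
  · refine (congrArg Finset.card (congrArg₂ (· \ ·) (bound_mul true _ _)
      (bound_mul false _ _))).trans ?_
    refine (card_unionSet_sdiff (last_mem_bound false _) (zero_mem_bound false _)).trans ?_
    exact congrArg₂ (· + ·) (card_bead hS _) (card_bead hS _)

end PreCell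

end Faces

/-! ### Compatibility with the differentials -/

section AlternatingSums

variable {k A : Type*} [CommRing k] [Ring A] [Algebra k A]

/-- The alternating sum of products, with the shifts by `1` of edges expanded. -/
theorem sum_shifted_products {m : ℕ} (F G : Fin (m + 1) → A) :
    ∑ j : Fin (m + 1), (-1 : k) ^ (j.1 + 1) •
      ((F j - if j.1 = 0 then 1 else 0) * (G j - if m - j.1 = 0 then 1 else 0)) =
    ∑ j : Fin (m + 1), (-1 : k) ^ (j.1 + 1) • (F j * G j) + G 0 + (-1 : k) ^ m • F (Fin.last m) -
      if m = 0 then 1 else 0 := by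
  have h1 : ∀ j : Fin (m + 1), j.1 = 0 ↔ j = 0 := fun j =>
    ⟨fun h => Fin.ext h, fun h => congrArg Fin.val h⟩
  have h2 : ∀ j : Fin (m + 1), m - j.1 = 0 ↔ j = Fin.last m := fun j => by
    rw [Fin.ext_iff, Fin.val_last]; omega
  simp only [h1, h2, sub_mul, mul_sub, smul_sub, Finset.sum_sub_distrib, ite_mul, mul_ite, one_mul,
    mul_one, zero_mul, mul_zero, smul_ite, smul_zero, Finset.sum_ite_eq', Finset.mem_univ, if_true]
  have h3 : (if Fin.last m = 0 then (-1 : k) ^ ((Fin.last m).1 + 1) • (1 : A) else 0) =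
      -if m = 0 then 1 else 0 := by
    by_cases hm : m = 0
    · subst hm; simp
    · rw [if_neg hm, if_neg fun e => hm (congrArg Fin.val e), neg_zero]
  rw [h3]
  simp only [Fin.val_zero, Fin.val_last, pow_succ, mul_neg_one, neg_smul, pow_zero, one_smul]
  abel

/-- The alternating sum of the faces, with the outer faces split off. -/
theorem sum_shifted_faces {m : ℕ} (E : Fin (m + 3) → A) :
    ∑ i : Fin (m + 3), (-1 : k) ^ i.1 • (E i - if m = 0 then 1 else 0) =
    E 0 + ∑ j : Fin (m + 1), (-1 : k) ^ (j.1 + 1) • E j.succ.castSucc +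
      (-1 : k) ^ m • E (Fin.last _) - if m = 0 then 1 else 0 := by
  have h : ∑ i : Fin (m + 3), (-1 : k) ^ i.1 • (if m = 0 then (1 : A) else 0) =
      if m = 0 then 1 else 0 := by
    by_cases hm : m = 0
    · subst hm; simp [Fin.sum_univ_succ]
    · simp [hm]
  simp only [smul_sub, Finset.sum_sub_distrib]
  rw [h, Fin.sum_univ_castSucc, Fin.sum_univ_succ]
  simp [pow_succ]

end AlternatingSums

section Differential

variable (k : Type v) [CommRing k] {S : SSet.{u}} {x : Vertices S} (hS : ∀ y : Vertices S, y = x)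

/-- The boundary of a bead. -/
theorem differential_beadCls {m : ℕ} (σ : Simp S (m + 2)) :
    CubicalMonoid.differential k (endMonoid S x) (beadCls k hS σ) =
      ∑ j : Fin (m + 1), (-1 : k) ^ (j.1 + 1) •
        (beadCls k hS (front S (p := j.1 + 1) (by omega) σ) *
          beadCls k hS (back S (p := j.1 + 1) (q := m - j.1 + 1) (by omega) σ) -
          beadCls k hS (S.δ j.succ.castSucc σ)) := by
  refine (CubicalMonoid.differential_cls k _ _).trans ?_
  refine Finset.sum_congr rfl fun (j : Fin (m + 1)) _ => ?_
  refine congrArg _ (congrArg₂ (· - ·) ?_ ?_)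
  · refine (congrArg (CubicalMonoid.cls k _) ((PreCell.toCell_beadFace hS σ j true).symm.trans
      (PreCell.beadFace_true hS (p := j.1) (q := m - j.1) (by omega) σ))).trans ?_
    exact CubicalMonoid.cls_mul k _ _ _
  · exact congrArg (CubicalMonoid.cls k _) ((PreCell.toCell_beadFace hS σ j false).symm.trans
      (PreCell.beadFace_false hS σ j))

theorem back_one {m : ℕ} (σ : Simp S (m + 2)) :
    back S (p := 1) (q := m + 1) (by omega) σ = S.δ 0 σ := by
  refine congrArg (fun φ => S.map φ σ) (Quiver.Hom.unop_inj ?_)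
  ext i : 3
  refine Fin.ext ?_
  change i.1 + 1 = ((0 : Fin (m + 3)).succAbove i).1
  simp

theorem front_last {m : ℕ} (σ : Simp S (m + 2)) :
    front S (p := m + 1) (by omega) σ = S.δ (Fin.last _) σ := by
  refine congrArg (fun φ => S.map φ σ) (Quiver.Hom.unop_inj ?_)
  ext i : 3
  refine Fin.ext ?_
  change i.1 + 0 = ((Fin.last (m + 2)).succAbove i).1
  simp

theorem beadCls_mem_gr {n : ℕ} (σ : Simp S (n + 1)) :
    beadCls k hS σ ∈ CubicalMonoid.gr k (endMonoid S x) n :=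
  CubicalMonoid.cls_mem_gr k (endMonoid S x) (PreCell.bead hS σ).toCell

theorem ofCobar_sgen_mem_gr {n : ℕ} (σ : Simp S (n + 1)) :
    ofCobar k hS (sgen k hS σ) ∈ CubicalMonoid.gr k (endMonoid S x) n := by
  rw [ofCobar_sgen]
  refine sub_mem (beadCls_mem_gr k hS σ) ?_
  split_ifs with hn
  · subst hn
    exact SetLike.GradedOne.one_mem
  · exact zero_mem _

theorem ofCobar_gen_mem_gr (n : ℕ) (c : (normalizedChains k S x hS).X (n + 1)) :
    ofCobar k hS ((normalizedChains k S x hS).gen n c) ∈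
      CubicalMonoid.gr k (endMonoid S x) n := by
  have h : (Submodule.mkQ (CubicalMonoid.gr k (endMonoid S x) n)) ∘ₗ
      (ofCobar k hS).toLinearMap ∘ₗ (normalizedChains k S x hS).gen n = 0 :=
    schains_hom_ext fun σ => (Submodule.Quotient.mk_eq_zero _).2 (ofCobar_sgen_mem_gr k hS σ)
  exact (Submodule.Quotient.mk_eq_zero _).1 (DFunLike.congr_fun h c)

/-- The shifts by `1` of the edges in the products of front and last faces account for the outer
faces of `σ`, which do not occur in the boundary of its bead. -/
theorem ofCobar_dGen_scls {m : ℕ} (σ : Simp S (m + 2)) :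
    ofCobar k hS ((normalizedChains k S x hS).dGen (m + 1) (scls k σ)) =
      CubicalMonoid.differential k (endMonoid S x) (ofCobar k hS (sgen k hS σ)) := by
  rw [ofCobar_sgen, if_neg (Nat.succ_ne_zero m), sub_zero, differential_beadCls]
  have hbd : ofCobar k hS ((normalizedChains k S x hS).gen m (sbd k S (m + 1) (scls k σ))) =
      ∑ i : Fin (m + 3), (-1 : k) ^ i.1 • (beadCls k hS (S.δ i σ) - if m = 0 then 1 else 0) := by
    rw [sbd_scls]
    refine (congrArg (ofCobar k hS) (map_sum ((normalizedChains k S x hS).gen m) _ _)).trans ?_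
    refine (map_sum (ofCobar k hS) _ _).trans (Finset.sum_congr rfl fun i _ => ?_)
    refine (congrArg (ofCobar k hS) (map_smul ((normalizedChains k S x hS).gen m) _ _)).trans ?_
    refine (map_smul (ofCobar k hS) _ _).trans (congrArg _ ?_)
    exact ofCobar_sgen k hS (S.δ i σ)
  have hmul : ∀ j : Fin (m + 1), ofCobar k hS ((normalizedChains k S x hS).genMul j.1 (m - j.1)
      ((normalizedChains k S x hS).comul0 (j.1 + 1) (m - j.1 + 1) (m + 2) (scls k σ))) =
      (beadCls k hS (front S (p := j.1 + 1) (by omega) σ) - if j.1 = 0 then 1 else 0) *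
        (beadCls k hS (back S (p := j.1 + 1) (q := m - j.1 + 1) (by omega) σ) -
          if m - j.1 = 0 then 1 else 0) := by
    intro j
    rw [ConnectedDGCoalgebra.comul0_eq _ (by omega)]
    refine (congrArg (fun t => ofCobar k hS ((normalizedChains k S x hS).genMul _ _ t))
      (scomul_scls k S (p := j.1 + 1) (q := m - j.1 + 1) (by omega) σ)).trans ?_
    refine (congrArg (ofCobar k hS)
      ((normalizedChains k S x hS).genMul_tmul _ _ (scls k _) (scls k _))).trans ?_
    exact (map_mul _ _ _).trans (congrArg₂ (· * ·) (ofCobar_sgen k hS _) (ofCobar_sgen k hS _))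
  refine (congrArg (ofCobar k hS)
    ((normalizedChains k S x hS).dGen_succ m (scls k σ))).trans ?_
  rw [map_add, map_neg, map_sum,
    Finset.Nat.sum_antidiagonal_eq_sum_range_succ_mk, Finset.sum_range]
  refine (congrArg₂ (fun a b => -a + b) hbd (Finset.sum_congr rfl fun j _ =>
    (map_smul (ofCobar k hS) _ _).trans (congrArg _ (hmul j)))).trans ?_
  rw [sum_shifted_faces, sum_shifted_products]
  simp only [smul_sub, Finset.sum_sub_distrib]
  have h0 : beadCls k hS (back S (p := ((0 : Fin (m + 1)) : ℕ) + 1)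
      (q := m - ((0 : Fin (m + 1)) : ℕ) + 1) (by simp; omega) σ) = beadCls k hS (S.δ 0 σ) :=
    congrArg (beadCls k hS) (back_one σ)
  have h1 : beadCls k hS (front S (p := (Fin.last m : ℕ) + 1) (by simp) σ) =
      beadCls k hS (S.δ (Fin.last _) σ) := congrArg (beadCls k hS) (front_last σ)
  rw [h0, h1]
  abel

theorem differential_mul_of_mem_gr {n : ℕ} {a : CubicalMonoid.NormalizedChains k (endMonoid S x)}
    (ha : a ∈ CubicalMonoid.gr k (endMonoid S x) n)
    (b : CubicalMonoid.NormalizedChains k (endMonoid S x)) :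
    CubicalMonoid.differential k (endMonoid S x) (a * b) =
      CubicalMonoid.differential k (endMonoid S x) a * b +
        (-1 : k) ^ n • (a * CubicalMonoid.differential k (endMonoid S x) b) := by
  refine (((endMonoid S x).dga k).d_mul n a ha b).trans (congrArg _ ?_)
  rcases Nat.even_or_odd n with hn | hn
  · rw [hn.neg_one_pow, hn.neg_one_pow, one_smul]; exact one_mul _
  · rw [hn.neg_one_pow, hn.neg_one_pow, neg_one_smul]; exact neg_one_mul _

theorem differential_ofCobar_gen (n : ℕ) (c : (normalizedChains k S x hS).X (n + 1)) :
    CubicalMonoid.differential k (endMonoid S x)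
      (ofCobar k hS ((normalizedChains k S x hS).gen n c)) =
      ofCobar k hS ((normalizedChains k S x hS).dGen n c) := by
  obtain _ | m := n
  · refine (((endMonoid S x).dga k).d_zero _ (ofCobar_gen_mem_gr k hS 0 c)).trans ?_
    exact (map_zero (ofCobar k hS)).symm
  · have h : CubicalMonoid.differential k (endMonoid S x) ∘ₗ (ofCobar k hS).toLinearMap ∘ₗ
        (normalizedChains k S x hS).gen (m + 1) =
        (ofCobar k hS).toLinearMap ∘ₗ (normalizedChains k S x hS).dGen (m + 1) :=
      schains_hom_ext fun σ => (ofCobar_dGen_scls k hS σ).symm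
    exact DFunLike.congr_fun h c

/-- The homomorphism `ofCobar` commutes with the differentials.  The second assertion, the Leibniz
rule for products with a left factor in the image, makes the induction over products work without
reference to homogeneous components. -/
theorem differential_ofCobar_and_mul (a : ChainsCobar k hS) :
    CubicalMonoid.differential k (endMonoid S x) (ofCobar k hS a) =
      ofCobar k hS ((normalizedChains k S x hS).D a) ∧
    ∀ b, CubicalMonoid.differential k (endMonoid S x) (ofCobar k hS a * b) =
      CubicalMonoid.differential k (endMonoid S x) (ofCobar k hS a) * b +
        ofCobar k hS ((normalizedChains k S x hS).sgn a) *
          CubicalMonoid.differential k (endMonoid S x) b := by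
  induction a using ConnectedDGCoalgebra.gen_induction with
  | h1 r =>
    have h : CubicalMonoid.differential k (endMonoid S x)
        (algebraMap k (CubicalMonoid.NormalizedChains k (endMonoid S x)) r) = 0 :=
      ((endMonoid S x).dga k).d_zero _ (SetLike.algebraMap_mem_graded _ r)
    rw [AlgHom.commutes, AlgHom.commutes, AlgHom.commutes, ConnectedDGCoalgebra.D_algebraMap, h,
      map_zero]
    refine ⟨rfl, fun b => ?_⟩
    rw [zero_mul, zero_add, ← Algebra.smul_def, ← Algebra.smul_def, map_smul]
  | hgen n c =>
    refine ⟨?_, fun b => ?_⟩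
    · rw [ConnectedDGCoalgebra.D_gen, differential_ofCobar_gen]
    · rw [differential_mul_of_mem_gr k (ofCobar_gen_mem_gr k hS n c),
        ConnectedDGCoalgebra.sgn_gen, map_smul, smul_mul_assoc]
  | hmul a b ha hb =>
    refine ⟨?_, fun c => ?_⟩
    · rw [map_mul, ha.2 (ofCobar k hS b), ha.1, hb.1, ConnectedDGCoalgebra.D_mul, map_add, map_mul, map_mul]
    · rw [map_mul (ofCobar k hS) a b, map_mul (normalizedChains k S x hS).sgn,
        map_mul (ofCobar k hS), mul_assoc, ha.2 (ofCobar k hS b * c), hb.2 c,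
        ha.2 (ofCobar k hS b)]
      simp only [mul_add, add_mul, mul_assoc, add_assoc]
  | hadd a b ha hb =>
    refine ⟨?_, fun c => ?_⟩
    · rw [map_add, map_add, map_add, map_add, ha.1, hb.1]
    · rw [map_add, map_add, map_add, map_add, add_mul, map_add, ha.2, hb.2, add_mul, add_mul]
      abel

end Differential

/-! ### Compatibility with the gradings -/

section Grading

/-- An injective linear map between graded modules which preserves degrees also reflects them. -/
theorem mem_of_map_mem_graded {k A B : Type*} [CommRing k] [AddCommGroup A] [Module k A]
    [AddCommGroup B] [Module k B] (𝒜 : ℕ → Submodule k A) (ℬ : ℕ → Submodule k B)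
    [DirectSum.Decomposition 𝒜] [DirectSum.Decomposition ℬ] {f : A →ₗ[k] B}
    (hf : Function.Injective f) (h : ∀ n, ∀ a ∈ 𝒜 n, f a ∈ ℬ n) {n : ℕ} {a : A}
    (ha : f a ∈ ℬ n) : a ∈ 𝒜 n := by
  have hcomp : ∀ (a : A) (i : ℕ),
      (DirectSum.decompose ℬ (f a) i : B) = f (DirectSum.decompose 𝒜 a i : A) := by
    intro a i
    induction a using DirectSum.Decomposition.inductionOn 𝒜 with
    | zero => simp
    | @homogeneous j a =>
      by_cases hij : j = i
      · subst hij
        rw [DirectSum.decompose_of_mem_same _ (h j _ a.2), DirectSum.decompose_of_mem_same _ a.2]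
      · rw [DirectSum.decompose_of_mem_ne _ (h j _ a.2) hij,
          DirectSum.decompose_of_mem_ne _ a.2 hij, map_zero]
    | add a b ha hb => simp [DirectSum.decompose_add, ha, hb]
  have : a = (DirectSum.decompose 𝒜 a n : A) :=
    hf ((DirectSum.decompose_of_mem_same ℬ ha).symm.trans (hcomp a n))
  rw [this]
  exact SetLike.coe_mem _

variable (k : Type v) [CommRing k] {S : SSet.{u}} {x : Vertices S} (hS : ∀ y : Vertices S, y = x)

theorem ofCobar_mem_gr {n : ℕ} {a : ChainsCobar k hS}
    (ha : a ∈ (normalizedChains k S x hS).gr n) :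
    ofCobar k hS a ∈ CubicalMonoid.gr k (endMonoid S x) n := by
  have h : (normalizedChains k S x hS).gr n ≤
      (CubicalMonoid.gr k (endMonoid S x) n).comap (ofCobar k hS).toLinearMap := by
    refine Submodule.span_le.2 ?_
    rintro _ ⟨l, rfl, rfl⟩
    change ofCobar k hS _ ∈ CubicalMonoid.gr k (endMonoid S x) _
    clear ha
    induction l with
    | nil =>
      rw [ConnectedDGCoalgebra.word, map_one]
      exact SetLike.GradedOne.one_mem
    | cons c l ih =>
      rw [ConnectedDGCoalgebra.word, map_mul]
      exact SetLike.mul_mem_graded (ofCobar_gen_mem_gr k hS c.1 c.2) ih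
  exact h ha

theorem cobarEquiv_mem_gr_iff (n : ℕ) (a : CubicalMonoid.NormalizedChains k (endMonoid S x)) :
    cobarEquiv k hS a ∈ (normalizedChains k S x hS).gr n ↔
      a ∈ CubicalMonoid.gr k (endMonoid S x) n := by
  obtain ⟨b, rfl⟩ := (cobarEquiv k hS).symm.surjective a
  rw [AlgEquiv.apply_symm_apply]
  exact ⟨fun hb => ofCobar_mem_gr k hS hb, mem_of_map_mem_graded (normalizedChains k S x hS).gr
    (CubicalMonoid.gr k (endMonoid S x)) (f := (ofCobar k hS).toLinearMap)
    (cobarEquiv k hS).symm.injective fun n b hb => ofCobar_mem_gr k hS hb⟩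

theorem cobarEquiv_differential (a : CubicalMonoid.NormalizedChains k (endMonoid S x)) :
    cobarEquiv k hS (CubicalMonoid.differential k (endMonoid S x) a) =
      (normalizedChains k S x hS).D (cobarEquiv k hS a) := by
  obtain ⟨b, rfl⟩ := (cobarEquiv k hS).symm.surjective a
  rw [AlgEquiv.apply_symm_apply]
  refine (congrArg (cobarEquiv k hS) (differential_ofCobar_and_mul k hS b).1).trans ?_
  exact (cobarEquiv k hS).apply_symm_apply _

end Grading

end CubicalCobar

theorem theorem7p1 {k : Type v} [CommRing k] (S : SSet.{u}) (x : CubicalCobar.Vertices S)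
    (hS : ∀ y : CubicalCobar.Vertices S, y = x) :
    Nonempty (CubicalCobar.DGAlgebra.Iso (CubicalCobar.Lambda k S x)
      (CubicalCobar.normalizedChains k S x hS).cobar) :=
  ⟨{ equiv := CubicalCobar.cobarEquiv k hS
     mem_gr_iff := CubicalCobar.cobarEquiv_mem_gr_iff k hS
     map_d := CubicalCobar.cobarEquiv_differential k hS }⟩
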